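/- **Notation.** Let $\mathrm{QI}$ be the set of real quadratic irrationals and $S(y)=\frac1y-\lfloor\frac1y\rfloor$ the Gauss map. For $\alpha\in\mathrm{QI}$ let $P_\alpha\subset[0,1]$ be the (finite) period of $\alpha \bmod 1$ under $S$, i.e. the set of periodic points in its forward $S$-orbit, let $\nu_\alpha$ be the normalized counting measure on $P_\alpha$, and let $j_\alpha=1$ if $|P_\alpha|$ is even, $j_\alpha=2$ if $|P_\alpha|$ is odd. Let $d\nu_{\mathrm{Gauss}}=\frac{1}{\log 2}\frac{dx}{1+x}$ on $[0,1]$. Let $X_\infty=\mathrm{PGL}_2(\mathbb Z)\backslash \mathrm{PGL}_2(\mathbb R)$, let $m_\infty$ be the $\mathrm{PGL}_2(\mathbb R)$-invariant probability measure on $X_\infty$, and equip $X_\infty$ with the quotient $d_{X_\infty}$ of the Riemannian distance on $\mathrm{PGL}_2(\mathbb R)$ obtained by left translation from a fixed inner product on its Lie algebra that is invariant under conjugation by $\mathrm{PO}_2(\mathbb R)$. For $\alpha\in\mathrm{QI}$ with Galois conjugate $\alpha'$ put $g_\alpha=\begin{pmatrix}\alpha&\alpha'\\1&1\end{pmatrix}$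 if $\alpha>\alpha'$ and $g_\alpha=\begin{pmatrix}\alpha&-\alpha'\\1&-1\end{pmatrix}$ otherwise, and let $x_\alpha=\mathrm{PGL}_2(\mathbb Z)g_\alpha\in X_\infty$. Write $a(t)=\mathrm{diag}(e^t,1)$. The orbit $\{x_\alpha a(t):t\in\mathbb R\}$ is periodic; let $t_\alpha$ be its length (the minimal $t>0$ with $x_\alpha a(t)=x_\alpha$) and let $\mu_\alpha$ be the $\{a(t)\}$-invariant probability measure supported on it. For a metric space $Y$ and $\kappa>0$ let $\mathrm{Lip}_\kappa(Y)$ be the set of functions $f:Y\to\mathbb C$ that are Lipschitz with constant $\kappa$. **Theorem 7.5.** There are an absolute constant $c_0>0$, a constant $T_0>1$ and, for every $\epsilon>0$, a constant $C_\epsilon>0$ (where $c_0$ does not depend on the chosen inner product, and $T_0$, $C_\epsilon$ depend on no other data than this choice and, for $C_\epsilon$, on $\epsilon$) such that the following holds. Let $\alpha\in\mathrm{QI}$ and $T>T_0$ be such that $$\Big|\int f\,d\mu_\alpha-\int f\,dm_\infty\Big|\le\max\{\|f\|_2,\kappa\}\,T^{-1}$$ for every $\kappa>0$ and every $f\in\mathrm{Lip}_\kappa(X_\infty)\cap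 L^2(X_\infty,m_\infty)$. Then, for every $\epsilon>0$: 1. for every $\kappa>0$ and every $f\in\mathrm{Lip}_\kappa([0,1])$, $$\Big|\int_0^1 f\,d\nu_\alpha-\int_0^1 f\,d\nu_{\mathrm{Gauss}}\Big|\le C_\epsilon\max\{\|f\|_\infty,\kappa\}\,T^{-\frac13+\epsilon};$$ 2. $$\Big|\frac{|P_\alpha|}{t_\alpha}-\frac1{j_\alpha c_0}\Big|\le C_\epsilon\,T^{-\frac13+\epsilon}.$$ -/

import Mathlib

open MeasureTheory ProbabilityTheory
open scoped ENNReal NNReal MatrixGroups IntermediateField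

noncomputable section

namespace CFGeodesic

/-! ### Continued fractions -/

/-- The Gauss map `S y = 1 / y - ⌊1 / y⌋`. -/
def gaussMap (y : ℝ) : ℝ := Int.fract y⁻¹

/-- The set of real quadratic irrationals. -/
def QI : Set ℝ := {α | Module.finrank ℚ ℚ⟮α⟯ = 2}

/-- The period `P_α` of `α mod 1` under the Gauss map: the points of the forward orbit of
`α mod 1` that are periodic. -/
def cfPeriod (α : ℝ) : Set ℝ :=
  {y | ∃ n : ℕ, gaussMap^[n] (Int.fract α) = y} ∩ Function.periodicPts gaussMap

/-- `ν_α`, the normalized counting measure on `P_α`. -/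
def nuPeriod (α : ℝ) : Measure ℝ := uniformOn (cfPeriod α)

/-- The Gauss-Kuzmin measure `(1 / log 2) dx / (1 + x)` on `[0, 1]`. -/
def nuGauss : Measure ℝ :=
  (volume.restrict (Set.Icc 0 1)).withDensity
    fun x => ENNReal.ofReal (1 / (Real.log 2 * (1 + x)))

/-- `j_α`: it is `1` if `|P_α|` is even and `2` if `|P_α|` is odd. -/
def parityIndex (α : ℝ) : ℕ := if Even (cfPeriod α).ncard then 1 else 2

/-! ### The space `X_∞ = PGL₂(ℤ) \ PGL₂(ℝ)` -/

/-- `PGL₂(ℤ)` as a subgroup of `PGL₂(ℝ)`. -/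
def gammaInf : Subgroup PGL(2, ℝ) :=
  (Matrix.ProjGenLinGroup.map (n := Fin 2) (Int.castRingHom ℝ)).range

/-- The space of cosets `Γ g`, for `Γ = PGL₂(ℤ)` and `g ∈ PGL₂(ℝ)`. -/
def XInf : Type := Quotient (QuotientGroup.rightRel gammaInf)

/-- The projection `g ↦ Γ g`. -/
def XInf.mk (g : PGL(2, ℝ)) : XInf := Quotient.mk (QuotientGroup.rightRel gammaInf) g

/-- The quotient topology (from `GL₂(ℝ)`, through `PGL₂(ℝ)`). -/
instance : TopologicalSpace XInf :=
  TopologicalSpace.coinduced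
    (fun g : GL (Fin 2) ℝ => XInf.mk (Matrix.ProjGenLinGroup.mk g)) inferInstance

instance : MeasurableSpace XInf := borel XInf

instance : BorelSpace XInf := ⟨rfl⟩

/-- The right translation `(Γ g) h = Γ (g h)`. -/
def XInf.translate (x : XInf) (h : PGL(2, ℝ)) : XInf :=
  Quotient.map' (· * h)
    (fun a b hab => by
      rw [QuotientGroup.rightRel_apply] at hab ⊢
      simpa [mul_assoc] using hab) x

/-! ### The Riemannian metric -/

/-- The image of a matrix in the Lie algebra `𝔤𝔩₂ / scalars` of `PGL₂(ℝ)`, which is identified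
with the space of traceless matrices. -/
def tracelessPart (A : Matrix (Fin 2) (Fin 2) ℝ) : LieAlgebra.SpecialLinear.sl (Fin 2) ℝ :=
  ⟨A - (A.trace / 2) • (1 : Matrix (Fin 2) (Fin 2) ℝ), by
    show _ ∈ LinearMap.ker (Matrix.traceLinearMap (Fin 2) ℝ ℝ)
    simp [Matrix.trace_fin_two]⟩

/-- An inner product on the Lie algebra of `PGL₂(ℝ)` that is invariant under conjugation by
the maximal compact subgroup `PO₂(ℝ)`. -/
structure InvInnerProduct where
  form : LinearMap.BilinForm ℝ (LieAlgebra.SpecialLinear.sl (Fin 2) ℝ)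
  symm : ∀ u v, form u v = form v u
  pos : ∀ u, u ≠ 0 → 0 < form u u
  invariant : ∀ k ∈ Matrix.orthogonalGroup (Fin 2) ℝ, ∀ u v,
    form (tracelessPart (k⁻¹ * u.1 * k)) (tracelessPart (k⁻¹ * v.1 * k)) = form u v

/-- A path in `GL₂(ℝ)` whose entries are continuously differentiable. -/
def IsC1Path (p : ℝ → GL (Fin 2) ℝ) : Prop :=
  ∀ i j, ContDiff ℝ 1 fun t => (p t).1 i j

/-- The left-translated velocity `p⁻¹ p'` of (the image in `PGL₂(ℝ)` of) a path. -/
def velocity (p : ℝ → GL (Fin 2) ℝ) (t : ℝ) : LieAlgebra.SpecialLinear.sl (Fin 2) ℝ :=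
  tracelessPart ((p t)⁻¹.1 * Matrix.of fun i j => deriv (fun s => (p s).1 i j) t)

/-- The length, on the time interval `[0, 1]` and for the left-invariant Riemannian metric
that `Q` induces on `PGL₂(ℝ)`, of the image of a path. -/
def pathLength (Q : InvInnerProduct) (p : ℝ → GL (Fin 2) ℝ) : ℝ≥0∞ :=
  ∫⁻ t in Set.Icc (0 : ℝ) 1, ENNReal.ofReal (Real.sqrt (Q.form (velocity p t) (velocity p t)))

/-- The left-invariant Riemannian distance on `PGL₂(ℝ)`
(it is `∞` between the two connected components). -/
def distG (Q : InvInnerProduct) (g h : PGL(2, ℝ)) : ℝ≥0∞ :=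
  ⨅ (p : ℝ → GL (Fin 2) ℝ) (_ : IsC1Path p)
    (_ : Matrix.ProjGenLinGroup.mk (p 0) = g) (_ : Matrix.ProjGenLinGroup.mk (p 1) = h),
    pathLength Q p

/-- The quotient distance on `X_∞`: the infimum of the distances between representatives. -/
def distX (Q : InvInnerProduct) (x y : XInf) : ℝ≥0∞ :=
  ⨅ (g : PGL(2, ℝ)) (h : PGL(2, ℝ)) (_ : XInf.mk g = x) (_ : XInf.mk h = y), distG Q g h

/-- `f : X_∞ → ℂ` is Lipschitz with constant `κ`. -/
def LipX (Q : InvInnerProduct) (κ : ℝ≥0) (f : XInf → ℂ) : Prop :=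
  ∀ x y, edist (f x) (f y) ≤ κ * distX Q x y

/-! ### The invariant probability measure -/

/-- `n(x) = (1, x; 0, 1)`. -/
def unip (x : ℝ) : GL (Fin 2) ℝ :=
  Matrix.GeneralLinearGroup.mkOfDetNeZero !![1, x; 0, 1] (by simp)

/-- `a(t) = diag(e^t, 1)`. -/
def diagExp (t : ℝ) : GL (Fin 2) ℝ :=
  Matrix.GeneralLinearGroup.mkOfDetNeZero !![Real.exp t, 0; 0, 1] (by simp)

/-- `k(θ)`, the rotation `(cos θ, -sin θ; sin θ, cos θ)`. -/
def rot (θ : ℝ) : GL (Fin 2) ℝ :=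
  Matrix.GeneralLinearGroup.mkOfDetNeZero
    !![Real.cos θ, -Real.sin θ; Real.sin θ, Real.cos θ]
    (by simp [Matrix.det_fin_two, ← sq])

/-- The class in `X_∞` of `n(x) a(s) k(θ)`, for `(x, s, θ)` the Iwasawa coordinates. -/
def iwasawa (c : ℝ × ℝ × ℝ) : XInf :=
  XInf.mk (Matrix.ProjGenLinGroup.mk (unip c.1 * diagExp c.2.1 * rot c.2.2))

/-- The standard fundamental domain in Iwasawa coordinates `(x, s, θ)`: the base point
`x + i e^s` lies in `{|Re z| ≤ 1 / 2, |z| ≥ 1}`, and `θ ∈ [0, π)`. -/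
def fundDomain : Set (ℝ × ℝ × ℝ) :=
  {c | |c.1| ≤ 1 / 2 ∧ 1 ≤ c.1 ^ 2 + Real.exp c.2.1 ^ 2 ∧ c.2.2 ∈ Set.Ico 0 Real.pi}

/-- `m_∞`, the `PGL₂(ℝ)`-invariant probability measure on `X_∞`. The Haar measure of the
(unimodular) group is `e^{-s} dx ds dθ` in Iwasawa coordinates, that is `y⁻² dx dy dθ` with
`y = e^s`; it is restricted to the fundamental domain, of volume `π² / 3`, and pushed
forward. -/
def haarX : Measure XInf :=
  Measure.map iwasawa
    (((volume : Measure (ℝ × ℝ × ℝ)).restrict fundDomain).withDensity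
      fun c => ENNReal.ofReal (3 / Real.pi ^ 2 * Real.exp (-c.2.1)))

/-! ### The periodic geodesic of a quadratic irrational -/

/-- The flow `x ↦ x a(t)`. -/
def flow (x : XInf) (t : ℝ) : XInf := x.translate (Matrix.ProjGenLinGroup.mk (diagExp t))

/-- The length `t_x` of the period: the minimal `t > 0` with `x a(t) = x`. -/
def orbitLength (x : XInf) : ℝ := sInf {t : ℝ | 0 < t ∧ flow x t = x}

/-- `μ_x`, the flow-invariant probability measure on a periodic orbit: the image of the
uniform probability measure on `[0, t_x)`. -/
def orbitMeasure (x : XInf) : Measure XInf :=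
  Measure.map (flow x) ((volume : Measure ℝ)[|Set.Ico 0 (orbitLength x)])

/-- The Galois conjugate `α'` of a quadratic irrational `α`: the other root of its minimal
polynomial `X² + b X + c`, that is `-b - α`. -/
def galConj (α : ℝ) : ℝ := -((minpoly ℚ α).coeff 1 : ℝ) - α

lemma ne_galConj {α : ℝ} (hα : α ∈ QI) : α ≠ galConj α := by
  intro h
  have h2 : α = algebraMap ℚ ℝ (-(minpoly ℚ α).coeff 1 / 2) := by
    unfold galConj at h
    simp only [eq_ratCast]
    push_cast
    linarith
  have hbot : ℚ⟮α⟯ = ⊥ := by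
    rw [IntermediateField.adjoin_simple_eq_bot_iff, IntermediateField.mem_bot]
    exact ⟨_, h2.symm⟩
  have h3 : Module.finrank ℚ ℚ⟮α⟯ = 2 := hα
  rw [hbot, IntermediateField.finrank_bot] at h3
  omega

/-- `g_α`, the matrix `(α, α'; 1, 1)` if `α > α'` and `(α, -α'; 1, -1)` otherwise. -/
def gMat (α : QI) : GL (Fin 2) ℝ :=
  if galConj α < α then
    Matrix.GeneralLinearGroup.mkOfDetNeZero !![(α : ℝ), galConj α; 1, 1]
      (by simpa [Matrix.det_fin_two, sub_eq_zero] using ne_galConj α.2)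
  else
    Matrix.GeneralLinearGroup.mkOfDetNeZero !![(α : ℝ), -galConj α; 1, -1]
      (by
        simp only [Matrix.det_fin_two_of]
        intro h
        exact ne_galConj α.2 (by linarith))

/-- `x_α = Γ g_α`. -/
def xPoint (α : QI) : XInf := XInf.mk (Matrix.ProjGenLinGroup.mk (gMat α))

/-- `t_α`, the length of the periodic orbit of `x_α`. -/
def tLength (α : QI) : ℝ := orbitLength (xPoint α)

/-- `μ_α`, the invariant probability measure on the periodic orbit of `x_α`. -/
def muPeriodic (α : QI) : Measure XInf := orbitMeasure (xPoint α)

/-- `μ_α` approximates `m_∞` to within `T⁻¹`: for every square-integrable `κ`-Lipschitz `f`,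
the integrals differ by at most `max(‖f‖₂, κ) T⁻¹`. -/
def ApproxHaar (Q : InvInnerProduct) (α : QI) (T : ℝ) : Prop :=
  ∀ (κ : ℝ≥0) (f : XInf → ℂ), 0 < κ → LipX Q κ f → MemLp f 2 haarX →
    ‖(∫ x, f x ∂(muPeriodic α)) - ∫ x, f x ∂haarX‖
      ≤ max (eLpNorm f 2 haarX).toReal κ * T⁻¹

/-- The sup norm of `f` on `[0, 1]`. -/
def supNorm01 (f : ℝ → ℂ) : ℝ := ⨆ x : Set.Icc (0 : ℝ) 1, ‖f x‖

end CFGeodesic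

end

/-! # Equidistribution of continued fraction periods from equidistribution of closed geodesics

The matrix `g` is read as the oriented geodesic with end points `ξ = g₀₀ / g₁₀` and
`-1 / ζ = g₀₁ / g₁₁`, together with the time parameter `ρ = g₁₀ / g₀₁` along it; right
multiplication by `a(t)` fixes `ξ`, `ζ` and multiplies `ρ` by `e^t`. The geodesics with
`(ξ, ζ) ∈ (0, 1)²` form a cross-section of the flow on `X_∞`, on which the first return map is the
natural extension `(ξ, ζ) ↦ (S ξ, 1 / (⌊1 / ξ⌋ + ζ))` of the Gauss map.

To a weight `ψ` on the cross-section belongs the function `poincareX ψ` on `X_∞`: the sum over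
`γ ∈ GL₂(ℤ)` of the bump `ψ(ξ, ζ) hat |ρ|` at `γ g`. It can be integrated in two ways by unfolding.

* Over the orbit of `x_α`. The geodesic of `α` is equivalent to one with `(ξ, ζ) ∈ (0, 1)²` and `ξ`
  purely periodic (`exists_reduced`), and the translates of that geodesic that meet `(0, 1)²` are
  exactly those reached by the continued fraction algorithm (`ClosedRed.exists_param`). So, for `ψ`
  supported in `(0, 1)²`, the integral over one return of the geodesic is `2 hatMass` times the sum
  of `ψ` over the points `(y, ζ)` above the period (`ClosedRed.lintegral_poincare_eq`). The
  geodesic closes up in `X_∞` after one or two returns according to the parity of `|P_α|`, since the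
  determinant of the return matrix is `(-1) ^ |P_α|` (`ClosedRed.orbitLength_eq`); this is `j_α`.
* Over `X_∞`. Unfolding over the upper half-plane and changing coordinates to `(ξ, ζ, ρ)`, in which
  Haar measure is `dξ dζ / (1 + ξ ζ)² · dρ / ρ`, gives `(12 / π²) hatMass ∬ ψ / (1 + ξ ζ)²`
  (`lintegral_poincareX_haarX_eq`). As `∫₀¹ dζ / (1 + ξ ζ)² = 1 / (1 + ξ)`, this projects to the
  density of the Gauss measure.

The hypothesis compares the two for `ψ = f(ξ)` cut off at distance `δ` from the boundary of the
square. Then `poincareX ψ` has Lipschitz constant `O(1 / δ)` (`exists_lipX`) and bounded `L²` norm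
(`exists_eLpNorm_bound`), and the cut-off costs `O(δ)` in the integral over the cross-section.
With `δ = T ^ (-1 / 2)` every error is `O(T ^ (-1 / 2))`, which is more than what is claimed. An
inner cut-off gives lower bounds, for each `f ≥ 0`, and an outer one gives an upper bound for
`f = 1`; the upper bound for `f` follows by applying the lower bound to `1 - f`
(`exists_count_estimates`). For `f = 1` this is the second claim, with `c₀ = π² / (6 log 2)`, and
the quotient of the estimates for `f` and for `1` is the first claim. -/

noncomputable section

namespace CFGeodesic

/-! ### Geodesics, end points and bumps -/

/-- The inclusion `GL₂(ℤ) → GL₂(ℝ)`. -/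
def intGL : GL (Fin 2) ℤ →* GL (Fin 2) ℝ := Matrix.GeneralLinearGroup.map (Int.castRingHom ℝ)

@[simp] lemma intGL_apply (γ : GL (Fin 2) ℤ) (i j : Fin 2) : intGL γ i j = (γ i j : ℝ) := rfl

lemma intGL_mul_apply (γ : GL (Fin 2) ℤ) (g : GL (Fin 2) ℝ) (i j : Fin 2) :
    (intGL γ * g) i j = γ i 0 * g 0 j + γ i 1 * g 1 j := by
  simp [Matrix.mul_apply, Fin.sum_univ_two]

lemma intGL_neg (γ : GL (Fin 2) ℤ) : intGL (-γ) = -intGL γ := by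
  ext i j
  simp

lemma det_int_cases (γ : GL (Fin 2) ℤ) :
    γ 0 0 * γ 1 1 - γ 0 1 * γ 1 0 = 1 ∨ γ 0 0 * γ 1 1 - γ 0 1 * γ 1 0 = -1 := by
  have := Int.isUnit_iff.1 ((Matrix.isUnit_iff_isUnit_det _).1 γ.isUnit)
  rwa [Matrix.det_fin_two] at this

lemma abs_det_int (γ : GL (Fin 2) ℤ) :
    |(γ 0 0 * γ 1 1 - γ 0 1 * γ 1 0 : ℝ)| = 1 := by
  have h : |γ 0 0 * γ 1 1 - γ 0 1 * γ 1 0| = 1 := by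
    rcases det_int_cases γ with h | h <;> rw [h] <;> rfl
  exact_mod_cast h

lemma det_real_ne (g : GL (Fin 2) ℝ) : g 0 0 * g 1 1 - g 0 1 * g 1 0 ≠ 0 := by
  have := g.det_ne_zero
  rwa [Matrix.det_fin_two] at this

/-- The forward end point `a / c` of the geodesic of `g = (a, b; c, d)`. -/
def xiC (g : GL (Fin 2) ℝ) : ℝ := g 0 0 / g 1 0

/-- The coordinate `-d / b` of the backward end point `b / d` of the geodesic of
`g = (a, b; c, d)`. -/
def zetaC (g : GL (Fin 2) ℝ) : ℝ := -(g 1 1) / g 0 1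

/-- The (exponential, signed) time coordinate `c / b` on the geodesic of `g = (a, b; c, d)`. -/
def rhoC (g : GL (Fin 2) ℝ) : ℝ := g 1 0 / g 0 1

/-- A Lipschitz bump supported on `[1 / 2, 3 / 2]`. -/
def hat (r : ℝ) : ℝ := max 0 (1 / 2 - |r - 1|)

lemma hat_nonneg (r : ℝ) : 0 ≤ hat r := le_max_left _ _

lemma hat_le (r : ℝ) : hat r ≤ 1 := by
  unfold hat
  have := abs_nonneg (r - 1)
  rw [max_le_iff]; constructor <;> linarith

lemma hat_ne_zero {r : ℝ} (h : hat r ≠ 0) : r ∈ Set.Icc (1 / 2 : ℝ) (3 / 2) := by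
  unfold hat at h
  by_contra hr
  apply h
  apply max_eq_left
  by_contra! h2
  have h3 := abs_lt.1 (show |r - 1| < 1 / 2 by linarith)
  exact hr ⟨by linarith [h3.1], by linarith [h3.2]⟩

lemma hat_lip (r s : ℝ) : |hat r - hat s| ≤ |r - s| := by
  unfold hat
  refine (abs_max_sub_max_le_max _ _ _ _).trans ?_
  simp only [sub_self, abs_zero]
  refine max_le (abs_nonneg _) ?_
  rw [show 1 / 2 - |r - 1| - (1 / 2 - |s - 1|) = |s - 1| - |r - 1| by ring]
  refine (abs_abs_sub_abs_le_abs_sub _ _).trans ?_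
  rw [abs_sub_comm r s]
  apply le_of_eq; congr 1; ring

lemma continuous_hat : Continuous hat := by unfold hat; fun_prop

/-- The bump attached to a weight `ψ` on the cross-section, thickened along the flow. -/
def phi (ψ : ℝ × ℝ → ℝ) (g : GL (Fin 2) ℝ) : ℝ := ψ (xiC g, zetaC g) * hat |rhoC g|

/-- A weight with values in `[0, 1]` and Lipschitz constant `L`, supported near the cross-section
`{(ξ, ζ) ∈ [0, 1]²}`. -/
structure IsTest (L : ℝ) (ψ : ℝ × ℝ → ℝ) : Prop where
  nonneg : ∀ p, 0 ≤ ψ p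
  le_one : ∀ p, ψ p ≤ 1
  lip : ∀ p q, |ψ p - ψ q| ≤ L * (|p.1 - q.1| + |p.2 - q.2|)
  supp : ∀ p, ψ p ≠ 0 → p.1 ∈ Set.Icc (-1 / 4 : ℝ) (5 / 4) ∧ p.2 ∈ Set.Icc (-1 / 4 : ℝ) (5 / 4)

/-- The compact (modulo scalars) part of `GL₂(ℝ)` that carries all the bumps `phi ψ`. -/
structure InBox (g : GL (Fin 2) ℝ) : Prop where
  xi : xiC g ∈ Set.Icc (-1 / 4 : ℝ) (5 / 4)
  zeta : zetaC g ∈ Set.Icc (-1 / 4 : ℝ) (5 / 4)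
  rho : |rhoC g| ∈ Set.Icc (1 / 2 : ℝ) (3 / 2)

lemma InBox.c_ne {g : GL (Fin 2) ℝ} (h : InBox g) : g 1 0 ≠ 0 := by
  intro h0
  have := h.rho.1
  simp only [rhoC, h0, zero_div, abs_zero] at this
  norm_num at this

lemma InBox.b_ne {g : GL (Fin 2) ℝ} (h : InBox g) : g 0 1 ≠ 0 := by
  intro h0
  have := h.rho.1
  simp only [rhoC, h0, div_zero, abs_zero] at this
  norm_num at this

lemma phi_nonneg {L : ℝ} {ψ : ℝ × ℝ → ℝ} (hψ : IsTest L ψ) (g : GL (Fin 2) ℝ) : 0 ≤ phi ψ g :=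
  mul_nonneg (hψ.nonneg _) (hat_nonneg _)

lemma phi_le_one {L : ℝ} {ψ : ℝ × ℝ → ℝ} (hψ : IsTest L ψ) (g : GL (Fin 2) ℝ) : phi ψ g ≤ 1 :=
  mul_le_one₀ (hψ.le_one _) (hat_nonneg _) (hat_le _)

lemma inBox_of_phi_ne_zero {L : ℝ} {ψ : ℝ × ℝ → ℝ} (hψ : IsTest L ψ) {g : GL (Fin 2) ℝ}
    (h : phi ψ g ≠ 0) : InBox g := by
  have h1 := hψ.supp _ (left_ne_zero_of_mul h)
  exact ⟨h1.1, h1.2, hat_ne_zero (right_ne_zero_of_mul h)⟩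

section scaling

variable {g h : GL (Fin 2) ℝ} {u v : ℝ}

/-- The effect on the coordinates of rescaling the two columns. -/
lemma coords_of_cols (hu : u ≠ 0) (hv : v ≠ 0) (h0 : ∀ i, h i 0 = g i 0 * u)
    (h1 : ∀ i, h i 1 = g i 1 * v) :
    xiC h = xiC g ∧ zetaC h = zetaC g ∧ rhoC h = rhoC g * (u / v) := by
  refine ⟨?_, ?_, ?_⟩
  · rw [xiC, xiC, h0, h0, mul_div_mul_right _ _ hu]
  · rw [zetaC, zetaC, h1, h1, ← neg_mul, mul_div_mul_right _ _ hv]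
  · rw [rhoC, rhoC, h0, h1, mul_div_mul_comm]

/-- A bump does not change if both columns are rescaled by factors of equal modulus. -/
lemma phi_of_cols (ψ : ℝ × ℝ → ℝ) (hu : u ≠ 0) (huv : |v| = |u|) (h0 : ∀ i, h i 0 = g i 0 * u)
    (h1 : ∀ i, h i 1 = g i 1 * v) : phi ψ h = phi ψ g := by
  have hv : v ≠ 0 := by rw [← abs_pos, huv, abs_pos]; exact hu
  obtain ⟨a, b, c⟩ := coords_of_cols hu hv h0 h1
  rw [phi, phi, a, b, c, abs_mul, abs_div, huv, div_self (by positivity), mul_one]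

end scaling

lemma phi_mul_scalar (ψ : ℝ × ℝ → ℝ) (g : GL (Fin 2) ℝ) (u : ℝˣ) :
    phi ψ (g * Matrix.GeneralLinearGroup.scalar (Fin 2) u) = phi ψ g :=
  phi_of_cols ψ (u := u) (v := u) u.ne_zero rfl (by simp [Matrix.GeneralLinearGroup.scalar])
    (by simp [Matrix.GeneralLinearGroup.scalar])

/-! ### The Poincaré series of a bump -/

/-- The sum of the bump over `GL₂(ℤ)` (so that each element of `PGL₂(ℤ)` counts twice). -/
def poincare (ψ : ℝ × ℝ → ℝ) (g : GL (Fin 2) ℝ) : ℝ≥0∞ :=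
  ∑' γ : GL (Fin 2) ℤ, ENNReal.ofReal (phi ψ (intGL γ * g))

lemma poincare_int_mul (ψ : ℝ × ℝ → ℝ) (δ : GL (Fin 2) ℤ) (g : GL (Fin 2) ℝ) :
    poincare ψ (intGL δ * g) = poincare ψ g := by
  unfold poincare
  rw [← (Equiv.mulRight δ).tsum_eq (fun γ => ENNReal.ofReal (phi ψ (intGL γ * g)))]
  simp [mul_assoc]

lemma poincare_mul_scalar (ψ : ℝ × ℝ → ℝ) (g : GL (Fin 2) ℝ) (u : ℝˣ) :
    poincare ψ (g * Matrix.GeneralLinearGroup.scalar (Fin 2) u) = poincare ψ g := by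
  unfold poincare
  simp_rw [← mul_assoc, phi_mul_scalar]

/-- The projection `GL₂(ℝ) → X_∞`. -/
def proj (g : GL (Fin 2) ℝ) : XInf := XInf.mk (Matrix.ProjGenLinGroup.mk g)

lemma proj_surjective : Function.Surjective proj := by
  intro x
  obtain ⟨y, hy⟩ := Quotient.exists_rep x
  obtain ⟨g, rfl⟩ := Matrix.ProjGenLinGroup.mk_surjective y
  exact ⟨g, hy⟩

lemma proj_eq_iff {g h : GL (Fin 2) ℝ} :
    proj g = proj h ↔ ∃ (γ : GL (Fin 2) ℤ) (u : ℝˣ),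
      h = intGL γ * g * Matrix.GeneralLinearGroup.scalar (Fin 2) u := by
  change (Quotient.mk (QuotientGroup.rightRel gammaInf) (Matrix.ProjGenLinGroup.mk g) =
    Quotient.mk (QuotientGroup.rightRel gammaInf) (Matrix.ProjGenLinGroup.mk h)) ↔ _
  rw [Quotient.eq, QuotientGroup.rightRel_apply, gammaInf, MonoidHom.mem_range]
  constructor
  · rintro ⟨y, hy⟩
    obtain ⟨γ, rfl⟩ := Matrix.ProjGenLinGroup.mk_surjective y
    rw [Matrix.ProjGenLinGroup.map_mk, eq_mul_inv_iff_mul_eq, ← map_mul,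
      Matrix.ProjGenLinGroup.mk_eq_mk_iff] at hy
    obtain ⟨u, hu⟩ := hy
    exact ⟨γ, u, hu.symm⟩
  · rintro ⟨γ, u, rfl⟩
    refine ⟨Matrix.ProjGenLinGroup.mk γ, ?_⟩
    rw [Matrix.ProjGenLinGroup.map_mk, eq_mul_inv_iff_mul_eq, ← map_mul,
      Matrix.ProjGenLinGroup.mk_eq_mk_iff]
    exact ⟨u, rfl⟩

/-- The Poincaré series as a function on `X_∞`. -/
def poincareX (ψ : ℝ × ℝ → ℝ) (x : XInf) : ℝ≥0∞ :=
  poincare ψ (Function.surjInv proj_surjective x)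

lemma poincareX_proj (ψ : ℝ × ℝ → ℝ) (g : GL (Fin 2) ℝ) :
    poincareX ψ (proj g) = poincare ψ g := by
  obtain ⟨γ, u, hu⟩ := proj_eq_iff.1 (Function.surjInv_eq proj_surjective (proj g))
  unfold poincareX
  conv_rhs => rw [hu]
  rw [poincare_mul_scalar, poincare_int_mul]

/-! ### Finiteness of the Poincaré series -/

/-- If an integral matrix with rows `(p, q)`, `(r, s)` maps one point of the box to another, then
`r x + s` and `p - q z` are the factors by which it rescales the columns. Their product is bounded
since the determinant is `±1`, and they are comparable, so each of them is bounded; they determine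
the entries. -/
lemma entry_bound {p q r s x z x' z' : ℝ} (hx : x ∈ Set.Icc (-1 / 4 : ℝ) (5 / 4))
    (hz : z ∈ Set.Icc (-1 / 4 : ℝ) (5 / 4)) (hx' : x' ∈ Set.Icc (-1 / 4 : ℝ) (5 / 4))
    (hz' : z' ∈ Set.Icc (-1 / 4 : ℝ) (5 / 4))
    (h1 : p * x + q = x' * (r * x + s)) (h2 : r - s * z = -z' * (p - q * z))
    (hdet : |p * s - q * r| = 1) (hR : |r * x + s| ≤ 3 * |p - q * z|)
    (hU : |p - q * z| ≤ 3 * |r * x + s|) :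
    |p| ≤ 20 ∧ |q| ≤ 20 ∧ |r| ≤ 20 ∧ |s| ≤ 20 := by
  have key : ∀ {x z : ℝ}, x ∈ Set.Icc (-1 / 4 : ℝ) (5 / 4) → z ∈ Set.Icc (-1 / 4 : ℝ) (5 / 4) →
      11 / 16 ≤ 1 + x * z ∧ 1 + x * z ≤ 41 / 16 := by
    rintro x z ⟨a, b⟩ ⟨c, d⟩
    constructor <;> nlinarith
  obtain ⟨k1, k2⟩ := key hx hz
  obtain ⟨k3, k4⟩ := key hx' hz'
  set R := r * x + s with hRd
  set U := p - q * z with hUd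
  have hdet2 : R * U * (1 + x' * z') = (p * s - q * r) * (1 + x * z) := by
    have : R * U * (1 + x' * z') = R * U + (x' * R) * (z' * U) := by ring
    rw [this, ← h1, show z' * U = -(r - s * z) by rw [h2]; ring, hRd, hUd]; ring
  have hRU : |R| * |U| ≤ 4 := by
    have h3 : |R| * |U| * (1 + x' * z') = 1 + x * z := by
      have := congrArg abs hdet2
      rwa [abs_mul, abs_mul, abs_mul, hdet, one_mul, abs_of_pos (by linarith : 0 < 1 + x' * z'),
        abs_of_pos (by linarith : 0 < 1 + x * z)] at this
    have h4 : 0 ≤ |R| * |U| := by positivity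
    nlinarith
  have hR4 : |R| ≤ 4 := by nlinarith [abs_nonneg R, abs_nonneg U]
  have hU4 : |U| ≤ 4 := by nlinarith [abs_nonneg R, abs_nonneg U]
  have aux : ∀ {w : ℝ}, w ∈ Set.Icc (-1 / 4 : ℝ) (5 / 4) → |w| ≤ 5 / 4 := by
    rintro w ⟨a, b⟩; rw [abs_le]; constructor <;> linarith
  have bd : ∀ w y A B : ℝ, |A| ≤ 5 / 4 → |B| ≤ 5 / 4 → w * (1 + x * z) = y →
      |y| ≤ |A| * 4 * |B| + 4 → |w| ≤ 20 := by
    intro w y A B hA hB he hy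
    have : |w| * (1 + x * z) = |y| := by
      rw [← he, abs_mul, abs_of_pos (by linarith : 0 < 1 + x * z)]
    have h5 : |A| * 4 * |B| ≤ 25 / 4 := by nlinarith [abs_nonneg A, abs_nonneg B]
    nlinarith [abs_nonneg w]
  have bd2 : ∀ w A B : ℝ, |A| ≤ 5 / 4 → |B| ≤ 5 / 4 → w * (1 + x * z) = A * R - B * U →
      |w| ≤ 20 := by
    intro w A B hA hB he
    have : |w| * (1 + x * z) = |A * R - B * U| := by
      rw [← he, abs_mul, abs_of_pos (by linarith : 0 < 1 + x * z)]
    have h5 := abs_sub (A * R) (B * U)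
    rw [abs_mul, abs_mul] at h5
    have h6 : |A| * |R| ≤ 5 := by nlinarith [abs_nonneg A, abs_nonneg R]
    have h7 : |B| * |U| ≤ 5 := by nlinarith [abs_nonneg B, abs_nonneg U]
    nlinarith [abs_nonneg w]
  refine ⟨?_, ?_, ?_, ?_⟩
  · refine bd p (x' * R * z + U) x' z (aux hx') (aux hz) (by rw [← h1, hUd]; ring) ?_
    refine (abs_add_le _ _).trans ?_
    rw [abs_mul, abs_mul]
    gcongr
  · exact bd2 q x' x (aux hx') (aux hx) (by rw [← h1, hUd]; ring)
  · refine bd2 r z z' (aux hz) (aux hz') ?_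
    linear_combination h2
  · refine bd s (z' * U * x + R) z' x (aux hz') (aux hx) (by linear_combination (-x) * h2) ?_
    refine (abs_add_le _ _).trans ?_
    rw [abs_mul, abs_mul]
    gcongr

/-- The relations between the coordinates of `g` and of `γ g`. -/
lemma coords_int_mul (γ : GL (Fin 2) ℤ) (g : GL (Fin 2) ℝ) (hb : g 0 1 ≠ 0) (hc : g 1 0 ≠ 0) :
    (intGL γ * g) 0 0 = g 1 0 * (γ 0 0 * xiC g + γ 0 1) ∧
    (intGL γ * g) 1 0 = g 1 0 * (γ 1 0 * xiC g + γ 1 1) ∧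
    (intGL γ * g) 0 1 = g 0 1 * (γ 0 0 - γ 0 1 * zetaC g) ∧
    (intGL γ * g) 1 1 = g 0 1 * (γ 1 0 - γ 1 1 * zetaC g) := by
  simp only [intGL_mul_apply, xiC, zetaC]
  refine ⟨?_, ?_, ?_, ?_⟩ <;> field_simp <;> ring

lemma abs_entry_le {γ : GL (Fin 2) ℤ} {g : GL (Fin 2) ℝ} (h1 : InBox g)
    (h2 : InBox (intGL γ * g)) (i j : Fin 2) : |γ i j| ≤ 20 := by
  obtain ⟨e00, e10, e01, e11⟩ := coords_int_mul γ g h1.b_ne h1.c_ne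
  have hb := h1.b_ne
  have hc := h1.c_ne
  have hR : (γ 1 0 * xiC g + γ 1 1 : ℝ) ≠ 0 := by
    have := h2.c_ne; rw [e10] at this; exact right_ne_zero_of_mul this
  have hU : (γ 0 0 - γ 0 1 * zetaC g : ℝ) ≠ 0 := by
    have := h2.b_ne; rw [e01] at this; exact right_ne_zero_of_mul this
  have ex : xiC (intGL γ * g) = (γ 0 0 * xiC g + γ 0 1) / (γ 1 0 * xiC g + γ 1 1) := by
    rw [xiC, e00, e10, mul_div_mul_left _ _ hc]
  have ez : zetaC (intGL γ * g) = -(γ 1 0 - γ 1 1 * zetaC g) / (γ 0 0 - γ 0 1 * zetaC g) := by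
    rw [zetaC, e11, e01, ← mul_neg, mul_div_mul_left _ _ hb]
  have er : |rhoC (intGL γ * g)| = |rhoC g| *
      (|(γ 1 0 * xiC g + γ 1 1 : ℝ)| / |(γ 0 0 - γ 0 1 * zetaC g : ℝ)|) := by
    rw [rhoC, rhoC, e10, e01, mul_div_mul_comm, abs_mul, abs_div (_ + _)]
  have hU' := abs_pos.2 hU
  have hquo := h2.rho
  rw [er] at hquo
  have hr := h1.rho
  set Q := |(γ 1 0 * xiC g + γ 1 1 : ℝ)| / |(γ 0 0 - γ 0 1 * zetaC g : ℝ)| with hQ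
  have hQ3 : Q ≤ 3 := by nlinarith [hquo.2, hr.1]
  have hQ0 : 0 ≤ Q := by positivity
  have hQ3' : 1 ≤ 3 * Q := by nlinarith [hquo.1, hr.2]
  have hRQ : |(γ 1 0 * xiC g + γ 1 1 : ℝ)| = Q * |(γ 0 0 - γ 0 1 * zetaC g : ℝ)| := by
    rw [hQ, div_mul_cancel₀ _ hU'.ne']
  have := entry_bound h1.xi h1.zeta h2.xi h2.zeta (p := γ 0 0) (q := γ 0 1) (r := γ 1 0)
    (s := γ 1 1) (by rw [ex, div_mul_cancel₀ _ hR])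
    (by rw [ez, neg_div, neg_neg, div_mul_cancel₀ _ hU]) (abs_det_int γ)
    (by rw [hRQ]; gcongr) (by rw [hRQ]; nlinarith)
  obtain ⟨t1, t2, t3, t4⟩ := this
  fin_cases i <;> fin_cases j
  · exact_mod_cast t1
  · exact_mod_cast t2
  · exact_mod_cast t3
  · exact_mod_cast t4

lemma finite_entries_le (M : ℤ) : {γ : GL (Fin 2) ℤ | ∀ i j, |γ i j| ≤ M}.Finite := by
  have : ({A : Fin 2 → Fin 2 → ℤ | ∀ i j, A i j ∈ Set.Icc (-M) M}).Finite := by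
    have h := Set.Finite.pi' (fun i : Fin 2 =>
      Set.Finite.pi' (fun j : Fin 2 => Set.finite_Icc (-M) M))
    exact h
  refine Set.Finite.of_finite_image (f := fun γ : GL (Fin 2) ℤ => (fun i j => γ i j))
    (this.subset ?_) ?_
  · rintro _ ⟨γ, hγ, rfl⟩ i j
    exact abs_le.1 (hγ i j)
  · intro γ _ δ _ h
    ext i j
    exact congrFun (congrFun h i) j

/-- A uniform bound for the number of translates of a point in the box: any two of them differ by an
integral matrix with bounded entries. -/
lemma exists_card_bound : ∃ N : ℕ, ∀ g : GL (Fin 2) ℝ,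
    {γ : GL (Fin 2) ℤ | InBox (intGL γ * g)}.Finite ∧
    {γ : GL (Fin 2) ℤ | InBox (intGL γ * g)}.ncard ≤ N := by
  refine ⟨{γ : GL (Fin 2) ℤ | ∀ i j, |γ i j| ≤ 20}.ncard, fun g => ?_⟩
  rcases Set.eq_empty_or_nonempty {γ : GL (Fin 2) ℤ | InBox (intGL γ * g)} with h | ⟨δ, hδ⟩
  · rw [h]; simp
  have hsub : (fun γ => γ * δ⁻¹) '' {γ : GL (Fin 2) ℤ | InBox (intGL γ * g)} ⊆
      {γ : GL (Fin 2) ℤ | ∀ i j, |γ i j| ≤ 20} := by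
    rintro _ ⟨γ, hγ, rfl⟩ i j
    refine abs_entry_le (g := intGL δ * g) hδ ?_ i j
    rw [← mul_assoc, ← map_mul]
    simpa using hγ
  have hinj : Function.Injective (fun γ : GL (Fin 2) ℤ => γ * δ⁻¹) := mul_left_injective _
  have hfin := finite_entries_le 20
  refine ⟨(hfin.subset hsub).of_finite_image hinj.injOn, ?_⟩
  rw [← Set.ncard_image_of_injective _ hinj]
  exact Set.ncard_le_ncard hsub hfin

lemma poincare_eq_sum {L : ℝ} {ψ : ℝ × ℝ → ℝ} (hψ : IsTest L ψ) {g : GL (Fin 2) ℝ}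
    (S : Finset (GL (Fin 2) ℤ)) (hS : ∀ γ, InBox (intGL γ * g) → γ ∈ S) :
    poincare ψ g = ENNReal.ofReal (∑ γ ∈ S, phi ψ (intGL γ * g)) := by
  rw [ENNReal.ofReal_sum_of_nonneg fun γ _ => phi_nonneg hψ _]
  refine tsum_eq_sum fun γ hγ => ?_
  by_contra h
  refine hγ (hS γ (inBox_of_phi_ne_zero hψ fun h0 => h ?_))
  rw [h0, ENNReal.ofReal_zero]

lemma toReal_poincare_eq_sum {L : ℝ} {ψ : ℝ × ℝ → ℝ} (hψ : IsTest L ψ) {g : GL (Fin 2) ℝ}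
    (S : Finset (GL (Fin 2) ℤ)) (hS : ∀ γ, InBox (intGL γ * g) → γ ∈ S) :
    (poincare ψ g).toReal = ∑ γ ∈ S, phi ψ (intGL γ * g) := by
  rw [poincare_eq_sum hψ S hS, ENNReal.toReal_ofReal]
  exact Finset.sum_nonneg fun γ _ => phi_nonneg hψ _

/-- The Poincaré series are uniformly bounded. -/
lemma exists_poincare_bound : ∃ N : ℕ, ∀ {L : ℝ} {ψ : ℝ × ℝ → ℝ}, IsTest L ψ →
    ∀ g, poincare ψ g ≤ N := by
  obtain ⟨N, hN⟩ := exists_card_bound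
  refine ⟨N, fun {L ψ} hψ g => ?_⟩
  obtain ⟨hf, hc⟩ := hN g
  rw [poincare_eq_sum hψ hf.toFinset (by simp), ← ENNReal.ofReal_natCast]
  apply ENNReal.ofReal_le_ofReal
  refine (Finset.sum_le_card_nsmul _ _ 1 fun γ _ => phi_le_one hψ _).trans ?_
  rw [← Set.ncard_eq_toFinset_card _ hf, nsmul_eq_mul, mul_one]
  exact_mod_cast hc

/-! ### The invariant inner product in coordinates -/

/-- The traceless matrix with entries `(x₀, x₁; x₂, -x₀)`. -/
def slOf (x : Fin 3 → ℝ) : LieAlgebra.SpecialLinear.sl (Fin 2) ℝ :=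
  tracelessPart !![x 0, x 1; x 2, -x 0]

lemma slOf_val (x : Fin 3 → ℝ) : (slOf x).1 = !![x 0, x 1; x 2, -x 0] := by
  simp [slOf, tracelessPart, Matrix.trace_fin_two]

lemma slOf_eq (x : Fin 3 → ℝ) :
    slOf x = x 0 • slOf ![1, 0, 0] + x 1 • slOf ![0, 1, 0] + x 2 • slOf ![0, 0, 1] := by
  apply Subtype.ext
  change (slOf x).1 = x 0 • (slOf ![1, 0, 0]).1 + x 1 • (slOf ![0, 1, 0]).1
    + x 2 • (slOf ![0, 0, 1]).1
  simp only [slOf_val]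
  ext i j
  fin_cases i <;> fin_cases j <;> simp

lemma slOf_ne_zero {x : Fin 3 → ℝ} (hx : x ≠ 0) : slOf x ≠ 0 := by
  intro h
  apply hx
  have h1 : (slOf x).1 = 0 := by rw [h]; rfl
  rw [slOf_val] at h1
  have e := fun i j => congrFun (congrFun h1 i) j
  ext i
  fin_cases i
  · simpa using e 0 0
  · simpa using e 0 1
  · simpa using e 1 0

/-- The quadratic form of `Q` in coordinates. -/
def qform (Q : InvInnerProduct) (x : Fin 3 → ℝ) : ℝ := Q.form (slOf x) (slOf x)

lemma qform_eq (Q : InvInnerProduct) (x : Fin 3 → ℝ) :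
    qform Q x = ∑ i, ∑ j, x i * x j *
      Q.form (slOf (Pi.single i 1)) (slOf (Pi.single j 1)) := by
  have e0 : (Pi.single 0 1 : Fin 3 → ℝ) = ![1, 0, 0] := by ext i; fin_cases i <;> rfl
  have e1 : (Pi.single 1 1 : Fin 3 → ℝ) = ![0, 1, 0] := by ext i; fin_cases i <;> rfl
  have e2 : (Pi.single 2 1 : Fin 3 → ℝ) = ![0, 0, 1] := by ext i; fin_cases i <;> rfl
  rw [qform, slOf_eq x]
  simp only [Fin.sum_univ_three, e0, e1, e2, map_add, map_smul, LinearMap.add_apply,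
    LinearMap.smul_apply, smul_eq_mul]
  ring

lemma continuous_qform (Q : InvInnerProduct) : Continuous (qform Q) := by
  have : qform Q = fun x => ∑ i, ∑ j, x i * x j *
      Q.form (slOf (Pi.single i 1)) (slOf (Pi.single j 1)) := funext (qform_eq Q)
  rw [this]
  fun_prop

lemma qform_smul (Q : InvInnerProduct) (c : ℝ) (x : Fin 3 → ℝ) :
    qform Q (c • x) = c ^ 2 * qform Q x := by
  rw [qform_eq, qform_eq, Finset.mul_sum]
  refine Finset.sum_congr rfl fun i _ => ?_
  rw [Finset.mul_sum]
  refine Finset.sum_congr rfl fun j _ => ?_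
  simp only [Pi.smul_apply, smul_eq_mul]
  ring

/-- The coordinates of a tangent vector are controlled by its length. -/
lemma exists_coord_bound (Q : InvInnerProduct) :
    ∃ C : ℝ, 0 < C ∧ ∀ x : Fin 3 → ℝ, ∀ i, |x i| ≤ C * Real.sqrt (qform Q x) := by
  have hK : IsCompact (Metric.sphere (0 : Fin 3 → ℝ) 1) := isCompact_sphere _ _
  have hne : (Metric.sphere (0 : Fin 3 → ℝ) 1).Nonempty := by
    exact ⟨fun _ => 1, by simp⟩
  obtain ⟨y, hy, hmin⟩ := hK.exists_isMinOn hne (continuous_qform Q).continuousOn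
  have hy0 : y ≠ 0 := by
    rintro rfl
    simp at hy
  have hm : 0 < qform Q y := Q.pos _ (slOf_ne_zero hy0)
  refine ⟨1 / Real.sqrt (qform Q y), by positivity, fun x i => ?_⟩
  rcases eq_or_ne x 0 with rfl | hx
  · simp only [Pi.zero_apply, abs_zero]; positivity
  have hn : 0 < ‖x‖ := norm_pos_iff.2 hx
  have h1 : qform Q y ≤ qform Q (‖x‖⁻¹ • x) := hmin (by simp [norm_smul, hn.ne'])
  rw [qform_smul] at h1
  have h2 : ‖x‖ ^ 2 * qform Q y ≤ qform Q x := by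
    calc ‖x‖ ^ 2 * qform Q y ≤ ‖x‖ ^ 2 * (‖x‖⁻¹ ^ 2 * qform Q x) := by gcongr
      _ = qform Q x := by field_simp
  have h3 : ‖x‖ * Real.sqrt (qform Q y) ≤ Real.sqrt (qform Q x) := by
    rw [← Real.sqrt_sq hn.le, ← Real.sqrt_mul (by positivity)]
    exact Real.sqrt_le_sqrt h2
  rw [div_mul_eq_mul_div, one_mul, le_div_iff₀ (Real.sqrt_pos.2 hm)]
  refine le_trans ?_ h3
  gcongr
  exact norm_le_pi_norm x i

/-! ### Velocities of paths -/

/-- The full (not yet traceless) left-translated velocity of a path. -/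
def fullVel (p : ℝ → GL (Fin 2) ℝ) (t : ℝ) : Matrix (Fin 2) (Fin 2) ℝ :=
  (p t)⁻¹.1 * Matrix.of fun i j => deriv (fun s => (p s).1 i j) t

/-- The coordinates of the velocity of a path. -/
def velC (p : ℝ → GL (Fin 2) ℝ) (t : ℝ) : Fin 3 → ℝ :=
  ![(fullVel p t 0 0 - fullVel p t 1 1) / 2, fullVel p t 0 1, fullVel p t 1 0]

lemma velocity_eq (p : ℝ → GL (Fin 2) ℝ) (t : ℝ) : velocity p t = slOf (velC p t) := by
  apply Subtype.ext
  rw [slOf_val]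
  change fullVel p t - (Matrix.trace (fullVel p t) / 2) • 1 = _
  ext i j
  fin_cases i <;> fin_cases j <;> simp [Matrix.trace_fin_two, velC] <;> ring

lemma pathLength_eq (Q : InvInnerProduct) (p : ℝ → GL (Fin 2) ℝ) :
    pathLength Q p =
      ∫⁻ t in Set.Icc (0 : ℝ) 1, ENNReal.ofReal (Real.sqrt (qform Q (velC p t))) := by
  simp only [pathLength, velocity_eq, qform]

lemma deriv_entry (p : ℝ → GL (Fin 2) ℝ) (t : ℝ) (i j : Fin 2) :
    deriv (fun s => p s i j) t = p t i 0 * fullVel p t 0 j + p t i 1 * fullVel p t 1 j := by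
  have h : (p t).1 * fullVel p t = Matrix.of fun i j => deriv (fun s => (p s).1 i j) t := by
    rw [fullVel, ← mul_assoc, ← Units.val_mul, mul_inv_cancel, Units.val_one, one_mul]
  have := congrFun (congrFun h i) j
  rw [Matrix.mul_apply, Fin.sum_univ_two] at this
  exact this.symm

lemma IsC1Path.hasDerivAt {p : ℝ → GL (Fin 2) ℝ} (hp : IsC1Path p) (t : ℝ) (i j : Fin 2) :
    HasDerivAt (fun s => p s i j)
      (p t i 0 * fullVel p t 0 j + p t i 1 * fullVel p t 1 j) t := by
  rw [← deriv_entry]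
  exact ((hp i j).differentiable (by norm_num)).differentiableAt.hasDerivAt

lemma IsC1Path.continuous {p : ℝ → GL (Fin 2) ℝ} (hp : IsC1Path p) (i j : Fin 2) :
    Continuous (fun s => p s i j) := (hp i j).continuous

lemma IsC1Path.continuous_fullVel {p : ℝ → GL (Fin 2) ℝ} (hp : IsC1Path p) (i j : Fin 2) :
    Continuous (fun t => fullVel p t i j) := by
  have hd : ∀ i j, Continuous (fun t => deriv (fun s => (p s).1 i j) t) := fun i j =>
    (hp i j).continuous_deriv le_rfl
  have hc : ∀ i j, Continuous (fun t => (p t).1 i j) := fun i j => (hp i j).continuous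
  have hinv : ∀ i j, Continuous (fun t => (p t)⁻¹.1 i j) := by
    intro i j
    have : (fun t => (p t)⁻¹.1 i j) = fun t => (p t).1.det⁻¹ * (p t).1.adjugate i j := by
      funext t
      rw [Matrix.coe_units_inv, Matrix.inv_def, Matrix.smul_apply, Ring.inverse_eq_inv',
        smul_eq_mul]
    rw [this]
    have hdet : Continuous fun t => (p t).1.det :=
      Continuous.matrix_det (continuous_matrix hc)
    refine (hdet.inv₀ fun t => (p t).det_ne_zero).mul ?_
    exact (Continuous.matrix_adjugate (continuous_matrix hc)).matrix_elem i j
  simp only [fullVel, Matrix.mul_apply, Matrix.of_apply]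
  exact continuous_finsetSum _ fun k _ => (hinv i k).mul (hd k j)

lemma IsC1Path.continuous_velC {p : ℝ → GL (Fin 2) ℝ} (hp : IsC1Path p) :
    Continuous (velC p) := by
  have := hp.continuous_fullVel
  refine continuous_pi fun i => ?_
  fin_cases i
  · exact (((this 0 0).sub (this 1 1)).div_const 2)
  · exact this 0 1
  · exact this 1 0

lemma IsC1Path.mul_left {p : ℝ → GL (Fin 2) ℝ} (hp : IsC1Path p) (h : GL (Fin 2) ℝ) :
    IsC1Path fun t => h * p t := by
  intro i j
  have := hp
  simp only [Units.val_mul, Matrix.mul_apply, Fin.sum_univ_two]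
  exact (contDiff_const.mul (hp 0 j)).add (contDiff_const.mul (hp 1 j))

lemma IsC1Path.fullVel_mul_left {p : ℝ → GL (Fin 2) ℝ} (hp : IsC1Path p) (h : GL (Fin 2) ℝ)
    (t : ℝ) : fullVel (fun t => h * p t) t = fullVel p t := by
  have hd : (Matrix.of fun i j => deriv (fun s => (h * p s).1 i j) t) =
      h.1 * Matrix.of fun i j => deriv (fun s => (p s).1 i j) t := by
    ext i j
    simp only [Units.val_mul, Matrix.mul_apply, Fin.sum_univ_two, Matrix.of_apply]
    have := fun i => (((hp i j).differentiable (by norm_num)).differentiableAt (x := t)).hasDerivAt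
    exact (((this 0).const_mul _).add ((this 1).const_mul _)).deriv
  rw [fullVel, fullVel, hd, mul_inv_rev, ← mul_assoc]
  congr 1
  rw [← Units.val_mul]
  simp

lemma IsC1Path.velC_mul_left {p : ℝ → GL (Fin 2) ℝ} (hp : IsC1Path p) (h : GL (Fin 2) ℝ)
    (t : ℝ) : velC (fun t => h * p t) t = velC p t := by
  simp only [velC, hp.fullVel_mul_left]

/-! ### The bump along a path -/

/-- The box in terms of closed conditions on the entries, free of divisions. -/
lemma inBox_iff (g : GL (Fin 2) ℝ) : InBox g ↔
    |g 0 0| ≤ 2 * |g 1 0| ∧ -1 / 4 * g 1 0 ^ 2 ≤ g 0 0 * g 1 0 ∧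
      g 0 0 * g 1 0 ≤ 5 / 4 * g 1 0 ^ 2 ∧ -1 / 4 * g 0 1 ^ 2 ≤ -(g 1 1) * g 0 1 ∧
      -(g 1 1) * g 0 1 ≤ 5 / 4 * g 0 1 ^ 2 ∧ 1 / 2 * |g 0 1| ≤ |g 1 0| ∧
      |g 1 0| ≤ 3 / 2 * |g 0 1| := by
  have dv : ∀ {a c k : ℝ}, c ≠ 0 → (k ≤ a / c ↔ k * c ^ 2 ≤ a * c) := by
    intro a c k hc
    rw [show a / c = a * c / c ^ 2 by field_simp, le_div_iff₀ (by positivity)]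
  have dv' : ∀ {a c k : ℝ}, c ≠ 0 → (a / c ≤ k ↔ a * c ≤ k * c ^ 2) := by
    intro a c k hc
    rw [show a / c = a * c / c ^ 2 by field_simp, div_le_iff₀ (by positivity)]
  constructor
  · intro h
    have hb := h.b_ne
    have hc := h.c_ne
    obtain ⟨⟨x1, x2⟩, ⟨z1, z2⟩, ⟨r1, r2⟩⟩ := h
    have hbp := abs_pos.2 hb
    have hcp := abs_pos.2 hc
    rw [rhoC, abs_div] at r1 r2
    rw [le_div_iff₀ hbp] at r1
    rw [div_le_iff₀ hbp] at r2
    refine ⟨?_, (dv hc).1 x1, (dv' hc).1 x2, (dv hb).1 z1, (dv' hb).1 z2, r1, r2⟩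
    rw [← div_le_iff₀ hcp, ← abs_div, abs_le]
    change -1 / 4 ≤ g 0 0 / g 1 0 at x1
    change g 0 0 / g 1 0 ≤ _ at x2
    constructor <;> linarith
  · rintro ⟨h1, h2, h3, h4, h5, h6, h7⟩
    have hc : g 1 0 ≠ 0 := by
      intro h0
      rw [h0] at h1
      have : g 0 0 = 0 := by simpa using h1
      exact det_real_ne g (by rw [this, h0]; ring)
    have hb : g 0 1 ≠ 0 := by
      intro h0
      rw [h0] at h7
      exact hc (by simpa using h7)
    have hbp := abs_pos.2 hb
    refine ⟨⟨(dv hc).2 h2, (dv' hc).2 h3⟩, ⟨(dv hb).2 h4, (dv' hb).2 h5⟩, ?_, ?_⟩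
    · rw [rhoC, abs_div, le_div_iff₀ hbp]; exact h6
    · rw [rhoC, abs_div, div_le_iff₀ hbp]; exact h7

lemma isClosed_inBox {X : Type*} [TopologicalSpace X] {f : X → GL (Fin 2) ℝ}
    (hf : ∀ i j, Continuous fun x => f x i j) : IsClosed {x | InBox (f x)} := by
  simp only [inBox_iff, Set.ofPred_and]
  have h00 := hf 0 0
  have h01 := hf 0 1
  have h10 := hf 1 0
  have h11 := hf 1 1
  refine .inter (isClosed_le ?_ ?_) <| .inter (isClosed_le ?_ ?_) <|
    .inter (isClosed_le ?_ ?_) <| .inter (isClosed_le ?_ ?_) <| .inter (isClosed_le ?_ ?_) <|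
    .inter (isClosed_le ?_ ?_) (isClosed_le ?_ ?_)
  all_goals fun_prop

lemma abs_phi_sub_le {L : ℝ} {ψ : ℝ × ℝ → ℝ} (hψ : IsTest L ψ) (g h : GL (Fin 2) ℝ) :
    |phi ψ h - phi ψ g| ≤ L * (|xiC h - xiC g| + |zetaC h - zetaC g|) + |rhoC h - rhoC g| := by
  have e : phi ψ h - phi ψ g = (ψ (xiC h, zetaC h) - ψ (xiC g, zetaC g)) * hat |rhoC h|
      + ψ (xiC g, zetaC g) * (hat |rhoC h| - hat |rhoC g|) := by unfold phi; ring
  rw [e]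
  refine (abs_add_le _ _).trans (add_le_add ?_ ?_)
  · rw [abs_mul]
    refine (mul_le_of_le_one_right (abs_nonneg _) ?_).trans (hψ.lip _ _)
    rw [abs_of_nonneg (hat_nonneg _)]; exact hat_le _
  · rw [abs_mul]
    refine (mul_le_of_le_one_left (abs_nonneg _) ?_).trans ((hat_lip _ _).trans ?_)
    · rw [abs_of_nonneg (hψ.nonneg _)]; exact hψ.le_one _
    · exact abs_abs_sub_abs_le_abs_sub _ _

lemma IsC1Path.hasDerivAt_coords {p : ℝ → GL (Fin 2) ℝ} (hp : IsC1Path p) {t : ℝ}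
    (hb : p t 0 1 ≠ 0) (hc : p t 1 0 ≠ 0) :
    HasDerivAt (fun s => xiC (p s))
      (velC p t 2 * (1 + xiC (p t) * zetaC (p t)) / rhoC (p t)) t ∧
    HasDerivAt (fun s => zetaC (p s))
      (-(velC p t 1 * (1 + xiC (p t) * zetaC (p t)) * rhoC (p t))) t ∧
    HasDerivAt (fun s => rhoC (p s)) (2 * rhoC (p t) * velC p t 0 - zetaC (p t) * velC p t 2
      - rhoC (p t) ^ 2 * xiC (p t) * velC p t 1) t := by
  have h := hp.hasDerivAt t
  refine ⟨?_, ?_, ?_⟩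
  · refine ((h 0 0).div (h 1 0) hc).congr_deriv ?_
    simp only [velC, xiC, zetaC, rhoC]
    simp
    field_simp
    ring
  · refine (((h 1 1).neg).div (h 0 1) hb).congr_deriv ?_
    simp only [velC, xiC, zetaC, rhoC]
    simp
    field_simp
    ring
  · refine ((h 1 0).div (h 0 1) hb).congr_deriv ?_
    simp only [velC, xiC, zetaC, rhoC]
    simp
    field_simp
    ring

/-- The left-hand side bounds the rate of change of the bump at the point with coordinates
`(x, z, r)`, for a velocity with coordinates `v0`, `v1`, `v2` in the Lie algebra. -/
lemma coord_speed_le {L x z r v0 v1 v2 s : ℝ} (hL : 0 ≤ L) (hx : x ∈ Set.Icc (-1 / 4 : ℝ) (5 / 4))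
    (hz : z ∈ Set.Icc (-1 / 4 : ℝ) (5 / 4)) (hr : |r| ∈ Set.Icc (1 / 2 : ℝ) (3 / 2))
    (h0 : |v0| ≤ s) (h1 : |v1| ≤ s) (h2 : |v2| ≤ s) :
    L * (|v2 * (1 + x * z) / r| + |-(v1 * (1 + x * z) * r)|)
      + |2 * r * v0 - z * v2 - r ^ 2 * x * v1| ≤ (10 * L + 10) * s := by
  have hs : 0 ≤ s := (abs_nonneg _).trans h0
  have aux : ∀ {w : ℝ}, w ∈ Set.Icc (-1 / 4 : ℝ) (5 / 4) → |w| ≤ 5 / 4 := by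
    rintro w ⟨a, b⟩; rw [abs_le]; constructor <;> linarith
  have hxa := aux hx
  have hza := aux hz
  have hxz : |1 + x * z| ≤ 41 / 16 := by
    refine (abs_add_le _ _).trans ?_
    rw [abs_one, abs_mul]
    nlinarith [abs_nonneg x, abs_nonneg z]
  have hrinv : |r|⁻¹ ≤ 2 := by
    rw [inv_le_comm₀ (by linarith [hr.1]) (by norm_num)]; linarith [hr.1]
  have a1 : |v2 * (1 + x * z) / r| ≤ 41 / 8 * s := by
    rw [div_eq_mul_inv, abs_mul, abs_mul, abs_inv]
    calc |v2| * |1 + x * z| * |r|⁻¹ ≤ s * (41 / 16) * 2 := by gcongr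
      _ = 41 / 8 * s := by ring
  have a2 : |-(v1 * (1 + x * z) * r)| ≤ 123 / 32 * s := by
    rw [abs_neg, abs_mul, abs_mul]
    calc |v1| * |1 + x * z| * |r| ≤ s * (41 / 16) * (3 / 2) := by gcongr; exact hr.2
      _ = 123 / 32 * s := by ring
  have a3 : |2 * r * v0 - z * v2 - r ^ 2 * x * v1| ≤ 10 * s := by
    refine (abs_sub _ _).trans ?_
    have b1 : |2 * r * v0 - z * v2| ≤ |2 * r * v0| + |z * v2| := abs_sub _ _
    have b2 : |2 * r * v0| ≤ 3 * s := by
      rw [abs_mul, abs_mul, abs_two]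
      calc 2 * |r| * |v0| ≤ 2 * (3 / 2) * s := by gcongr; exact hr.2
        _ = 3 * s := by ring
    have b3 : |z * v2| ≤ 5 / 4 * s := by rw [abs_mul]; gcongr
    have b4 : |r ^ 2 * x * v1| ≤ 45 / 16 * s := by
      rw [abs_mul, abs_mul, abs_pow]
      calc |r| ^ 2 * |x| * |v1| ≤ (3 / 2) ^ 2 * (5 / 4) * s := by gcongr; exact hr.2
        _ = 45 / 16 * s := by ring
    linarith
  nlinarith [mul_le_mul_of_nonneg_left a1 hL, mul_le_mul_of_nonneg_left a2 hL]

/-- Along a path, the bump changes at a rate controlled by the speed. -/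
lemma IsC1Path.eventually_abs_phi_sub_le {L C : ℝ} {ψ : ℝ × ℝ → ℝ} (hψ : IsTest L ψ) (hL : 0 ≤ L)
    {Q : InvInnerProduct} (hC : ∀ x i, |x i| ≤ C * Real.sqrt (qform Q x))
    {p : ℝ → GL (Fin 2) ℝ} (hp : IsC1Path p) (t : ℝ) {r : ℝ}
    (hr : (10 * L + 10) * (C * Real.sqrt (qform Q (velC p t))) < r) :
    ∀ᶠ z in nhdsWithin t (Set.Ioi t), |phi ψ (p z) - phi ψ (p t)| ≤ r * (z - t) := by
  have hr0 : 0 < r := lt_of_le_of_lt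
    (mul_nonneg (by linarith) ((abs_nonneg _).trans (hC (velC p t) 0))) hr
  by_cases hbox : InBox (p t)
  · obtain ⟨d1, d2, d3⟩ := hp.hasDerivAt_coords hbox.b_ne hbox.c_ne
    have hv := fun i => hC (velC p t) i
    have hsp := coord_speed_le hL hbox.xi hbox.zeta hbox.rho (hv 0) (hv 1) (hv 2)
    have tend := (((hasDerivAt_iff_tendsto_slope.1 d1).abs.add
      (hasDerivAt_iff_tendsto_slope.1 d2).abs).const_mul L).add
      (hasDerivAt_iff_tendsto_slope.1 d3).abs
    have tend' := tend.mono_left (nhdsWithin_mono t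
      (fun x (hx : x ∈ Set.Ioi t) => (ne_of_gt hx : x ≠ t)))
    filter_upwards [tend'.eventually_lt_const (lt_of_le_of_lt hsp hr), self_mem_nhdsWithin]
      with z hz hzt
    have hzt' : 0 < z - t := sub_pos.2 hzt
    refine (abs_phi_sub_le hψ _ _).trans ?_
    have e : ∀ f : ℝ → ℝ, |f z - f t| = |slope f t z| * (z - t) := by
      intro f
      rw [slope_def_field, abs_div, abs_of_pos hzt', div_mul_cancel₀ _ hzt'.ne']
    rw [e (fun s => xiC (p s)), e (fun s => zetaC (p s)), e (fun s => rhoC (p s)), ← add_mul,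
      ← mul_assoc, ← add_mul]
    gcongr
  · have hopen : IsOpen {s | InBox (p s)}ᶜ :=
      (isClosed_inBox fun i j => hp.continuous i j).isOpen_compl
    have hev : ∀ᶠ z in nhds t, ¬ InBox (p z) := hopen.mem_nhds hbox
    have hz0 : ∀ z, ¬ InBox (p z) → phi ψ (p z) = 0 := fun z hz => by
      by_contra h; exact hz (inBox_of_phi_ne_zero hψ h)
    filter_upwards [hev.filter_mono nhdsWithin_le_nhds, self_mem_nhdsWithin] with z hz hzt
    rw [hz0 z hz, hz0 t hbox, sub_zero, abs_zero]
    exact mul_nonneg hr0.le (sub_pos.2 hzt).le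

lemma continuous_phi_comp {X : Type*} [TopologicalSpace X] {L : ℝ} {ψ : ℝ × ℝ → ℝ}
    (hψ : IsTest L ψ) {f : X → GL (Fin 2) ℝ} (hf : ∀ i j, Continuous fun x => f x i j) :
    Continuous fun x => phi ψ (f x) := by
  rw [continuous_iff_continuousAt]
  intro x
  by_cases hbox : InBox (f x)
  · have hcont : ∀ {a b : X → ℝ}, Continuous a → Continuous b → b x ≠ 0 →
        ContinuousAt (fun y => a y / b y) x := fun ha hb h0 =>
      ha.continuousAt.div hb.continuousAt h0
    have h1 : ContinuousAt (fun y => xiC (f y)) x := hcont (hf 0 0) (hf 1 0) hbox.c_ne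
    have h2 : ContinuousAt (fun y => zetaC (f y)) x := hcont (hf 1 1).neg (hf 0 1) hbox.b_ne
    have h3 : ContinuousAt (fun y => rhoC (f y)) x := hcont (hf 1 0) (hf 0 1) hbox.b_ne
    have t : Filter.Tendsto (fun y => L * (|xiC (f y) - xiC (f x)| + |zetaC (f y) - zetaC (f x)|)
        + |rhoC (f y) - rhoC (f x)|) (nhds x) (nhds 0) := by
      have t1 := ((tendsto_iff_dist_tendsto_zero.1 h1.tendsto).add
        (tendsto_iff_dist_tendsto_zero.1 h2.tendsto)).const_mul L
      have t2 := t1.add (tendsto_iff_dist_tendsto_zero.1 h3.tendsto)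
      simpa [Real.dist_eq] using t2
    rw [ContinuousAt, tendsto_iff_dist_tendsto_zero]
    refine squeeze_zero (fun _ => dist_nonneg) (fun y => ?_) t
    rw [Real.dist_eq]
    exact abs_phi_sub_le hψ _ _
  · have hev : ∀ᶠ z in nhds x, ¬ InBox (f z) := (isClosed_inBox hf).isOpen_compl.mem_nhds hbox
    have hz0 : ∀ z, ¬ InBox (f z) → phi ψ (f z) = 0 := fun z hz => by
      by_contra h; exact hz (inBox_of_phi_ne_zero hψ h)
    refine ContinuousAt.congr (continuousAt_const (y := (0 : ℝ))) ?_
    filter_upwards [hev] with z hz using (hz0 z hz).symm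

/-- The change of the bump along a path is bounded by the length of the path, whether or not the
path stays in the box: outside of it the bump vanishes. -/
lemma IsC1Path.abs_phi_sub_le {L C : ℝ} {ψ : ℝ × ℝ → ℝ} (hψ : IsTest L ψ) (hL : 0 ≤ L)
    {Q : InvInnerProduct} (hC0 : 0 < C) (hC : ∀ x i, |x i| ≤ C * Real.sqrt (qform Q x))
    {p : ℝ → GL (Fin 2) ℝ} (hp : IsC1Path p) :
    ENNReal.ofReal |phi ψ (p 1) - phi ψ (p 0)| ≤
      ENNReal.ofReal ((10 * L + 10) * C) * pathLength Q p := by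
  set K := (10 * L + 10) * C with hK
  have hK0 : 0 ≤ K := by positivity
  set s : ℝ → ℝ := fun t => Real.sqrt (qform Q (velC p t)) with hs
  have hsc : Continuous s := ((continuous_qform Q).comp hp.continuous_velC).sqrt
  have hint : pathLength Q p = ENNReal.ofReal (∫ t in (0 : ℝ)..1, s t) := by
    rw [pathLength_eq, intervalIntegral.integral_of_le zero_le_one,
      ← integral_Icc_eq_integral_Ioc, ofReal_integral_eq_lintegral_ofReal]
    · exact hsc.continuousOn.integrableOn_compact isCompact_Icc
    · exact Filter.Eventually.of_forall fun t => Real.sqrt_nonneg _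
  rw [hint, ← ENNReal.ofReal_mul hK0]
  apply ENNReal.ofReal_le_ofReal
  have hB : ∀ x, HasDerivAt (fun x => K * ∫ t in (0 : ℝ)..x, s t) (K * s x) x := fun x =>
    (hsc.integral_hasStrictDerivAt 0 x).hasDerivAt.const_mul K
  have hev : ∀ x r, K * s x < r →
      ∀ᶠ z in nhdsWithin x (Set.Ioi x), |phi ψ (p z) - phi ψ (p x)| ≤ r * (z - x) :=
    fun x r hr => hp.eventually_abs_phi_sub_le hψ hL hC x (by rw [hK, mul_assoc] at hr; exact hr)
  have hcont : Continuous fun t => phi ψ (p t) := continuous_phi_comp hψ hp.continuous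
  have key : ∀ σ : ℝ, |σ| = 1 →
      σ * (phi ψ (p 1) - phi ψ (p 0)) ≤ K * ∫ t in (0 : ℝ)..1, s t := by
    intro σ hσ
    refine image_le_of_liminf_slope_right_le_deriv_boundary
      (f := fun t => σ * (phi ψ (p t) - phi ψ (p 0)))
      (B := fun x => K * ∫ t in (0 : ℝ)..x, s t) (B' := fun x => K * s x) (a := 0) (b := 1)
      (continuous_const.mul (hcont.sub continuous_const)).continuousOn (by simp)
      (fun x _ => (hB x).continuousAt.continuousWithinAt)
      (fun x _ => (hB x).hasDerivWithinAt) (fun x _ r hr => ?_) ⟨zero_le_one, le_rfl⟩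
    obtain ⟨r', hr1, hr2⟩ := exists_between hr
    refine Filter.Eventually.frequently ?_
    filter_upwards [hev x r' hr1, self_mem_nhdsWithin] with z hz hzx
    have hzx' : 0 < z - x := sub_pos.2 hzx
    rw [slope_def_field]
    refine lt_of_le_of_lt ?_ hr2
    rw [div_le_iff₀ hzx']
    refine le_trans ?_ hz
    rw [← mul_sub, sub_sub_sub_cancel_right]
    refine (le_abs_self _).trans ?_
    rw [abs_mul, hσ, one_mul]
  rw [abs_le]
  have h1 := key 1 abs_one
  have h2 := key (-1) (by simp)
  constructor <;> linarith

/-! ### Lipschitz bound and integrability of the Poincaré series on `X_∞` -/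

/-- The Poincaré series of a weight with Lipschitz constant `L ≥ 1` is Lipschitz on `X_∞`, with a
constant proportional to `L`. -/
lemma exists_lipX (Q : InvInnerProduct) : ∃ K : ℝ, 0 < K ∧ ∀ {L : ℝ} {ψ : ℝ × ℝ → ℝ},
    1 ≤ L → IsTest L ψ → LipX Q (K * L).toNNReal fun x => ((poincareX ψ x).toReal : ℂ) := by
  obtain ⟨N, hN⟩ := exists_card_bound
  obtain ⟨C, hC0, hC⟩ := exists_coord_bound Q
  refine ⟨(2 * N + 1) * (20 * C), by positivity, fun {L ψ} hL hψ x y => ?_⟩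
  have hL0 : 0 ≤ L := by linarith
  set κ : ℝ := (2 * N + 1) * (20 * C) * L with hκ
  have hκ0 : 0 < κ := by positivity
  have hκ' : (κ.toNNReal : ℝ≥0∞) ≠ 0 := by simpa using hκ0
  rw [mul_comm, ← ENNReal.div_le_iff_le_mul (Or.inl hκ') (Or.inl ENNReal.coe_ne_top)]
  unfold distX distG
  refine le_iInf fun g => le_iInf fun h => le_iInf fun hg => le_iInf fun hh =>
    le_iInf fun p => le_iInf fun hp => le_iInf fun h0 => le_iInf fun h1 => ?_
  rw [ENNReal.div_le_iff_le_mul (Or.inl hκ') (Or.inl ENNReal.coe_ne_top), mul_comm]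
  have ex : x = proj (p 0) := by rw [← hg, ← h0]; rfl
  have ey : y = proj (p 1) := by rw [← hh, ← h1]; rfl
  rw [ex, ey]
  simp only [poincareX_proj]
  set S := (hN (p 0)).1.toFinset ∪ (hN (p 1)).1.toFinset with hS
  have hcard : (S.card : ℝ) ≤ 2 * N := by
    have e1 := (hN (p 0)).2
    have e2 := (hN (p 1)).2
    rw [Set.ncard_eq_toFinset_card _ (hN _).1] at e1 e2
    have : S.card ≤ 2 * N := (Finset.card_union_le _ _).trans (by omega)
    exact_mod_cast this
  rw [toReal_poincare_eq_sum hψ S (fun γ hγ => by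
      rw [hS, Finset.mem_union]; left; simpa using hγ),
    toReal_poincare_eq_sum hψ S (fun γ hγ => by
      rw [hS, Finset.mem_union]; right; simpa using hγ)]
  rw [edist_dist, Complex.dist_eq, ← Complex.ofReal_sub, Complex.norm_real, Real.norm_eq_abs,
    abs_sub_comm, ← Finset.sum_sub_distrib]
  have hterm : ∀ γ ∈ S, ENNReal.ofReal |phi ψ (intGL γ * p 1) - phi ψ (intGL γ * p 0)| ≤
      ENNReal.ofReal ((10 * L + 10) * C) * pathLength Q p := by
    intro γ _
    have := (hp.mul_left (intGL γ)).abs_phi_sub_le hψ hL0 hC0 hC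
    rwa [show pathLength Q (fun t => intGL γ * p t) = pathLength Q p by
      simp only [pathLength_eq, hp.velC_mul_left]] at this
  calc ENNReal.ofReal |∑ γ ∈ S, (phi ψ (intGL γ * p 1) - phi ψ (intGL γ * p 0))|
      ≤ ENNReal.ofReal (∑ γ ∈ S, |phi ψ (intGL γ * p 1) - phi ψ (intGL γ * p 0)|) :=
        ENNReal.ofReal_le_ofReal (Finset.abs_sum_le_sum_abs _ _)
    _ = ∑ γ ∈ S, ENNReal.ofReal |phi ψ (intGL γ * p 1) - phi ψ (intGL γ * p 0)| :=
        ENNReal.ofReal_sum_of_nonneg fun _ _ => abs_nonneg _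
    _ ≤ ∑ γ ∈ S, ENNReal.ofReal ((10 * L + 10) * C) * pathLength Q p := Finset.sum_le_sum hterm
    _ = (S.card : ℝ≥0∞) * (ENNReal.ofReal ((10 * L + 10) * C) * pathLength Q p) := by
        rw [Finset.sum_const, nsmul_eq_mul]
    _ = ENNReal.ofReal (S.card * ((10 * L + 10) * C)) * pathLength Q p := by
        rw [ENNReal.ofReal_mul (Nat.cast_nonneg S.card), ENNReal.ofReal_natCast, mul_assoc]
    _ ≤ (κ.toNNReal : ℝ≥0∞) * pathLength Q p := by
        gcongr
        change _ ≤ ENNReal.ofReal κ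
        apply ENNReal.ofReal_le_ofReal
        rw [hκ]
        calc (S.card : ℝ) * ((10 * L + 10) * C) ≤ (2 * N + 1) * ((20 * L) * C) := by
              gcongr <;> linarith
          _ = _ := by ring

lemma continuous_entry (i j : Fin 2) : Continuous fun g : GL (Fin 2) ℝ => g i j :=
  Units.continuous_val.matrix_elem i j

/-- A matrix in the box is bounded in terms of its determinant, which left multiplication by
`GL₂(ℤ)` preserves up to sign; this makes the Poincaré series locally finite. -/
lemma abs_entry_le_det {k : GL (Fin 2) ℝ} (hk : InBox k) (i j : Fin 2) :
    |k i j| ≤ 16 * |k 0 0 * k 1 1 - k 0 1 * k 1 0| + 1 := by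
  have sq : ∀ x d : ℝ, x ^ 2 ≤ d → x ≤ d + 1 := fun x d h => by nlinarith [sq_nonneg (x - 1 / 2)]
  set D := |k 0 0 * k 1 1 - k 0 1 * k 1 0| with hD
  have hDg : 0 < D := abs_pos.2 (det_real_ne k)
  have hb := hk.b_ne
  have hc := hk.c_ne
  have hbp := abs_pos.2 hb
  have hcp := abs_pos.2 hc
  have hr := hk.rho
  rw [rhoC, abs_div] at hr
  have r1 := (le_div_iff₀ hbp).1 hr.1
  have r2 := (div_le_iff₀ hbp).1 hr.2
  have e1 : k 0 0 = k 1 0 * xiC k := by rw [xiC]; field_simp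
  have e2 : k 1 1 = -(k 0 1 * zetaC k) := by rw [zetaC]; field_simp
  obtain ⟨x1, x2⟩ := hk.xi
  obtain ⟨z1, z2⟩ := hk.zeta
  have hxz : 11 / 16 ≤ 1 + xiC k * zetaC k := by nlinarith
  have hxa : |xiC k| ≤ 5 / 4 := abs_le.2 ⟨by linarith, x2⟩
  have hza : |zetaC k| ≤ 5 / 4 := abs_le.2 ⟨by linarith, z2⟩
  have e3 : |k 0 1| * |k 1 0| * (1 + xiC k * zetaC k) = D := by
    rw [hD, ← abs_of_pos (by linarith : 0 < 1 + xiC k * zetaC k), ← abs_mul, ← abs_mul,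
      ← abs_neg]
    congr 1
    rw [e1, e2]
    ring
  have hbc : |k 0 1| * |k 1 0| ≤ 16 / 11 * D := by nlinarith [mul_pos hbp hcp]
  have hbb : |k 0 1| ^ 2 ≤ 3 * D := by nlinarith
  have hcc : |k 1 0| ^ 2 ≤ 7 * D := by nlinarith
  have hb1 : |k 0 1| ≤ 3 * D + 1 := sq _ _ hbb
  have hc1 : |k 1 0| ≤ 7 * D + 1 := sq _ _ hcc
  have ha1 : |k 0 0| ≤ 16 * D + 1 := by
    rw [e1, abs_mul]
    have : (|k 1 0| * |xiC k|) ^ 2 ≤ 16 * D := by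
      rw [mul_pow]
      calc |k 1 0| ^ 2 * |xiC k| ^ 2 ≤ (7 * D) * (5 / 4) ^ 2 := by gcongr
        _ ≤ _ := by nlinarith
    exact sq _ _ this
  have hd1 : |k 1 1| ≤ 16 * D + 1 := by
    rw [e2, abs_neg, abs_mul]
    have : (|k 0 1| * |zetaC k|) ^ 2 ≤ 16 * D := by
      rw [mul_pow]
      calc |k 0 1| ^ 2 * |zetaC k| ^ 2 ≤ (3 * D) * (5 / 4) ^ 2 := by gcongr
        _ ≤ _ := by nlinarith
    exact sq _ _ this
  fin_cases i <;> fin_cases j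
  · exact ha1
  · change |k 0 1| ≤ _; linarith
  · change |k 1 0| ≤ _; linarith
  · exact hd1

/-- Near a given matrix, only finitely many translates reach the box. -/
lemma exists_eventually_finite (g₀ : GL (Fin 2) ℝ) : ∃ S : Finset (GL (Fin 2) ℤ),
    ∀ᶠ g in nhds g₀, ∀ γ, InBox (intGL γ * g) → γ ∈ S := by
  set D : GL (Fin 2) ℝ → ℝ := fun g => g 0 0 * g 1 1 - g 0 1 * g 1 0 with hD
  have hDc : Continuous D := by
    have := continuous_entry
    exact ((this 0 0).mul (this 1 1)).sub ((this 0 1).mul (this 1 0))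
  set E : GL (Fin 2) ℝ → ℝ := fun g => (16 * |D g| + 1) *
    (|g 0 0| + |g 0 1| + |g 1 0| + |g 1 1|) / |D g| with hE
  have hEc : ContinuousAt E g₀ := by
    have := continuous_entry
    refine ContinuousAt.div ?_ hDc.abs.continuousAt (abs_ne_zero.2 (det_real_ne g₀))
    exact Continuous.continuousAt (((continuous_const.mul hDc.abs).add continuous_const).mul
      ((((this 0 0).abs.add (this 0 1).abs).add (this 1 0).abs).add (this 1 1).abs))
  obtain ⟨M, hM⟩ := exists_int_gt (E g₀)
  refine ⟨(finite_entries_le M).toFinset, ?_⟩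
  filter_upwards [hEc.eventually_lt_const hM] with g hg γ hγ
  rw [Set.Finite.mem_toFinset]
  have hDg : 0 < |D g| := abs_pos.2 (det_real_ne g)
  set k := intGL γ * g with hk
  have hdet : |D k| = |D g| := by
    have : D k = (γ 0 0 * γ 1 1 - γ 0 1 * γ 1 0) * D g := by
      simp only [hD, hk, intGL_mul_apply]; ring
    rw [this, abs_mul, abs_det_int, one_mul]
  have hkb : ∀ i j, |k i j| ≤ 16 * |D g| + 1 := by
    rw [← hdet]
    exact abs_entry_le_det hγ
  -- Cramer's rule bounds the entries of `γ = k g⁻¹`.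
  have cramer : ∀ x u v y z : ℝ, x * D g = u * y - v * z → |u| ≤ 16 * |D g| + 1 →
      |v| ≤ 16 * |D g| + 1 → |y| + |z| ≤ |g 0 0| + |g 0 1| + |g 1 0| + |g 1 1| → |x| < M := by
    intro x u v y z he hu hv hyz
    refine lt_of_le_of_lt ?_ hg
    rw [hE, le_div_iff₀ hDg, ← abs_mul, he]
    refine (abs_sub _ _).trans ?_
    rw [abs_mul, abs_mul]
    calc |u| * |y| + |v| * |z| ≤ (16 * |D g| + 1) * |y| + (16 * |D g| + 1) * |z| := by gcongr
      _ = (16 * |D g| + 1) * (|y| + |z|) := by ring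
      _ ≤ _ := by gcongr
  have n00 := abs_nonneg (g 0 0)
  have n01 := abs_nonneg (g 0 1)
  have n10 := abs_nonneg (g 1 0)
  have n11 := abs_nonneg (g 1 1)
  have main : ∀ i j, |(γ i j : ℝ)| < M := by
    intro i j
    fin_cases j
    · refine cramer _ (k i 0) (k i 1) (g 1 1) (g 1 0) ?_ (hkb i 0) (hkb i 1) (by linarith)
      simp only [hD, hk, intGL_mul_apply, Fin.zero_eta]; ring
    · refine cramer _ (k i 1) (k i 0) (g 0 0) (g 0 1) ?_ (hkb i 1) (hkb i 0) (by linarith)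
      simp only [hD, hk, intGL_mul_apply, Fin.mk_one]; ring
  intro i j
  exact_mod_cast (main i j).le

lemma continuous_poincareX {L : ℝ} {ψ : ℝ × ℝ → ℝ} (hψ : IsTest L ψ) :
    Continuous fun x => (poincareX ψ x).toReal := by
  rw [continuous_coinduced_dom]
  change Continuous fun g => (poincareX ψ (proj g)).toReal
  simp only [poincareX_proj]
  rw [continuous_iff_continuousAt]
  intro g₀
  obtain ⟨S, hS⟩ := exists_eventually_finite g₀
  have hc : Continuous fun g => ∑ γ ∈ S, phi ψ (intGL γ * g) := by
    refine continuous_finsetSum _ fun γ _ => continuous_phi_comp hψ fun i j => ?_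
    simp only [intGL_mul_apply]
    have := continuous_entry
    exact (continuous_const.mul (this 0 j)).add (continuous_const.mul (this 1 j))
  refine hc.continuousAt.congr ?_
  filter_upwards [hS] with g hg using (toReal_poincare_eq_sum hψ S hg).symm

lemma poincareX_ne_top {L : ℝ} {ψ : ℝ × ℝ → ℝ} (hψ : IsTest L ψ) (x : XInf) :
    poincareX ψ x ≠ ⊤ := by
  obtain ⟨N, hN⟩ := exists_poincare_bound
  exact ne_top_of_le_ne_top (ENNReal.natCast_ne_top N) (hN hψ _)

lemma measurable_poincareX {L : ℝ} {ψ : ℝ × ℝ → ℝ} (hψ : IsTest L ψ) :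
    Measurable (poincareX ψ) := by
  have h := (continuous_poincareX hψ).measurable.ennreal_ofReal
  convert h using 1
  funext x
  rw [ENNReal.ofReal_toReal (poincareX_ne_top hψ x)]

lemma continuous_proj : Continuous proj := continuous_coinduced_rng

lemma continuous_GL_of_entries {X : Type*} [TopologicalSpace X] {f : X → GL (Fin 2) ℝ}
    (hf : ∀ i j, Continuous fun x => f x i j) : Continuous f := by
  rw [Units.continuous_iff]
  refine ⟨continuous_matrix hf, continuous_matrix fun i j => ?_⟩
  have hdet : Continuous fun t => (f t).1.det := Continuous.matrix_det (continuous_matrix hf)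
  have : (fun t => (f t)⁻¹.1 i j) = fun t => (f t).1.det⁻¹ * (f t).1.adjugate i j := by
    funext t
    rw [Matrix.coe_units_inv, Matrix.inv_def, Matrix.smul_apply, Ring.inverse_eq_inv', smul_eq_mul]
  change Continuous (fun t => (f t)⁻¹.1 i j)
  rw [this]
  refine (hdet.inv₀ fun t => (f t).det_ne_zero).mul ?_
  exact (Continuous.matrix_adjugate (continuous_matrix hf)).matrix_elem i j

/-- The matrix `n(x) a(s) k(θ)`. -/
def iwaMat (x s θ : ℝ) : GL (Fin 2) ℝ := unip x * diagExp s * rot θ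

lemma iwaMat_apply (x s θ : ℝ) :
    iwaMat x s θ 0 0 = Real.exp s * Real.cos θ + x * Real.sin θ ∧
    iwaMat x s θ 0 1 = -(Real.exp s * Real.sin θ) + x * Real.cos θ ∧
    iwaMat x s θ 1 0 = Real.sin θ ∧ iwaMat x s θ 1 1 = Real.cos θ := by
  simp [iwaMat, unip, diagExp, rot, Matrix.mul_apply, Fin.sum_univ_two,
    Matrix.GeneralLinearGroup.mkOfDetNeZero]

lemma continuous_iwaMat : Continuous fun c : ℝ × ℝ × ℝ => iwaMat c.1 c.2.1 c.2.2 := by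
  refine continuous_GL_of_entries fun i j => ?_
  have h := fun c : ℝ × ℝ × ℝ => iwaMat_apply c.1 c.2.1 c.2.2
  fin_cases i <;> fin_cases j <;> simp only [Fin.zero_eta, Fin.mk_one]
  · simp only [fun c => (h c).1]; fun_prop
  · simp only [fun c => (h c).2.1]; fun_prop
  · simp only [fun c => (h c).2.2.1]; fun_prop
  · simp only [fun c => (h c).2.2.2]; fun_prop

lemma iwasawa_eq (c : ℝ × ℝ × ℝ) : iwasawa c = proj (iwaMat c.1 c.2.1 c.2.2) := rfl

lemma continuous_iwasawa : Continuous iwasawa := continuous_proj.comp continuous_iwaMat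

lemma measurableSet_fundDomain : MeasurableSet fundDomain := by
  change MeasurableSet ({c : ℝ × ℝ × ℝ | |c.1| ≤ 1 / 2} ∩
    ({c | 1 ≤ c.1 ^ 2 + Real.exp c.2.1 ^ 2} ∩ {c | c.2.2 ∈ Set.Ico 0 Real.pi}))
  refine MeasurableSet.inter ?_ (MeasurableSet.inter ?_ ?_)
  · exact measurableSet_le (by fun_prop) (by fun_prop)
  · exact measurableSet_le (by fun_prop) (by fun_prop)
  · exact measurableSet_Ico.preimage (by fun_prop)

lemma lintegral_haarX {F : XInf → ℝ≥0∞} (hF : Measurable F) :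
    ∫⁻ x, F x ∂haarX = ∫⁻ c in fundDomain,
      ENNReal.ofReal (3 / Real.pi ^ 2 * Real.exp (-c.2.1)) * F (iwasawa c) := by
  rw [haarX, lintegral_map hF continuous_iwasawa.measurable,
    lintegral_withDensity_eq_lintegral_mul]
  · rfl
  · fun_prop
  · exact hF.comp continuous_iwasawa.measurable

instance : IsFiniteMeasure haarX := by
  constructor
  rw [← lintegral_one, lintegral_haarX measurable_const]
  set w : ℝ → ℝ≥0∞ := fun s => ENNReal.ofReal (3 / Real.pi ^ 2 * Real.exp (-s)) with hw
  have hwm : Measurable w := by fun_prop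
  have hsub : fundDomain ⊆ Set.Icc (-1) 1 ×ˢ (Set.Ioi (-1) ×ˢ Set.Ico 0 Real.pi) := by
    rintro ⟨x, s, θ⟩ ⟨h1, h2, h3⟩
    simp only at h1 h2 h3
    have hx := abs_le.1 h1
    refine ⟨⟨by linarith, by linarith⟩, ?_, h3⟩
    change -1 < s
    by_contra! hs
    have e1 : Real.exp s ≤ Real.exp (-1) := Real.exp_le_exp.2 hs
    have e2 : Real.exp (-1) ≤ 1 / 2 := by
      rw [Real.exp_neg, ← one_div]
      exact one_div_le_one_div_of_le (by norm_num) (by linarith [Real.add_one_le_exp (1 : ℝ)])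
    nlinarith [Real.exp_pos s]
  refine lt_of_le_of_lt (lintegral_mono_set hsub) ?_
  have hm : ∀ {X : Type} [MeasureSpace X], AEMeasurable (fun c : X × ℝ × ℝ => w c.2.1 * 1)
      volume := fun {X} _ =>
      (by fun_prop : Measurable (fun c : X × ℝ × ℝ => w c.2.1 * 1)).aemeasurable
  have hfin : ∫⁻ s in Set.Ioi (-1), w s < ⊤ := by
    have h1 : IntegrableOn (fun s => 3 / Real.pi ^ 2 * Real.exp (-s)) (Set.Ioi (-1)) := by
      have := (exp_neg_integrableOn_Ioi (-1) one_pos).const_mul (3 / Real.pi ^ 2)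
      simpa [IntegrableOn] using this
    exact Integrable.lintegral_lt_top h1
  rw [Measure.volume_eq_prod, setLIntegral_prod _ hm.restrict]
  simp only [mul_one, lintegral_const, Measure.restrict_apply_univ]
  refine ENNReal.mul_lt_top ?_ (by simp)
  rw [Measure.volume_eq_prod, setLIntegral_prod _ (by fun_prop)]
  simp only [lintegral_const, Measure.restrict_apply_univ]
  rw [lintegral_mul_const _ hwm]
  exact ENNReal.mul_lt_top hfin (by simp)

/-- The Poincaré series are square integrable, with a uniform bound for the norms. -/
lemma exists_eLpNorm_bound : ∃ C : ℝ, 0 < C ∧ ∀ {L : ℝ} {ψ : ℝ × ℝ → ℝ}, IsTest L ψ →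
    MemLp (fun x => ((poincareX ψ x).toReal : ℂ)) 2 haarX ∧
    (eLpNorm (fun x => ((poincareX ψ x).toReal : ℂ)) 2 haarX).toReal ≤ C := by
  obtain ⟨N, hN⟩ := exists_poincare_bound
  have hfin : haarX Set.univ ^ (2 : ℝ≥0∞).toReal⁻¹ * ENNReal.ofReal N ≠ ⊤ :=
    ENNReal.mul_ne_top (ENNReal.rpow_ne_top_of_nonneg (by simp) (measure_ne_top _ _))
      ENNReal.ofReal_ne_top
  refine ⟨(haarX Set.univ ^ (2 : ℝ≥0∞).toReal⁻¹ * ENNReal.ofReal N).toReal + 1, by positivity,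
    fun {L ψ} hψ => ?_⟩
  have hb : ∀ x, ‖((poincareX ψ x).toReal : ℂ)‖ ≤ N := by
    intro x
    rw [Complex.norm_real, Real.norm_of_nonneg ENNReal.toReal_nonneg]
    refine ENNReal.toReal_le_of_le_ofReal (by positivity) ?_
    rw [ENNReal.ofReal_natCast]
    exact hN hψ _
  have hmeas : AEStronglyMeasurable (fun x => ((poincareX ψ x).toReal : ℂ)) haarX :=
    (Complex.continuous_ofReal.comp (continuous_poincareX hψ)).aestronglyMeasurable
  refine ⟨MemLp.of_bound hmeas N (Filter.Eventually.of_forall hb), ?_⟩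
  refine (ENNReal.toReal_mono hfin
    (eLpNorm_le_of_ae_bound (Filter.Eventually.of_forall hb))).trans (by linarith)

section

open UpperHalfPlane

/-! ### Unfolding over the upper half-plane -/

lemma volume_re_eq (c : ℝ) : volume {z : ℂ | z.re = c} = 0 := by
  have h := Complex.volume_preserving_equiv_real_prod
  have e : {z : ℂ | z.re = c} = Complex.measurableEquivRealProd ⁻¹' ({c} ×ˢ Set.univ) := by
    ext z; simp [Complex.measurableEquivRealProd_apply]
  rw [e, h.measure_preimage (by measurability), Measure.volume_eq_prod, Measure.prod_prod]
  simp

lemma volume_fd_diff_fdo : volume (ModularGroup.fd \ ModularGroup.fdo) = 0 := by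
  rw [UpperHalfPlane.volume_eq_lintegral]
  apply setLIntegral_measure_zero
  refine measure_mono_null (t := Metric.sphere (0 : ℂ) 1 ∪
    ({z : ℂ | z.re = 1 / 2} ∪ {z : ℂ | z.re = -(1 / 2)})) ?_ ?_
  · rintro _ ⟨z, ⟨h1, h2⟩, rfl⟩
    by_contra hcon
    simp only [Set.mem_union, not_or, mem_sphere_zero_iff_norm, Set.mem_ofPred_eq] at hcon
    obtain ⟨c1, c2, c3⟩ := hcon
    refine h2 ⟨lt_of_le_of_ne h1.1 fun h => c1 ?_, lt_of_le_of_ne h1.2 fun h => ?_⟩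
    · rw [Complex.normSq_eq_norm_sq] at h
      exact (pow_eq_one_iff_of_nonneg (norm_nonneg _) two_ne_zero).1 h.symm
    · rcases (abs_eq (by norm_num : (0 : ℝ) ≤ 1 / 2)).1 h with h | h
      · exact c2 h
      · exact c3 h
  · rw [measure_union_null_iff, measure_union_null_iff]
    exact ⟨Measure.addHaar_sphere _ _ _, volume_re_eq _, volume_re_eq _⟩

lemma volume_preimage_smul_null (g : GL (Fin 2) ℝ) {s : Set ℍ} (hs : volume s = 0) :
    volume ((fun z => g • z) ⁻¹' s) = 0 := by
  rw [measure_preimage_smul]; exact hs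

/-- The integral matrix `diag(-1, 1)`. -/
def reflInt : GL (Fin 2) ℤ :=
  ⟨!![-1, 0; 0, 1], !![-1, 0; 0, 1], by simp [Matrix.one_fin_two], by simp [Matrix.one_fin_two]⟩

instance : Countable (GL (Fin 2) ℤ) := by
  refine Function.Injective.countable (f := fun (γ : GL (Fin 2) ℤ) (i j : Fin 2) => γ i j) ?_
  intro γ δ h
  ext i j
  exact congrFun (congrFun h i) j

lemma intGL_reflInt : intGL reflInt = UpperHalfPlane.J := by
  ext i j
  fin_cases i <;> fin_cases j <;> simp [reflInt]

lemma reflInt_mul_self : reflInt * reflInt = 1 := by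
  ext i j
  fin_cases i <;> fin_cases j <;>
    simp [reflInt, Matrix.mul_apply, Fin.sum_univ_two]

lemma J_smul_mem_fd {z : ℍ} : UpperHalfPlane.J • z ∈ ModularGroup.fd ↔ z ∈ ModularGroup.fd := by
  have h : ((UpperHalfPlane.J • z : ℍ) : ℂ) = -(starRingEnd ℂ) (z : ℂ) :=
    UpperHalfPlane.coe_J_smul z
  have hre : (UpperHalfPlane.J • z).re = -z.re := by
    rw [← UpperHalfPlane.coe_re, h]; simp
  simp only [ModularGroup.fd, Set.mem_ofPred_eq, h, hre, Complex.normSq_neg, Complex.normSq_conj,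
    abs_neg]

lemma intGL_toGL_smul (σ : SL(2, ℤ)) (z : ℍ) :
    intGL (Matrix.SpecialLinearGroup.toGL σ) • z = σ • z := by
  rw [ModularGroup.sl_moeb]
  congr 1
  ext i j
  rfl

lemma exists_toGL_of_det {γ : GL (Fin 2) ℤ} (h : γ 0 0 * γ 1 1 - γ 0 1 * γ 1 0 = 1) :
    ∃ σ : SL(2, ℤ), Matrix.SpecialLinearGroup.toGL σ = γ := by
  refine ⟨⟨γ.1, by rw [Matrix.det_fin_two]; exact h⟩, ?_⟩
  ext i j
  rfl

/-- A point in the interior of the standard fundamental domain is moved into the fundamental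
domain exactly by the four elements `±1`, `±diag(-1, 1)` of `GL₂(ℤ)`. -/
lemma mem_fd_of_mem_fdo_iff {z : ℍ} (hz : z ∈ ModularGroup.fdo) (γ : GL (Fin 2) ℤ) :
    intGL γ • z ∈ ModularGroup.fd ↔ γ ∈ ({1, -1, reflInt, -reflInt} : Finset (GL (Fin 2) ℤ)) := by
  have hfd := ModularGroup.fdo_subset_fd hz
  have sl : ∀ δ : GL (Fin 2) ℤ, δ 0 0 * δ 1 1 - δ 0 1 * δ 1 0 = 1 →
      intGL δ • z ∈ ModularGroup.fd → δ = 1 ∨ δ = -1 := by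
    intro δ hδ hm
    obtain ⟨σ, rfl⟩ := exists_toGL_of_det hδ
    rw [intGL_toGL_smul] at hm
    rcases ModularGroup.eq_one_or_neg_one_of_mem_fdo_mem_fd hz hm with h | h
    · left; rw [h, map_one]
    · right; rw [h]; ext i j; simp
  simp only [Finset.mem_insert, Finset.mem_singleton]
  constructor
  · intro hm
    rcases det_int_cases γ with h | h
    · rcases sl γ h hm with h | h <;> simp [h]
    · have h1 : intGL (reflInt * γ) • z ∈ ModularGroup.fd := by
        rw [map_mul, mul_smul, intGL_reflInt, J_smul_mem_fd]; exact hm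
      have h2 : (reflInt * γ) 0 0 * (reflInt * γ) 1 1 - (reflInt * γ) 0 1 * (reflInt * γ) 1 0
          = 1 := by
        simp [reflInt, Matrix.mul_apply, Fin.sum_univ_two]
        linarith
      have h3 : γ = reflInt * (reflInt * γ) := by rw [← mul_assoc, reflInt_mul_self, one_mul]
      rcases sl _ h2 h1 with h | h
      · right; right; left; rw [h3, h, mul_one]
      · right; right; right; rw [h3, h]; simp
  · rintro (rfl | rfl | rfl | rfl)
    · simpa using hfd
    · rw [intGL_neg, UpperHalfPlane.neg_smul]; simpa using hfd
    · rw [intGL_reflInt, J_smul_mem_fd]; exact hfd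
    · rw [intGL_neg, UpperHalfPlane.neg_smul, intGL_reflInt, J_smul_mem_fd]; exact hfd

lemma card_four : ({1, -1, reflInt, -reflInt} : Finset (GL (Fin 2) ℤ)).card = 4 := by
  have e : ∀ {a b : GL (Fin 2) ℤ} (i : Fin 2), a i i ≠ b i i → a ≠ b := by
    rintro a b i h rfl; exact h rfl
  have r0 : reflInt 0 0 = -1 := by simp [reflInt]
  have r1 : reflInt 1 1 = 1 := by simp [reflInt]
  rw [Finset.card_insert_of_notMem, Finset.card_insert_of_notMem, Finset.card_insert_of_notMem,
    Finset.card_singleton]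
  · simp only [Finset.mem_singleton]
    exact e 0 (by simp [r0])
  · simp only [Finset.mem_insert, Finset.mem_singleton, not_or]
    exact ⟨e 1 (by simp [r1]), e 0 (by simp [r0])⟩
  · simp only [Finset.mem_insert, Finset.mem_singleton, not_or]
    exact ⟨e 0 (by simp), e 0 (by simp [r0]), e 1 (by simp [r1])⟩

/-- Almost every point lies in exactly four translates `γ fd` of the fundamental domain, counted by
`γ`, as `-1` acts trivially and `diag(-1, 1)` preserves the domain. -/
lemma ae_tsum_indicator_fd : ∀ᵐ w : ℍ, ∑' γ : GL (Fin 2) ℤ,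
    ModularGroup.fd.indicator (fun _ => (1 : ℝ≥0∞)) (intGL γ⁻¹ • w) = 4 := by
  have hnull : ∀ᵐ w : ℍ, ∀ γ : GL (Fin 2) ℤ,
      intGL γ • w ∉ ModularGroup.fd \ ModularGroup.fdo := by
    rw [ae_all_iff]
    intro γ
    have := volume_preimage_smul_null (intGL γ) volume_fd_diff_fdo
    rwa [measure_eq_zero_iff_ae_notMem] at this
  filter_upwards [hnull] with w hw
  obtain ⟨σ, hσ⟩ := ModularGroup.exists_smul_mem_fd w
  rw [← intGL_toGL_smul] at hσ
  set δ : GL (Fin 2) ℤ := Matrix.SpecialLinearGroup.toGL σ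
  have hz : intGL δ • w ∈ ModularGroup.fdo := by
    by_contra h; exact hw δ ⟨hσ, h⟩
  rw [← ((Equiv.inv (GL (Fin 2) ℤ)).trans (Equiv.mulLeft δ⁻¹)).tsum_eq
    (fun γ : GL (Fin 2) ℤ => ModularGroup.fd.indicator (fun _ => (1 : ℝ≥0∞)) (intGL γ⁻¹ • w))]
  have e : ∀ γ : GL (Fin 2) ℤ, ModularGroup.fd.indicator (fun _ => (1 : ℝ≥0∞))
      (intGL (((Equiv.inv (GL (Fin 2) ℤ)).trans (Equiv.mulLeft δ⁻¹)) γ)⁻¹ • w) =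
      if γ ∈ ({1, -1, reflInt, -reflInt} : Finset (GL (Fin 2) ℤ)) then 1 else 0 := by
    intro γ
    simp only [Equiv.trans_apply, Equiv.inv_apply, Equiv.coe_mulLeft, mul_inv_rev, inv_inv]
    rw [map_mul, mul_smul]
    by_cases hγ : γ ∈ ({1, -1, reflInt, -reflInt} : Finset (GL (Fin 2) ℤ))
    · rw [if_pos hγ, Set.indicator_of_mem ((mem_fd_of_mem_fdo_iff hz γ).2 hγ)]
    · rw [if_neg hγ, Set.indicator_of_notMem fun h => hγ ((mem_fd_of_mem_fdo_iff hz γ).1 h)]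
  simp only [e]
  rw [tsum_eq_sum (s := ({1, -1, reflInt, -reflInt} : Finset (GL (Fin 2) ℤ)))
    (fun γ hγ => by rw [if_neg hγ]), Finset.sum_congr rfl (fun γ hγ => if_pos hγ),
    Finset.sum_const, card_four]
  norm_num

lemma measurable_GL_smul (g : GL (Fin 2) ℝ) : Measurable fun z : ℍ => g • z :=
  (continuous_const_smul g).measurable

lemma measurableSet_fd : MeasurableSet ModularGroup.fd := ModularGroup.isClosed_fd.measurableSet

/-- Unfolding: the sum over `GL₂(ℤ)` of the integrals over the fundamental domain is four times
the integral over the upper half-plane. -/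
lemma tsum_lintegral_fd {G : ℍ → ℝ≥0∞} (hG : Measurable G) :
    ∑' γ : GL (Fin 2) ℤ, ∫⁻ z in ModularGroup.fd, G (intGL γ • z) = 4 * ∫⁻ w : ℍ, G w := by
  have hind : Measurable (ModularGroup.fd.indicator (fun _ => (1 : ℝ≥0∞))) :=
    measurable_const.indicator measurableSet_fd
  have e : ∀ γ : GL (Fin 2) ℤ, ∫⁻ z in ModularGroup.fd, G (intGL γ • z) =
      ∫⁻ w : ℍ, ModularGroup.fd.indicator (fun _ => (1 : ℝ≥0∞)) (intGL γ⁻¹ • w) * G w := by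
    intro γ
    rw [← lintegral_indicator measurableSet_fd]
    have := (measurePreserving_smul (intGL γ) (volume : Measure ℍ)).lintegral_comp
      (f := fun w : ℍ => ModularGroup.fd.indicator (fun _ => (1 : ℝ≥0∞)) (intGL γ⁻¹ • w) * G w)
      ((hind.comp (measurable_GL_smul _)).mul hG)
    rw [← this]
    refine lintegral_congr fun z => ?_
    rw [smul_smul, ← map_mul, inv_mul_cancel, map_one, one_smul]
    by_cases hz : z ∈ ModularGroup.fd <;> simp [hz]
  simp only [e]
  have hm : ∀ γ : GL (Fin 2) ℤ, AEMeasurable (fun w : ℍ =>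
      ModularGroup.fd.indicator (fun _ => (1 : ℝ≥0∞)) (intGL γ⁻¹ • w) * G w) := fun γ =>
    ((hind.comp (measurable_GL_smul _)).mul hG).aemeasurable
  rw [← lintegral_tsum hm, ← lintegral_const_mul _ hG]
  refine lintegral_congr_ae ?_
  filter_upwards [ae_tsum_indicator_fd] with w hw
  rw [ENNReal.tsum_mul_right, hw]

/-- Lebesgue integrals over the upper half-plane in the coordinates `x + i y`. -/
lemma lintegral_upperHalfPlane {G : ℂ → ℝ≥0∞} (hG : Measurable G) :
    ∫⁻ z : ℍ, G z = ∫⁻ x : ℝ, ∫⁻ y in Set.Ioi (0 : ℝ),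
      ENNReal.ofReal (1 / y ^ 2) * G ⟨x, y⟩ := by
  have h0 : ∫⁻ z : ℍ, G z = ∫⁻ z : ℂ in {z | 0 < z.im},
      ENNReal.ofReal (1 / z.im ^ 2) * G z := by
    have hm : Measurable fun z : ℍ =>
        (((1 / NNReal.mk z.im z.im_pos.le : ℝ≥0) ^ 2 : ℝ≥0) : ℝ≥0∞) := by
      have : Measurable fun z : ℍ => ENNReal.ofReal ((1 / z.im) ^ 2) := by
        have : Measurable fun z : ℍ => z.im := UpperHalfPlane.continuous_im.measurable
        fun_prop
      convert this using 2 with z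
      rw [ENNReal.ofReal]
      congr 1
      apply NNReal.eq
      rw [Real.coe_toNNReal _ (by positivity)]
      rfl
    have hGc : Measurable fun z : ℍ => G z := hG.comp UpperHalfPlane.measurable_coe
    rw [UpperHalfPlane.volume_def, lintegral_withDensity_eq_lintegral_mul _ hm hGc]
    have hr : Set.range UpperHalfPlane.coe = {z : ℂ | 0 < z.im} := by
      ext z
      constructor
      · rintro ⟨w, rfl⟩; exact w.im_pos
      · intro hz; exact ⟨⟨z, hz⟩, rfl⟩
    rw [← hr, ← UpperHalfPlane.measurableEmbedding_coe.map_comap,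
      UpperHalfPlane.measurableEmbedding_coe.lintegral_map]
    refine lintegral_congr fun z => ?_
    simp only [Pi.mul_apply]
    congr 1
    rw [ENNReal.ofReal]
    congr 1
    apply NNReal.eq
    rw [Real.coe_toNNReal _ (by positivity)]
    simp
  have hset : MeasurableSet {z : ℂ | 0 < z.im} := measurableSet_lt (by fun_prop) (by fun_prop)
  rw [h0, ← lintegral_indicator hset,
    ← Complex.volume_preserving_equiv_real_prod.symm.lintegral_comp_emb
      Complex.measurableEquivRealProd.symm.measurableEmbedding, Measure.volume_eq_prod,
    lintegral_prod]
  · refine lintegral_congr fun x => ?_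
    rw [← lintegral_indicator measurableSet_Ioi]
    refine lintegral_congr fun y => ?_
    rfl
  · refine Measurable.aemeasurable ?_
    refine Measurable.comp (Measurable.indicator ?_ hset) (MeasurableEquiv.measurable _)
    fun_prop

end

section

open UpperHalfPlane

/-! ### Averages over circles -/

/-- The bump at the matrix `n(x) a(log y) k(θ)`. -/
def phiXY (ψ : ℝ × ℝ → ℝ) (x y θ : ℝ) : ℝ :=
  ψ ((y * Real.cos θ + x * Real.sin θ) / Real.sin θ,
    -Real.cos θ / (-(y * Real.sin θ) + x * Real.cos θ)) *
    hat |Real.sin θ / (-(y * Real.sin θ) + x * Real.cos θ)|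

lemma phi_iwaMat (ψ : ℝ × ℝ → ℝ) (x s θ : ℝ) :
    phi ψ (iwaMat x s θ) = phiXY ψ x (Real.exp s) θ := by
  obtain ⟨h1, h2, h3, h4⟩ := iwaMat_apply x s θ
  simp only [phi, xiC, zetaC, rhoC, h1, h2, h3, h4, phiXY]

/-- The matrix `n(x) a(log y) k(θ)` for `z = x + i y`. -/
def iwaMatH (z : ℍ) (θ : ℝ) : GL (Fin 2) ℝ := iwaMat z.re (Real.log z.im) θ

lemma iwaMatH_apply (z : ℍ) (θ : ℝ) :
    iwaMatH z θ 0 0 = z.im * Real.cos θ + z.re * Real.sin θ ∧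
    iwaMatH z θ 0 1 = -(z.im * Real.sin θ) + z.re * Real.cos θ ∧
    iwaMatH z θ 1 0 = Real.sin θ ∧ iwaMatH z θ 1 1 = Real.cos θ := by
  have := iwaMat_apply z.re (Real.log z.im) θ
  rwa [Real.exp_log z.im_pos] at this

lemma phi_iwaMatH (ψ : ℝ × ℝ → ℝ) (z : ℍ) (θ : ℝ) :
    phi ψ (iwaMatH z θ) = phiXY ψ z.re z.im θ := by
  rw [iwaMatH, phi_iwaMat, Real.exp_log z.im_pos]

lemma mul_apply_two (g h : GL (Fin 2) ℝ) (i j : Fin 2) :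
    (g * h) i j = g i 0 * h 0 j + g i 1 * h 1 j := by
  simp [Matrix.mul_apply, Fin.sum_univ_two]

lemma exists_cos_sin {u v : ℝ} (h : 0 < u ^ 2 + v ^ 2) : ∃ n θ : ℝ, 0 < n ∧
    n ^ 2 = u ^ 2 + v ^ 2 ∧ n * Real.cos θ = u ∧ n * Real.sin θ = v := by
  refine ⟨‖(⟨u, v⟩ : ℂ)‖, Complex.arg ⟨u, v⟩, ?_, ?_, ?_, ?_⟩
  · rw [norm_pos_iff]
    intro h0
    have h1 := congrArg Complex.re h0
    have h2 := congrArg Complex.im h0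
    simp at h1 h2
    simp [h1, h2] at h
  · rw [← Complex.normSq_eq_norm_sq, Complex.normSq_mk]; ring
  · exact Complex.norm_mul_cos_arg _
  · exact Complex.norm_mul_sin_arg _

/-- Left multiplication by `h` turns `z` into `h • z`, and rotates or reflects the angle. -/
lemma exists_angle (h : GL (Fin 2) ℝ) (z : ℍ) : ∃ θ₀ ε : ℝ, (ε = 1 ∨ ε = -1) ∧
    ∀ (ψ : ℝ × ℝ → ℝ) (θ : ℝ),
      phi ψ (h * iwaMatH z θ) = phi ψ (iwaMatH (h • z) (θ₀ + ε * θ)) := by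
  set D := h 0 0 * h 1 1 - h 0 1 * h 1 0 with hD
  have hD0 : D ≠ 0 := det_real_ne h
  have hy := z.im_pos
  set u := h 1 0 * z.re + h 1 1 with hu
  set v := h 1 0 * z.im with hv
  have hden : Complex.normSq (denom h z) = u ^ 2 + v ^ 2 := by
    simp only [denom, Complex.normSq_apply, hu, hv]
    simp
    ring
  have huv : 0 < u ^ 2 + v ^ 2 := by
    rw [← hden]; exact normSq_denom_pos h z.im_ne_zero
  have him : (h • z).im = |D| * z.im / (u ^ 2 + v ^ 2) := by
    rw [UpperHalfPlane.im_smul_eq_div_normSq, hden, hD]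
    congr 3
    exact Matrix.det_fin_two _
  have hre : (h • z).re = ((h 0 0 * z.re + h 0 1) * u + h 0 0 * z.im * v) / (u ^ 2 + v ^ 2) := by
    rw [UpperHalfPlane.re_smul, Complex.div_re, hden]
    simp only [num, denom, hu, hv]
    simp
    ring
  -- for negative determinant the angle is reflected
  set ε : ℝ := if 0 < D then 1 else -1 with hε
  have hεD : |D| = ε * D := by
    rw [hε]; split_ifs with hp
    · rw [abs_of_pos hp, one_mul]
    · rw [abs_of_nonpos (not_lt.1 hp)]; ring
  have hε1 : ε = 1 ∨ ε = -1 := by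
    rw [hε]; split_ifs <;> simp
  have hεsq : ε * ε = 1 := by rcases hε1 with e | e <;> rw [e] <;> norm_num
  obtain ⟨n, θ₀, hn, hn2, hc, hs⟩ := exists_cos_sin (u := ε * u) (v := v)
    (by rw [mul_pow, pow_two ε, hεsq, one_mul]; exact huv)
  rw [mul_pow, pow_two ε, hεsq, one_mul] at hn2
  refine ⟨θ₀, ε, hε1, fun ψ θ => ?_⟩
  have hcos : Real.cos (ε * θ) = Real.cos θ := by
    rcases hε1 with e | e <;> rw [e] <;> simp
  have hsin : Real.sin (ε * θ) = ε * Real.sin θ := by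
    rcases hε1 with e | e <;> rw [e] <;> simp
  obtain ⟨a1, a2, a3, a4⟩ := iwaMatH_apply z θ
  obtain ⟨b1, b2, b3, b4⟩ := iwaMatH_apply (h • z) (θ₀ + ε * θ)
  have hcc : Real.cos θ₀ = ε * u / n := by rw [eq_div_iff hn.ne', mul_comm, hc]
  have hss : Real.sin θ₀ = v / n := by rw [eq_div_iff hn.ne', mul_comm, hs]
  have hkey : ∀ w : ℝ, (ε * D * z.im * w) = w * ε * (h 0 0 * z.im * h 1 1 - h 0 1 * v) := by
    intro w; rw [hD, hv]; ring
  have hn0 := hn.ne'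
  have e00 : (h * iwaMatH z θ) 0 0 = iwaMatH (h • z) (θ₀ + ε * θ) 0 0 * n := by
    rw [mul_apply_two, a1, a3, b1, him, hre, hεD, Real.cos_add, Real.sin_add, hcos, hsin, hcc, hss,
      ← hn2]
    field_simp
    rw [hn2]
    rcases hε1 with e | e <;> rw [e, hD, hu, hv] <;> ring
  have e10 : (h * iwaMatH z θ) 1 0 = iwaMatH (h • z) (θ₀ + ε * θ) 1 0 * n := by
    rw [mul_apply_two, a1, a3, b3, Real.sin_add, hcos, hsin, hcc, hss]
    field_simp
    rcases hε1 with e | e <;> rw [e, hu, hv] <;> ring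
  have e01 : (h * iwaMatH z θ) 0 1 = iwaMatH (h • z) (θ₀ + ε * θ) 0 1 * (ε * n) := by
    rw [mul_apply_two, a2, a4, b2, him, hre, hεD, Real.cos_add, Real.sin_add, hcos, hsin, hcc, hss,
      ← hn2]
    field_simp
    rw [hn2]
    rcases hε1 with e | e <;> rw [e, hD, hu, hv] <;> ring
  have e11 : (h * iwaMatH z θ) 1 1 = iwaMatH (h • z) (θ₀ + ε * θ) 1 1 * (ε * n) := by
    rw [mul_apply_two, a2, a4, b4, Real.cos_add, hcos, hsin, hcc, hss]
    field_simp
    rcases hε1 with e | e <;> rw [e, hu, hv] <;> ring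
  refine phi_of_cols ψ (u := n) (v := ε * n) hn0 ?_ ?_ ?_
  · rw [abs_mul]; rcases hε1 with e | e <;> rw [e] <;> simp
  · intro i; fin_cases i
    · exact e00
    · exact e10
  · intro i; fin_cases i
    · exact e01
    · exact e11

lemma phiXY_add_pi (ψ : ℝ × ℝ → ℝ) (x y θ : ℝ) :
    phiXY ψ x y (θ + Real.pi) = phiXY ψ x y θ := by
  unfold phiXY
  rw [Real.sin_add_pi, Real.cos_add_pi,
    show y * -Real.cos θ + x * -Real.sin θ = -(y * Real.cos θ + x * Real.sin θ) by ring,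
    show -(y * -Real.sin θ) + x * -Real.cos θ = -(-(y * Real.sin θ) + x * Real.cos θ) by ring,
    neg_div_neg_eq, neg_div_neg_eq, neg_div_neg_eq]

lemma continuous_iwaMatH_entry (z : ℍ) (i j : Fin 2) : Continuous fun θ => iwaMatH z θ i j := by
  have h := iwaMatH_apply z
  fin_cases i <;> fin_cases j <;> simp only [Fin.zero_eta, Fin.mk_one]
  · simp only [fun θ => (h θ).1]; fun_prop
  · simp only [fun θ => (h θ).2.1]; fun_prop
  · simp only [fun θ => (h θ).2.2.1]; fun_prop
  · simp only [fun θ => (h θ).2.2.2]; fun_prop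

lemma continuous_phiXY {L : ℝ} {ψ : ℝ × ℝ → ℝ} (hψ : IsTest L ψ) (z : ℍ) :
    Continuous fun θ => phiXY ψ z.re z.im θ := by
  simp only [← phi_iwaMatH]
  exact continuous_phi_comp hψ (continuous_iwaMatH_entry z)

lemma phiXY_nonneg {L : ℝ} {ψ : ℝ × ℝ → ℝ} (hψ : IsTest L ψ) (x y θ : ℝ) : 0 ≤ phiXY ψ x y θ :=
  mul_nonneg (hψ.nonneg _) (hat_nonneg _)

lemma lintegral_Ioo_eq_ofReal {f : ℝ → ℝ} (hf : Continuous f) (h0 : ∀ θ, 0 ≤ f θ) :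
    ∫⁻ θ in Set.Ioo 0 Real.pi, ENNReal.ofReal (f θ) =
      ENNReal.ofReal (∫ θ in (0 : ℝ)..Real.pi, f θ) := by
  rw [intervalIntegral.integral_of_le Real.pi_pos.le, ofReal_integral_eq_lintegral_ofReal,
    restrict_Ioo_eq_restrict_Ioc]
  · exact (hf.continuousOn.integrableOn_compact isCompact_Icc).mono_set Set.Ioc_subset_Icc_self
  · exact Filter.Eventually.of_forall h0

/-- The integral of the bump over the circle of frames at `x + i y`. -/
def circ (ψ : ℝ × ℝ → ℝ) (x y : ℝ) : ℝ≥0∞ :=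
  ∫⁻ θ in Set.Ioo 0 Real.pi, ENNReal.ofReal (phiXY ψ x y θ)

/-- The integral over a circle of frames is invariant under rotation and reflection of the angle, so
that left multiplication only moves the base point. -/
lemma lintegral_phi_mul {L : ℝ} {ψ : ℝ × ℝ → ℝ} (hψ : IsTest L ψ) (h : GL (Fin 2) ℝ) (z : ℍ) :
    ∫⁻ θ in Set.Ioo 0 Real.pi, ENNReal.ofReal (phi ψ (h * iwaMatH z θ)) =
      circ ψ (h • z).re (h • z).im := by
  obtain ⟨θ₀, ε, hε, he⟩ := exists_angle h z
  simp only [he, phi_iwaMatH, circ]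
  set f := fun θ => phiXY ψ (h • z).re (h • z).im θ with hf
  have hfc : Continuous f := continuous_phiXY hψ _
  have hf0 : ∀ θ, 0 ≤ f θ := fun θ => phiXY_nonneg hψ _ _ _
  have hper : Function.Periodic f Real.pi := fun θ => phiXY_add_pi ψ _ _ θ
  rw [lintegral_Ioo_eq_ofReal (f := f) hfc hf0,
    lintegral_Ioo_eq_ofReal (f := fun θ => f (θ₀ + ε * θ)) (by fun_prop) (fun _ => hf0 _)]
  congr 1
  rcases hε with rfl | rfl
  · simp only [one_mul]
    rw [intervalIntegral.integral_comp_add_left, add_zero, hper.intervalIntegral_add_eq θ₀ 0,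
      zero_add]
  · simp only [neg_one_mul, ← sub_eq_add_neg]
    rw [intervalIntegral.integral_comp_sub_left, sub_zero]
    have := hper.intervalIntegral_add_eq (θ₀ - Real.pi) 0
    rwa [sub_add_cancel, zero_add] at this

lemma IsTest.continuous {L : ℝ} {ψ : ℝ × ℝ → ℝ} (hψ : IsTest L ψ) : Continuous ψ := by
  rw [continuous_iff_continuousAt]
  intro p
  rw [ContinuousAt, tendsto_iff_dist_tendsto_zero]
  have t : Filter.Tendsto (fun q : ℝ × ℝ => L * (|q.1 - p.1| + |q.2 - p.2|)) (nhds p) (nhds 0) := by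
    have : Continuous fun q : ℝ × ℝ => L * (|q.1 - p.1| + |q.2 - p.2|) := by fun_prop
    simpa using this.tendsto p
  refine squeeze_zero (fun _ => dist_nonneg) (fun q => ?_) t
  rw [Real.dist_eq]
  exact hψ.lip q p

lemma IsTest.measurable_phiXY {L : ℝ} {ψ : ℝ × ℝ → ℝ} (hψ : IsTest L ψ) :
    Measurable fun c : ℝ × ℝ × ℝ => phiXY ψ c.1 c.2.1 c.2.2 := by
  have h1 := hψ.continuous.measurable
  have h2 := continuous_hat.measurable
  unfold phiXY
  refine Measurable.mul (h1.comp ?_) (h2.comp ?_)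
  · fun_prop
  · exact Measurable.abs (by fun_prop)

lemma IsTest.measurable_circ {L : ℝ} {ψ : ℝ × ℝ → ℝ} (hψ : IsTest L ψ) :
    Measurable fun c : ℝ × ℝ => circ ψ c.1 c.2 := by
  unfold circ
  have : Measurable fun p : (ℝ × ℝ) × ℝ => ENNReal.ofReal (phiXY ψ p.1.1 p.1.2 p.2) :=
    (hψ.measurable_phiXY.comp (g := fun c : ℝ × ℝ × ℝ => phiXY ψ c.1 c.2.1 c.2.2)
      (f := fun p : (ℝ × ℝ) × ℝ => (p.1.1, p.1.2, p.2)) (by fun_prop)).ennreal_ofReal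
  exact this.lintegral_prod_right'

/-- The substitution `y = exp s`. -/
lemma lintegral_exp_subst (H : ℝ → ℝ≥0∞) :
    ∫⁻ s : ℝ, ENNReal.ofReal (Real.exp (-s)) * H (Real.exp s) =
      ∫⁻ y in Set.Ioi (0 : ℝ), ENNReal.ofReal (1 / y ^ 2) * H y := by
  have h := lintegral_image_eq_lintegral_abs_deriv_mul (s := Set.univ) MeasurableSet.univ
    (fun x _ => (Real.hasDerivAt_exp x).hasDerivWithinAt) Real.exp_injective.injOn
    (fun y => ENNReal.ofReal (1 / y ^ 2) * H y)
  rw [Set.image_univ, Real.range_exp] at h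
  rw [h, Measure.restrict_univ]
  refine lintegral_congr fun s => ?_
  rw [← mul_assoc, ← ENNReal.ofReal_mul (abs_nonneg _), abs_of_pos (Real.exp_pos s), Real.exp_neg]
  congr 2
  field_simp

lemma lintegral_poincareX_circle {L : ℝ} {ψ : ℝ × ℝ → ℝ} (hψ : IsTest L ψ) (z : ℍ) :
    ∫⁻ θ in Set.Ioo 0 Real.pi, poincareX ψ (iwasawa (z.re, Real.log z.im, θ)) =
      ∑' γ : GL (Fin 2) ℤ, circ ψ (intGL γ • z).re (intGL γ • z).im := by
  have hm : ∀ γ : GL (Fin 2) ℤ, AEMeasurable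
      (fun θ => ENNReal.ofReal (phi ψ (intGL γ * iwaMatH z θ)))
      (volume.restrict (Set.Ioo 0 Real.pi)) := by
    intro γ
    refine Measurable.aemeasurable (Measurable.ennreal_ofReal (Continuous.measurable ?_))
    refine continuous_phi_comp hψ fun i j => ?_
    simp only [intGL_mul_apply]
    have := continuous_iwaMatH_entry z
    exact (continuous_const.mul (this 0 j)).add (continuous_const.mul (this 1 j))
  simp only [← lintegral_phi_mul hψ]
  rw [← lintegral_tsum hm]
  refine lintegral_congr fun θ => ?_
  rw [iwasawa_eq, poincareX_proj]
  rfl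

/-- Unfolding of the Haar integral of a Poincaré series. -/
lemma lintegral_poincareX_haarX {L : ℝ} {ψ : ℝ × ℝ → ℝ} (hψ : IsTest L ψ) :
    ∫⁻ x, poincareX ψ x ∂haarX = ENNReal.ofReal (3 / Real.pi ^ 2) * (4 *
      ∫⁻ x : ℝ, ∫⁻ y in Set.Ioi (0 : ℝ), ENNReal.ofReal (1 / y ^ 2) * circ ψ x y) := by
  have hPm := measurable_poincareX hψ
  -- the integrand after the substitution `y = exp s`
  set fd' : Set (ℝ × ℝ) := {c | |c.1| ≤ 1 / 2 ∧ 1 ≤ c.1 ^ 2 + c.2 ^ 2} with hfd'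
  have hfd'm : MeasurableSet fd' :=
    (measurableSet_le (f := fun c : ℝ × ℝ => |c.1|) (by fun_prop) (by fun_prop)).inter
      (measurableSet_le (g := fun c : ℝ × ℝ => c.1 ^ 2 + c.2 ^ 2) (by fun_prop) (by fun_prop))
  set I : ℝ × ℝ → ℝ≥0∞ := fd'.indicator fun _ => 1 with hI
  have hIm : Measurable I := measurable_const.indicator hfd'm
  set P : ℝ → ℝ → ℝ → ℝ≥0∞ := fun x s θ => poincareX ψ (iwasawa (x, s, θ)) with hP
  have hPmeas : Measurable fun c : ℝ × ℝ × ℝ => P c.1 c.2.1 c.2.2 :=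
    hPm.comp continuous_iwasawa.measurable
  set R : ℝ → ℝ → ℝ≥0∞ := fun x s => ∫⁻ θ in Set.Ioo 0 Real.pi, P x s θ with hR
  have hRm : Measurable fun c : ℝ × ℝ => R c.1 c.2 := by
    have : Measurable fun p : (ℝ × ℝ) × ℝ => P p.1.1 p.1.2 p.2 :=
      hPmeas.comp (f := fun p : (ℝ × ℝ) × ℝ => (p.1.1, p.1.2, p.2)) (by fun_prop)
    exact this.lintegral_prod_right'
  set k : ℝ≥0∞ := ENNReal.ofReal (3 / Real.pi ^ 2) with hk
  have step1 : ∫⁻ x, poincareX ψ x ∂haarX = ∫⁻ x : ℝ, ∫⁻ s : ℝ,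
      ENNReal.ofReal (Real.exp (-s)) * (k * I (x, Real.exp s) * R x s) := by
    rw [lintegral_haarX hPm, ← lintegral_indicator measurableSet_fundDomain,
      Measure.volume_eq_prod, lintegral_prod]
    · refine lintegral_congr fun x => ?_
      rw [Measure.volume_eq_prod, lintegral_prod]
      · refine lintegral_congr fun s => ?_
        have e : ∀ θ, fundDomain.indicator (fun c : ℝ × ℝ × ℝ =>
            ENNReal.ofReal (3 / Real.pi ^ 2 * Real.exp (-c.2.1)) * poincareX ψ (iwasawa c))
            (x, s, θ) = (ENNReal.ofReal (Real.exp (-s)) * (k * I (x, Real.exp s))) *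
              (Set.Ico 0 Real.pi).indicator (fun θ => P x s θ) θ := by
          intro θ
          by_cases h1 : (x, Real.exp s) ∈ fd'
          · by_cases h2 : θ ∈ Set.Ico 0 Real.pi
            · have h3 : (x, s, θ) ∈ fundDomain := ⟨h1.1, h1.2, h2⟩
              rw [Set.indicator_of_mem h3, Set.indicator_of_mem h2, hI, Set.indicator_of_mem h1,
                ENNReal.ofReal_mul (by positivity)]
              ring
            · have h3 : (x, s, θ) ∉ fundDomain := fun h => h2 h.2.2
              rw [Set.indicator_of_notMem h3, Set.indicator_of_notMem h2, mul_zero]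
          · have h3 : (x, s, θ) ∉ fundDomain := fun h => h1 ⟨h.1, h.2.1⟩
            rw [Set.indicator_of_notMem h3, hI, Set.indicator_of_notMem h1]
            simp
        have hPs : Measurable fun θ => P x s θ :=
          hPmeas.comp (f := fun θ => (x, s, θ)) (by fun_prop)
        simp only [e]
        rw [lintegral_const_mul _ (hPs.indicator measurableSet_Ico),
          lintegral_indicator measurableSet_Ico, ← restrict_Ioo_eq_restrict_Ico, mul_assoc]
      · have hm : Measurable fun c : ℝ × ℝ × ℝ =>
            ENNReal.ofReal (3 / Real.pi ^ 2 * Real.exp (-c.2.1)) * poincareX ψ (iwasawa c) :=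
          Measurable.mul (by fun_prop) hPmeas
        exact ((hm.indicator measurableSet_fundDomain).comp (by fun_prop : Measurable
          fun p : ℝ × ℝ => (x, p))).aemeasurable
    · have hm : Measurable fun c : ℝ × ℝ × ℝ =>
          ENNReal.ofReal (3 / Real.pi ^ 2 * Real.exp (-c.2.1)) * poincareX ψ (iwasawa c) :=
        Measurable.mul (by fun_prop) hPmeas
      exact (hm.indicator measurableSet_fundDomain).aemeasurable
  have step2 : ∫⁻ x, poincareX ψ x ∂haarX = ∫⁻ z : ℍ, k * (I (z.re, z.im) *
      R z.re (Real.log z.im)) := by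
    rw [step1]
    have := lintegral_upperHalfPlane
      (G := fun z : ℂ => k * (I (z.re, z.im) * R z.re (Real.log z.im))) (by
        have h1 : Measurable fun z : ℂ => I (z.re, z.im) := hIm.comp (by fun_prop)
        have h2 : Measurable fun z : ℂ => R z.re (Real.log z.im) :=
          hRm.comp (f := fun z : ℂ => (z.re, Real.log z.im)) (by fun_prop)
        exact (h1.mul h2).const_mul k)
    simp only [UpperHalfPlane.coe_re, UpperHalfPlane.coe_im] at this
    rw [this]
    refine lintegral_congr fun x => ?_
    rw [← lintegral_exp_subst (fun y => k * (I (x, y) * R x (Real.log y)))]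
    refine lintegral_congr fun s => ?_
    rw [Real.log_exp, mul_assoc k]
  rw [step2, lintegral_const_mul']
  swap
  · exact ENNReal.ofReal_ne_top
  congr 1
  have step3 : ∀ z : ℍ, I (z.re, z.im) * R z.re (Real.log z.im) =
      ModularGroup.fd.indicator (fun z : ℍ => ∑' γ : GL (Fin 2) ℤ,
        circ ψ (intGL γ • z).re (intGL γ • z).im) z := by
    intro z
    have hmem : (z.re, z.im) ∈ fd' ↔ z ∈ ModularGroup.fd := by
      simp only [hfd', ModularGroup.fd, Set.mem_ofPred_eq, Complex.normSq_apply,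
        UpperHalfPlane.coe_re, UpperHalfPlane.coe_im]
      rw [and_comm, pow_two, pow_two]
    by_cases hz : z ∈ ModularGroup.fd
    · rw [Set.indicator_of_mem hz, hI, Set.indicator_of_mem (hmem.2 hz), one_mul]
      exact lintegral_poincareX_circle hψ z
    · rw [Set.indicator_of_notMem hz, hI, Set.indicator_of_notMem (fun h => hz (hmem.1 h)),
        zero_mul]
  have hcirc : Measurable fun z : ℍ => circ ψ z.re z.im :=
    hψ.measurable_circ.comp (f := fun z : ℍ => (z.re, z.im))
      (UpperHalfPlane.continuous_re.measurable.prodMk UpperHalfPlane.continuous_im.measurable)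
  simp only [step3]
  have hmγ : ∀ γ : GL (Fin 2) ℤ, AEMeasurable (fun z : ℍ =>
      circ ψ (intGL γ • z).re (intGL γ • z).im) (volume.restrict ModularGroup.fd) := fun γ =>
    (hcirc.comp (measurable_GL_smul (intGL γ))).aemeasurable
  rw [lintegral_indicator measurableSet_fd, lintegral_tsum hmγ, tsum_lintegral_fd hcirc]
  congr 1
  have := lintegral_upperHalfPlane (G := fun z : ℂ => circ ψ z.re z.im)
    (hψ.measurable_circ.comp (by fun_prop : Measurable fun z : ℂ => (z.re, z.im)))
  simpa only [UpperHalfPlane.coe_re, UpperHalfPlane.coe_im] using this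

end

/-! ### The Haar integral in the coordinates of the cross-section -/

/-- The total mass of the bump along the flow. -/
def hatMass : ℝ≥0∞ := ∫⁻ t : ℝ, ENNReal.ofReal (hat (Real.exp t))

/-- The substitution `t = log tan θ` on `(0, π / 2)`. -/
lemma lintegral_tan_left (H : ℝ → ℝ≥0∞) :
    ∫⁻ θ in Set.Ioo 0 (Real.pi / 2), ENNReal.ofReal |1 / (Real.sin θ * Real.cos θ)| *
      H |Real.tan θ| = ∫⁻ t : ℝ, H (Real.exp t) := by
  have hpos : ∀ θ ∈ Set.Ioo 0 (Real.pi / 2), 0 < Real.sin θ ∧ 0 < Real.cos θ ∧ 0 < Real.tan θ :=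
    fun θ hθ => ⟨Real.sin_pos_of_pos_of_lt_pi hθ.1 (by linarith [hθ.2, Real.pi_pos]),
      Real.cos_pos_of_mem_Ioo ⟨by linarith [hθ.1, Real.pi_pos], hθ.2⟩,
      Real.tan_pos_of_pos_of_lt_pi_div_two hθ.1 hθ.2⟩
  have hd : ∀ θ ∈ Set.Ioo 0 (Real.pi / 2), HasDerivWithinAt (fun θ => Real.log (Real.tan θ))
      (1 / (Real.sin θ * Real.cos θ)) (Set.Ioo 0 (Real.pi / 2)) θ := by
    intro θ hθ
    obtain ⟨h1, h2, h3⟩ := hpos θ hθ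
    refine (((Real.hasDerivAt_tan h2.ne').log h3.ne').congr_deriv ?_).hasDerivWithinAt
    rw [Real.tan_eq_sin_div_cos]
    field_simp
  have hinj : Set.InjOn (fun θ => Real.log (Real.tan θ)) (Set.Ioo 0 (Real.pi / 2)) := by
    intro a ha b hb hab
    have h1 := Real.log_injOn_pos (hpos a ha).2.2 (hpos b hb).2.2 hab
    exact Real.injOn_tan ⟨by linarith [ha.1, Real.pi_pos], ha.2⟩
      ⟨by linarith [hb.1, Real.pi_pos], hb.2⟩ h1
  have himg : (fun θ => Real.log (Real.tan θ)) '' Set.Ioo 0 (Real.pi / 2) = Set.univ := by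
    rw [Set.eq_univ_iff_forall]
    intro t
    refine ⟨Real.arctan (Real.exp t), ⟨Real.arctan_pos.2 (Real.exp_pos t),
      Real.arctan_lt_pi_div_two _⟩, ?_⟩
    simp only [Real.tan_arctan, Real.log_exp]
  have h := lintegral_image_eq_lintegral_abs_deriv_mul measurableSet_Ioo hd hinj
    (fun t => H (Real.exp t))
  rw [himg, Measure.restrict_univ] at h
  rw [h]
  refine setLIntegral_congr_fun measurableSet_Ioo fun θ hθ => ?_
  have h3 := (hpos θ hθ).2.2
  simp only [Real.exp_log h3, abs_of_pos h3]

lemma lintegral_tan_right (H : ℝ → ℝ≥0∞) :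
    ∫⁻ θ in Set.Ioo (Real.pi / 2) Real.pi, ENNReal.ofReal |1 / (Real.sin θ * Real.cos θ)| *
      H |Real.tan θ| = ∫⁻ t : ℝ, H (Real.exp t) := by
  rw [← lintegral_tan_left H, ← lintegral_indicator measurableSet_Ioo,
    ← lintegral_indicator measurableSet_Ioo, ← lintegral_sub_left_eq_self _ Real.pi]
  refine lintegral_congr fun θ => ?_
  by_cases hθ : θ ∈ Set.Ioo 0 (Real.pi / 2)
  · have hθ' : Real.pi - θ ∈ Set.Ioo (Real.pi / 2) Real.pi :=
      ⟨by linarith [hθ.2], by linarith [hθ.1]⟩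
    rw [Set.indicator_of_mem hθ, Set.indicator_of_mem hθ', Real.sin_pi_sub, Real.cos_pi_sub,
      Real.tan_pi_sub, abs_neg, mul_neg, div_neg, abs_neg]
  · have hθ' : Real.pi - θ ∉ Set.Ioo (Real.pi / 2) Real.pi := fun h =>
      hθ ⟨by linarith [h.2], by linarith [h.1]⟩
    rw [Set.indicator_of_notMem hθ, Set.indicator_of_notMem hθ']

/-- The bump in terms of the end points `ξ` and `ξ - v` and the tangent `u` of the angle. -/
def bumpV (ψ : ℝ × ℝ → ℝ) (ξ v u : ℝ) : ℝ≥0∞ :=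
  ENNReal.ofReal (ψ (ξ, 1 / (v - ξ)) * hat (u / |v - ξ|))

lemma IsTest.measurable_bumpV {L : ℝ} {ψ : ℝ × ℝ → ℝ} (hψ : IsTest L ψ) :
    Measurable fun c : ℝ × ℝ × ℝ => bumpV ψ c.1 c.2.1 c.2.2 := by
  have h1 := hψ.continuous.measurable
  have h2 := continuous_hat.measurable
  unfold bumpV
  refine Measurable.ennreal_ofReal (Measurable.mul (h1.comp ?_) (h2.comp ?_))
  · exact Measurable.prodMk (by fun_prop) (by fun_prop)
  · exact Measurable.div (by fun_prop) (Measurable.abs (by fun_prop))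

lemma phiXY_eq (ψ : ℝ × ℝ → ℝ) {y θ : ℝ} (hs : Real.sin θ ≠ 0) (hc : Real.cos θ ≠ 0) (ξ : ℝ) :
    ENNReal.ofReal (phiXY ψ (ξ - y * Real.cos θ / Real.sin θ) y θ) =
      bumpV ψ ξ (y * (1 / (Real.sin θ * Real.cos θ))) |Real.tan θ| := by
  have hsc := Real.sin_sq_add_cos_sq θ
  have hb : -(y * Real.sin θ) + (ξ - y * Real.cos θ / Real.sin θ) * Real.cos θ =
      -(Real.cos θ * (y * (1 / (Real.sin θ * Real.cos θ)) - ξ)) := by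
    field_simp
    linear_combination (-y) * hsc
  have hx : (y * Real.cos θ + (ξ - y * Real.cos θ / Real.sin θ) * Real.sin θ) / Real.sin θ = ξ := by
    field_simp
    ring
  unfold bumpV phiXY
  rw [hx, hb, neg_div_neg_eq, Real.tan_eq_sin_div_cos]
  congr 4
  · rw [div_mul_eq_div_div, div_self hc]
  · rw [div_neg, abs_neg, div_mul_eq_div_div, abs_div]

/-- The integral over the base point for a fixed angle. -/
lemma lintegral_base (ψ : ℝ × ℝ → ℝ) {θ : ℝ} (hs : Real.sin θ ≠ 0)
    (hc : Real.cos θ ≠ 0) :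
    ∫⁻ y in Set.Ioi (0 : ℝ), ENNReal.ofReal (1 / y ^ 2) *
        ∫⁻ x : ℝ, ENNReal.ofReal (phiXY ψ x y θ) =
      ENNReal.ofReal |1 / (Real.sin θ * Real.cos θ)| *
        ∫⁻ v in (fun y => y * (1 / (Real.sin θ * Real.cos θ))) '' Set.Ioi (0 : ℝ),
          ENNReal.ofReal (1 / v ^ 2) * ∫⁻ ξ : ℝ, bumpV ψ ξ v |Real.tan θ| := by
  set A := 1 / (Real.sin θ * Real.cos θ) with hA
  have hA0 : A ≠ 0 := by positivity
  have h := lintegral_image_eq_lintegral_abs_deriv_mul (s := Set.Ioi (0 : ℝ)) measurableSet_Ioi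
    (f := fun y => y * A) (f' := fun _ => A)
    (fun x _ => ((hasDerivAt_id x).mul_const A).hasDerivWithinAt.congr_deriv (by simp))
    (mul_left_injective₀ hA0).injOn
    (fun v => ENNReal.ofReal (1 / v ^ 2) * ∫⁻ ξ : ℝ, bumpV ψ ξ v |Real.tan θ|)
  rw [h, ← lintegral_const_mul' _ _ ENNReal.ofReal_ne_top]
  refine setLIntegral_congr_fun measurableSet_Ioi fun y hy => ?_
  have hy0 : (0 : ℝ) < y := hy
  rw [← mul_assoc, ← mul_assoc, ← ENNReal.ofReal_mul (abs_nonneg _),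
    ← ENNReal.ofReal_mul (by positivity)]
  congr 1
  · congr 1
    rw [mul_pow, abs_mul_abs_self]
    field_simp
  · rw [← lintegral_sub_right_eq_self _ (y * Real.cos θ / Real.sin θ)]
    refine lintegral_congr fun ξ => ?_
    rw [phiXY_eq ψ hs hc]

lemma lintegral_bumpV_time {L : ℝ} {ψ : ℝ × ℝ → ℝ} (hψ : IsTest L ψ) {ξ v : ℝ} (h : ξ ≠ v) :
    ∫⁻ t : ℝ, bumpV ψ ξ v (Real.exp t) = ENNReal.ofReal (ψ (ξ, 1 / (v - ξ))) * hatMass := by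
  have hp : 0 < |v - ξ| := abs_pos.2 (sub_ne_zero.2 h.symm)
  rw [hatMass, ← lintegral_sub_right_eq_self (fun t => ENNReal.ofReal (hat (Real.exp t)))
      (Real.log |v - ξ|),
    ← lintegral_const_mul' _ _ ENNReal.ofReal_ne_top]
  refine lintegral_congr fun t => ?_
  rw [bumpV, ENNReal.ofReal_mul (hψ.nonneg _), Real.exp_sub, Real.exp_log hp]

lemma lintegral_half {L : ℝ} {ψ : ℝ × ℝ → ℝ} (hψ : IsTest L ψ) (V : Set ℝ) :
    ∫⁻ t : ℝ, ∫⁻ v in V, ENNReal.ofReal (1 / v ^ 2) * ∫⁻ ξ : ℝ, bumpV ψ ξ v (Real.exp t) =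
      hatMass * ∫⁻ v in V, ENNReal.ofReal (1 / v ^ 2) *
        ∫⁻ ξ : ℝ, ENNReal.ofReal (ψ (ξ, 1 / (v - ξ))) := by
  have hm := hψ.measurable_bumpV
  have hψm := hψ.continuous.measurable
  have hK : Measurable fun p : ℝ × ℝ => ∫⁻ ξ : ℝ, bumpV ψ ξ p.2 (Real.exp p.1) := by
    have : Measurable fun q : (ℝ × ℝ) × ℝ => bumpV ψ q.2 q.1.2 (Real.exp q.1.1) :=
      hm.comp (f := fun q : (ℝ × ℝ) × ℝ => (q.2, q.1.2, Real.exp q.1.1)) (by fun_prop)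
    exact this.lintegral_prod_right'
  have hK2 : Measurable fun v : ℝ => ∫⁻ ξ : ℝ, ENNReal.ofReal (ψ (ξ, 1 / (v - ξ))) := by
    have : Measurable fun q : ℝ × ℝ => ENNReal.ofReal (ψ (q.2, 1 / (q.1 - q.2))) :=
      (hψm.comp (f := fun q : ℝ × ℝ => (q.2, 1 / (q.1 - q.2)))
        (Measurable.prodMk (by fun_prop) (by fun_prop))).ennreal_ofReal
    exact this.lintegral_prod_right'
  rw [lintegral_lintegral_swap]
  · rw [← lintegral_const_mul _ (by fun_prop)]
    refine lintegral_congr fun v => ?_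
    have hm1 : Measurable fun t : ℝ => ∫⁻ ξ : ℝ, bumpV ψ ξ v (Real.exp t) :=
      hK.comp (f := fun t : ℝ => (t, v)) (by fun_prop)
    rw [lintegral_const_mul _ hm1, mul_left_comm]
    congr 1
    rw [lintegral_lintegral_swap]
    · have hm2 : Measurable fun ξ : ℝ => ENNReal.ofReal (ψ (ξ, 1 / (v - ξ))) :=
        (hψm.comp (f := fun ξ : ℝ => (ξ, 1 / (v - ξ)))
          (Measurable.prodMk (by fun_prop) (by fun_prop))).ennreal_ofReal
      rw [mul_comm, ← lintegral_mul_const _ hm2]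
      refine lintegral_congr_ae ?_
      filter_upwards [compl_mem_ae_iff.2 (Real.volume_singleton (a := v))] with ξ hξ
      exact lintegral_bumpV_time hψ hξ
    · exact (hm.comp (f := fun q : ℝ × ℝ => (q.2, v, Real.exp q.1)) (by fun_prop)).aemeasurable
  · exact (Measurable.mul (by fun_prop) hK).aemeasurable

/-- The substitution `v = ξ + 1 / ζ`, where `-1 / ζ = ξ - v` is the backward end point. -/
lemma lintegral_inversion (ψ : ℝ × ℝ → ℝ) (ξ : ℝ) :
    ∫⁻ v : ℝ, ENNReal.ofReal (1 / v ^ 2) * ENNReal.ofReal (ψ (ξ, 1 / (v - ξ))) =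
      ∫⁻ ζ : ℝ, ENNReal.ofReal (ψ (ξ, ζ) / (1 + ξ * ζ) ^ 2) := by
  have h := lintegral_image_eq_lintegral_abs_deriv_mul (s := ({0}ᶜ : Set ℝ))
    (measurableSet_singleton _).compl (f := fun ζ => ξ + ζ⁻¹) (f' := fun ζ => -(ζ ^ 2)⁻¹)
    (fun ζ hζ => ((hasDerivAt_inv hζ).const_add ξ).hasDerivWithinAt)
    (fun a _ b _ hab => inv_injective (add_left_cancel hab))
    (fun v => ENNReal.ofReal (1 / v ^ 2) * ENNReal.ofReal (ψ (ξ, 1 / (v - ξ))))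
  have himg : (fun ζ => ξ + ζ⁻¹) '' ({0}ᶜ : Set ℝ) = {ξ}ᶜ := by
    ext v
    simp only [Set.mem_image, Set.mem_compl_iff, Set.mem_singleton_iff]
    constructor
    · rintro ⟨ζ, hζ, rfl⟩ h0
      exact hζ (inv_eq_zero.1 (by linarith))
    · intro hv
      exact ⟨(v - ξ)⁻¹, inv_ne_zero (sub_ne_zero.2 hv), by rw [inv_inv]; ring⟩
  have hr : ∀ a : ℝ, (volume : Measure ℝ).restrict {a}ᶜ = volume := fun a =>
    Measure.restrict_eq_self_of_ae_mem (compl_mem_ae_iff.2 Real.volume_singleton)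
  rw [himg, hr, hr] at h
  rw [h]
  refine lintegral_congr_ae ?_
  filter_upwards [compl_mem_ae_iff.2 (Real.volume_singleton (a := (0 : ℝ)))] with ζ hζ
  have hζ0 : ζ ≠ 0 := hζ
  rw [← mul_assoc, ← ENNReal.ofReal_mul (abs_nonneg _), ← ENNReal.ofReal_mul (by positivity)]
  congr 1
  rw [add_sub_cancel_left, one_div (ζ⁻¹), inv_inv, abs_neg, abs_of_nonneg (by positivity),
    div_eq_mul_inv (ψ _), mul_comm (ψ _)]
  congr 1
  rw [← div_eq_inv_mul, one_div, div_eq_mul_inv, ← mul_inv, ← mul_pow]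
  congr 2
  field_simp
  ring

/-- The weight of the cross-section: the integral against the invariant measure of the natural
extension of the Gauss map. -/
def crossInt (ψ : ℝ × ℝ → ℝ) : ℝ≥0∞ :=
  ∫⁻ ξ : ℝ, ∫⁻ ζ : ℝ, ENNReal.ofReal (ψ (ξ, ζ) / (1 + ξ * ζ) ^ 2)

/-- The integral over all frames of the upper half-plane in the coordinates `(ξ, ζ, t)`: the
integral in `t` splits off as `hatMass`. -/
lemma lintegral_circ {L : ℝ} {ψ : ℝ × ℝ → ℝ} (hψ : IsTest L ψ) :
    ∫⁻ x : ℝ, ∫⁻ y in Set.Ioi (0 : ℝ), ENNReal.ofReal (1 / y ^ 2) * circ ψ x y =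
      hatMass * crossInt ψ := by
  have hψm := hψ.continuous.measurable
  have hφ : Measurable fun c : ℝ × ℝ × ℝ => ENNReal.ofReal (phiXY ψ c.1 c.2.1 c.2.2) :=
    hψ.measurable_phiXY.ennreal_ofReal
  have hX : Measurable fun p : ℝ × ℝ => ∫⁻ x : ℝ, ENNReal.ofReal (phiXY ψ x p.1 p.2) := by
    have : Measurable fun q : (ℝ × ℝ) × ℝ => ENNReal.ofReal (phiXY ψ q.2 q.1.1 q.1.2) :=
      hφ.comp (f := fun q : (ℝ × ℝ) × ℝ => (q.2, q.1.1, q.1.2)) (by fun_prop)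
    exact this.lintegral_prod_right'
  -- integrate over `x` first, then over `y`, then over the angle
  have s1 : ∫⁻ x : ℝ, ∫⁻ y in Set.Ioi (0 : ℝ), ENNReal.ofReal (1 / y ^ 2) * circ ψ x y =
      ∫⁻ θ in Set.Ioo 0 Real.pi, ∫⁻ y in Set.Ioi (0 : ℝ), ENNReal.ofReal (1 / y ^ 2) *
        ∫⁻ x : ℝ, ENNReal.ofReal (phiXY ψ x y θ) := by
    rw [lintegral_lintegral_swap (Measurable.mul (by fun_prop) hψ.measurable_circ).aemeasurable]
    rw [lintegral_lintegral_swap (f := fun (θ : ℝ) (y : ℝ) => ENNReal.ofReal (1 / y ^ 2) *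
        ∫⁻ x : ℝ, ENNReal.ofReal (phiXY ψ x y θ))
      (Measurable.mul (by fun_prop) (hX.comp measurable_swap)).aemeasurable]
    refine lintegral_congr fun y => ?_
    have hc : Measurable fun x : ℝ => circ ψ x y :=
      hψ.measurable_circ.comp (f := fun x : ℝ => (x, y)) (by fun_prop)
    have hx : Measurable fun θ : ℝ => ∫⁻ x : ℝ, ENNReal.ofReal (phiXY ψ x y θ) :=
      hX.comp (f := fun θ : ℝ => (y, θ)) (by fun_prop)
    rw [lintegral_const_mul _ hc, lintegral_const_mul _ hx]
    congr 1
    unfold circ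
    exact lintegral_lintegral_swap
      (hφ.comp (f := fun q : ℝ × ℝ => (q.1, y, q.2)) (by fun_prop)).aemeasurable
  have hpi := Real.pi_pos
  have hsplit : Set.Ioo 0 Real.pi =ᵐ[volume]
      (Set.Ioo 0 (Real.pi / 2) ∪ Set.Ioo (Real.pi / 2) Real.pi : Set ℝ) := by
    rw [← Set.Ioc_union_Ioo_eq_Ioo (by linarith : (0 : ℝ) ≤ Real.pi / 2)
      (by linarith : Real.pi / 2 < Real.pi)]
    exact ae_eq_set_union Ioo_ae_eq_Ioc.symm Filter.EventuallyEq.rfl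
  have himg1 : ∀ {A : ℝ}, 0 < A → (fun y => y * A) '' Set.Ioi (0 : ℝ) = Set.Ioi 0 := by
    intro A hA
    ext v
    constructor
    · rintro ⟨y, hy, rfl⟩; exact mul_pos hy hA
    · intro hv
      exact ⟨v / A, div_pos hv hA, div_mul_cancel₀ _ hA.ne'⟩
  have himg2 : ∀ {A : ℝ}, A < 0 → (fun y => y * A) '' Set.Ioi (0 : ℝ) = Set.Iio 0 := by
    intro A hA
    ext v
    constructor
    · rintro ⟨y, hy, rfl⟩; exact mul_neg_of_pos_of_neg hy hA
    · intro hv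
      exact ⟨v / A, div_pos_of_neg_of_neg hv hA, div_mul_cancel₀ _ hA.ne⟩
  have s2 : ∫⁻ θ in Set.Ioo 0 (Real.pi / 2), ∫⁻ y in Set.Ioi (0 : ℝ),
      ENNReal.ofReal (1 / y ^ 2) * ∫⁻ x : ℝ, ENNReal.ofReal (phiXY ψ x y θ) =
      hatMass * ∫⁻ v in Set.Ioi 0, ENNReal.ofReal (1 / v ^ 2) *
        ∫⁻ ξ : ℝ, ENNReal.ofReal (ψ (ξ, 1 / (v - ξ))) := by
    rw [← lintegral_half hψ, ← lintegral_tan_left (fun u => ∫⁻ v in Set.Ioi 0,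
      ENNReal.ofReal (1 / v ^ 2) * ∫⁻ ξ : ℝ, bumpV ψ ξ v u)]
    refine setLIntegral_congr_fun measurableSet_Ioo fun θ hθ => ?_
    have h1 : 0 < Real.sin θ := Real.sin_pos_of_pos_of_lt_pi hθ.1 (by linarith [hθ.2])
    have h2 : 0 < Real.cos θ := Real.cos_pos_of_mem_Ioo ⟨by linarith [hθ.1], hθ.2⟩
    rw [lintegral_base ψ h1.ne' h2.ne', himg1 (by positivity)]
  have s3 : ∫⁻ θ in Set.Ioo (Real.pi / 2) Real.pi, ∫⁻ y in Set.Ioi (0 : ℝ),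
      ENNReal.ofReal (1 / y ^ 2) * ∫⁻ x : ℝ, ENNReal.ofReal (phiXY ψ x y θ) =
      hatMass * ∫⁻ v in Set.Iio 0, ENNReal.ofReal (1 / v ^ 2) *
        ∫⁻ ξ : ℝ, ENNReal.ofReal (ψ (ξ, 1 / (v - ξ))) := by
    rw [← lintegral_half hψ, ← lintegral_tan_right (fun u => ∫⁻ v in Set.Iio 0,
      ENNReal.ofReal (1 / v ^ 2) * ∫⁻ ξ : ℝ, bumpV ψ ξ v u)]
    refine setLIntegral_congr_fun measurableSet_Ioo fun θ hθ => ?_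
    have h1 : 0 < Real.sin θ := Real.sin_pos_of_pos_of_lt_pi (by linarith [hθ.1]) hθ.2
    have h2 : Real.cos θ < 0 := Real.cos_neg_of_pi_div_two_lt_of_lt hθ.1 (by linarith [hθ.2])
    rw [lintegral_base ψ h1.ne' h2.ne, himg2
      (div_neg_of_pos_of_neg one_pos (mul_neg_of_pos_of_neg h1 h2))]
  have hJ : Measurable fun q : ℝ × ℝ => ENNReal.ofReal (ψ (q.2, 1 / (q.1 - q.2))) :=
    (hψm.comp (f := fun q : ℝ × ℝ => (q.2, 1 / (q.1 - q.2)))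
      (Measurable.prodMk (by fun_prop) (by fun_prop))).ennreal_ofReal
  rw [s1, setLIntegral_congr hsplit, lintegral_union measurableSet_Ioo
    (Set.disjoint_left.2 fun x h1 h2 => by linarith [h1.2, h2.1]), s2, s3, ← mul_add]
  congr 1
  have hI : (Set.univ : Set ℝ) =ᵐ[volume] (Set.Ioi 0 ∪ Set.Iio 0 : Set ℝ) := by
    have e : (Set.Ioi 0 ∪ Set.Iio 0 : Set ℝ) = {0}ᶜ := by
      rw [Set.union_comm, Set.Iio_union_Ioi]
    rw [e]
    exact (Filter.eventuallyEq_univ.2 (compl_mem_ae_iff.2 Real.volume_singleton)).symm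
  rw [← lintegral_union measurableSet_Iio (show Disjoint (Set.Ioi (0 : ℝ)) (Set.Iio 0) from
      Set.disjoint_left.2 fun x h1 h2 => lt_asymm (Set.mem_Ioi.1 h1) (Set.mem_Iio.1 h2)),
    ← setLIntegral_congr hI, Measure.restrict_univ]
  have e : ∀ v : ℝ, ENNReal.ofReal (1 / v ^ 2) * ∫⁻ ξ : ℝ, ENNReal.ofReal (ψ (ξ, 1 / (v - ξ))) =
      ∫⁻ ξ : ℝ, ENNReal.ofReal (1 / v ^ 2) * ENNReal.ofReal (ψ (ξ, 1 / (v - ξ))) := fun v =>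
    (lintegral_const_mul' _ _ ENNReal.ofReal_ne_top).symm
  simp only [e]
  rw [lintegral_lintegral_swap (Measurable.mul (by fun_prop) hJ).aemeasurable]
  exact lintegral_congr fun ξ => lintegral_inversion ψ ξ

/-- The Haar integral of a Poincaré series. -/
lemma lintegral_poincareX_haarX_eq {L : ℝ} {ψ : ℝ × ℝ → ℝ} (hψ : IsTest L ψ) :
    ∫⁻ x, poincareX ψ x ∂haarX =
      ENNReal.ofReal (12 / Real.pi ^ 2) * (hatMass * crossInt ψ) := by
  rw [lintegral_poincareX_haarX hψ, lintegral_circ hψ, ← mul_assoc]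
  congr 1
  rw [show (4 : ℝ≥0∞) = ENNReal.ofReal 4 by simp, ← ENNReal.ofReal_mul (by positivity)]
  congr 1
  ring

/-! ### Continued fraction steps as integral matrices -/

/-- The matrix `(-n, 1; 1, 0)` of a continued fraction step with digit `n`. -/
def stepMat (n : ℤ) : GL (Fin 2) ℤ :=
  ⟨!![-n, 1; 1, 0], !![0, 1; 1, n], by simp [Matrix.one_fin_two], by simp [Matrix.one_fin_two]⟩

lemma stepMat_mul_apply (n : ℤ) (γ : GL (Fin 2) ℤ) (j : Fin 2) :
    (stepMat n * γ) 0 j = γ 1 j - n * γ 0 j ∧ (stepMat n * γ) 1 j = γ 0 j := by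
  simp [stepMat, Matrix.mul_apply, Fin.sum_univ_two]
  ring

lemma intGL_stepMat_mul_apply (n : ℤ) (g : GL (Fin 2) ℝ) (j : Fin 2) :
    (intGL (stepMat n) * g) 0 j = g 1 j - n * g 0 j ∧ (intGL (stepMat n) * g) 1 j = g 0 j := by
  simp [intGL_mul_apply, stepMat]
  ring

/-- The product of the matrices of the first `k` continued fraction steps of `y`; the rightmost
factor belongs to the first step. -/
def cfMat : ℕ → ℝ → GL (Fin 2) ℤ
  | 0, _ => 1
  | k + 1, y => cfMat k (gaussMap y) * stepMat ⌊y⁻¹⌋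

lemma cfMat_add (k l : ℕ) (y : ℝ) :
    cfMat (k + l) y = cfMat k (gaussMap^[l] y) * cfMat l y := by
  induction l generalizing y with
  | zero => simp [cfMat]
  | succ l ih =>
    rw [← add_assoc, cfMat, ih, cfMat, Function.iterate_succ_apply, mul_assoc]

lemma cfMat_mul_period {p : ℕ} {y : ℝ} (hp : gaussMap^[p] y = y) (m : ℕ) :
    cfMat (p * m) y = cfMat p y ^ m := by
  induction m with
  | zero => simp [cfMat]
  | succ m ih =>
    have hit : gaussMap^[p * m] y = y := by
      rw [Function.iterate_mul]
      exact Function.iterate_fixed hp m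
    rw [mul_add, mul_one, add_comm, cfMat_add, hit, ih, pow_succ']

/-- The determinant of a continued fraction matrix has the parity of its length. -/
lemma det_cfMat (k : ℕ) (y : ℝ) :
    cfMat k y 0 0 * cfMat k y 1 1 - cfMat k y 0 1 * cfMat k y 1 0 = (-1) ^ k := by
  induction k generalizing y with
  | zero => simp [cfMat]
  | succ k ih =>
    have h := ih (gaussMap y)
    simp only [cfMat, Units.val_mul, Matrix.mul_apply, Fin.sum_univ_two, stepMat]
    simp
    rw [pow_succ, ← h]
    ring

/-- The natural extension of the Gauss map in the coordinates `(ξ, ζ)`. -/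
def pairStep (p : ℝ × ℝ) : ℝ × ℝ := (gaussMap p.1, 1 / (⌊p.1⁻¹⌋ + p.2))

lemma iterate_pairStep_fst (k : ℕ) (p : ℝ × ℝ) : (pairStep^[k] p).1 = gaussMap^[k] p.1 := by
  induction k generalizing p with
  | zero => rfl
  | succ k ih => rw [Function.iterate_succ_apply, ih, Function.iterate_succ_apply]; rfl

/-- The effect of a continued fraction step on the coordinates. -/
lemma coords_step {g : GL (Fin 2) ℝ} (hb : g 0 1 ≠ 0) (hc : g 1 0 ≠ 0) (hx : xiC g ≠ 0)
    (hz : (⌊(xiC g)⁻¹⌋ + zetaC g : ℝ) ≠ 0) :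
    (intGL (stepMat ⌊(xiC g)⁻¹⌋) * g) 0 1 ≠ 0 ∧ (intGL (stepMat ⌊(xiC g)⁻¹⌋) * g) 1 0 ≠ 0 ∧
    xiC (intGL (stepMat ⌊(xiC g)⁻¹⌋) * g) = gaussMap (xiC g) ∧
    zetaC (intGL (stepMat ⌊(xiC g)⁻¹⌋) * g) = 1 / (⌊(xiC g)⁻¹⌋ + zetaC g) ∧
    rhoC (intGL (stepMat ⌊(xiC g)⁻¹⌋) * g) =
      -(rhoC g * xiC g * (1 / (⌊(xiC g)⁻¹⌋ + zetaC g))) := by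
  have hxe : g 0 0 = g 1 0 * xiC g := by rw [xiC]; field_simp
  have hze : g 1 1 = -(g 0 1 * zetaC g) := by rw [zetaC]; field_simp
  generalize hn : ⌊(xiC g)⁻¹⌋ = n at *
  obtain ⟨e00, e10⟩ := intGL_stepMat_mul_apply n g 0
  obtain ⟨e01, e11⟩ := intGL_stepMat_mul_apply n g 1
  have e01' : (intGL (stepMat n) * g) 0 1 = -(g 0 1 * (n + zetaC g)) := by rw [e01, hze]; ring
  refine ⟨?_, ?_, ?_, ?_, ?_⟩
  · rw [e01']; exact neg_ne_zero.2 (mul_ne_zero hb hz)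
  · rw [e10, hxe]; exact mul_ne_zero hc hx
  · rw [gaussMap, Int.fract, hn, xiC, e00, e10, hxe]
    field_simp
  · rw [zetaC, e11, e01', neg_div_neg_eq, div_mul_eq_div_div, div_self hb]
  · rw [rhoC, e10, e01', rhoC, hxe]
    field_simp

lemma coords_cfMat (k : ℕ) {g : GL (Fin 2) ℝ} (hb : g 0 1 ≠ 0) (hc : g 1 0 ≠ 0)
    (hx : ∀ i, (pairStep^[i] (xiC g, zetaC g)).1 ≠ 0)
    (hz : ∀ i, (pairStep^[i] (xiC g, zetaC g)).2 ≠ 0) :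
    (intGL (cfMat k (xiC g)) * g) 0 1 ≠ 0 ∧ (intGL (cfMat k (xiC g)) * g) 1 0 ≠ 0 ∧
    (xiC (intGL (cfMat k (xiC g)) * g), zetaC (intGL (cfMat k (xiC g)) * g)) =
      pairStep^[k] (xiC g, zetaC g) := by
  induction k generalizing g with
  | zero => simp [cfMat, hb, hc]
  | succ k ih =>
    have hz1 : (⌊(xiC g)⁻¹⌋ + zetaC g : ℝ) ≠ 0 := by
      intro h0
      apply hz 1
      simp [pairStep, h0]
    obtain ⟨h1, h2, h3, h4, -⟩ := coords_step hb hc (hx 0) hz1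
    have hpair : (xiC (intGL (stepMat ⌊(xiC g)⁻¹⌋) * g),
        zetaC (intGL (stepMat ⌊(xiC g)⁻¹⌋) * g)) = pairStep (xiC g, zetaC g) := by
      rw [h3, h4]; rfl
    have := ih h1 h2 (fun i => by
      rw [hpair, ← Function.iterate_succ_apply]; exact hx (i + 1)) (fun i => by
      rw [hpair, ← Function.iterate_succ_apply]; exact hz (i + 1))
    rw [hpair, h3, ← Function.iterate_succ_apply, ← mul_assoc, ← map_mul] at this
    exact this

/-! ### Reduced geodesics -/

/-- A geodesic is reduced if it crosses the cross-section `(0, 1)²`. -/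
structure Red (g : GL (Fin 2) ℝ) : Prop where
  b_ne : g 0 1 ≠ 0
  c_ne : g 1 0 ≠ 0
  xi : xiC g ∈ Set.Ioo (0 : ℝ) 1
  zeta : zetaC g ∈ Set.Ioo (0 : ℝ) 1

lemma one_le_floor_inv {x : ℝ} (hx : x ∈ Set.Ioo (0 : ℝ) 1) : 1 ≤ ⌊x⁻¹⌋ := by
  rw [Int.le_floor]
  exact_mod_cast (one_le_inv₀ hx.1).2 hx.2.le

/-- A reduced geodesic stays reduced under a continued fraction step, and its time decreases. -/
lemma Red.step {g : GL (Fin 2) ℝ} (hg : Red g) (h : gaussMap (xiC g) ≠ 0) :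
    Red (intGL (stepMat ⌊(xiC g)⁻¹⌋) * g) ∧
    |rhoC (intGL (stepMat ⌊(xiC g)⁻¹⌋) * g)| < |rhoC g| := by
  have hn : (1 : ℝ) ≤ ⌊(xiC g)⁻¹⌋ := by exact_mod_cast one_le_floor_inv hg.xi
  have hz := hg.zeta
  have hx := hg.xi
  have hpos : (0 : ℝ) < ⌊(xiC g)⁻¹⌋ + zetaC g := by linarith [hz.1]
  obtain ⟨h1, h2, h3, h4, h5⟩ := coords_step hg.b_ne hg.c_ne hg.xi.1.ne' hpos.ne'
  have hz' : 1 / (⌊(xiC g)⁻¹⌋ + zetaC g) < 1 := by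
    rw [div_lt_one hpos]; linarith [hz.1]
  refine ⟨⟨h1, h2, ?_, ?_⟩, ?_⟩
  · rw [h3]
    exact ⟨lt_of_le_of_ne (Int.fract_nonneg _) h.symm, Int.fract_lt_one _⟩
  · rw [h4]
    exact ⟨by positivity, hz'⟩
  · have hr : 0 < |rhoC g| := abs_pos.2 (div_ne_zero hg.c_ne hg.b_ne)
    rw [h5, abs_neg, abs_mul, abs_mul, abs_of_pos hx.1,
      abs_of_pos (by positivity : 0 < 1 / (⌊(xiC g)⁻¹⌋ + zetaC g))]
    calc |rhoC g| * xiC g * (1 / (⌊(xiC g)⁻¹⌋ + zetaC g))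
        ≤ |rhoC g| * xiC g * 1 := by
          have := hx.1
          gcongr
      _ < |rhoC g| := by rw [mul_one]; exact mul_lt_of_lt_one_right hr hx.2

lemma Red.cfMat (k : ℕ) {g : GL (Fin 2) ℝ} (hg : Red g)
    (h : ∀ i, gaussMap^[i] (xiC g) ∈ Set.Ioo (0 : ℝ) 1) :
    Red (intGL (cfMat k (xiC g)) * g) ∧ xiC (intGL (cfMat k (xiC g)) * g) = gaussMap^[k] (xiC g) ∧
    (0 < k → |rhoC (intGL (CFGeodesic.cfMat k (xiC g)) * g)| < |rhoC g|) := by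
  induction k generalizing g with
  | zero => simpa [CFGeodesic.cfMat] using hg
  | succ k ih =>
    have h1 := h 1
    obtain ⟨r1, r2⟩ := hg.step h1.1.ne'
    have hx : xiC (intGL (stepMat ⌊(xiC g)⁻¹⌋) * g) = gaussMap (xiC g) := by
      have hn : (1 : ℝ) ≤ ⌊(xiC g)⁻¹⌋ := by exact_mod_cast one_le_floor_inv hg.xi
      exact (coords_step hg.b_ne hg.c_ne hg.xi.1.ne' (by linarith [hg.zeta.1])).2.2.1
    have := ih r1 (fun i => by rw [hx, ← Function.iterate_succ_apply]; exact h (i + 1))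
    rw [hx, ← Function.iterate_succ_apply, ← mul_assoc, ← map_mul] at this
    refine ⟨this.1, this.2.1, fun _ => ?_⟩
    rcases Nat.eq_zero_or_pos k with rfl | hk
    · simpa [CFGeodesic.cfMat] using r2
    · exact (this.2.2 hk).trans r2

/-! ### Equivalent reduced geodesics -/

/-- In the descent for nonnegative matrices, a continued fraction step keeps the entries
nonnegative. -/
lemma nonneg_of_step {p q P Q n : ℤ} {x : ℝ} (hx0 : 0 < x) (hx1 : x < 1) (hp : 0 ≤ p) (hq : 0 ≤ q)
    (hr : 0 ≤ P + n * p) (hs : 0 ≤ Q + n * q) (hdet : P * q - Q * p = 1 ∨ P * q - Q * p = -1)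
    (hpos : 0 < P * x + Q) (hex : ¬ (p = 1 ∧ q = 0 ∧ Q = 1)) : 0 ≤ P ∧ 0 ≤ Q := by
  by_contra hcon
  rcases lt_or_ge P 0 with hP | hP
  · have hQ : 0 < Q := by
      have hP' : (P : ℝ) < 0 := by exact_mod_cast hP
      have : (0 : ℝ) < Q := by nlinarith
      exact_mod_cast this
    have h1 : q ≤ -P * q := by nlinarith
    have h2 : p ≤ Q * p := by nlinarith
    have hpq : p + q ≤ 1 := by rcases hdet with h | h <;> linarith
    have hpq0 : p = 0 ∧ q = 0 ∨ p = 0 ∧ q = 1 ∨ p = 1 ∧ q = 0 := by omega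
    rcases hpq0 with ⟨rfl, rfl⟩ | ⟨rfl, rfl⟩ | ⟨rfl, rfl⟩
    · omega
    · omega
    · apply hex; refine ⟨rfl, rfl, ?_⟩; omega
  · have hQ : Q < 0 := by
      by_contra h; exact hcon ⟨hP, not_lt.1 h⟩
    have hP2 : 2 ≤ P := by
      have hQ' : (Q : ℝ) ≤ -1 := by exact_mod_cast (by omega : Q ≤ -1)
      have hP' : (0 : ℝ) ≤ P := by exact_mod_cast hP
      have : (1 : ℝ) < P := by nlinarith
      exact_mod_cast this
    have h1 : 0 ≤ -Q * p := mul_nonneg (by omega) hp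
    rcases hq.lt_or_eq with hq' | rfl
    · have h2 : 2 ≤ P * q := by nlinarith
      rcases hdet with h | h <;> linarith
    · simp at hs; omega

/-- If `g = N h` with `g`, `h` reduced and `N` a nonnegative integral matrix, then `h` comes from
`g` by continued fraction steps: each step keeps `N` nonnegative and lowers the sum of its
entries. -/
lemma exists_cfMat_of_nonneg (m : ℕ) {N : GL (Fin 2) ℤ} {g h : GL (Fin 2) ℝ} (hN : ∀ i j, 0 ≤ N i j)
    (hm : N 0 0 + N 0 1 + N 1 0 + N 1 1 ≤ m) (hg : Red g) (hh : Red h)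
    (hit : ∀ i, gaussMap^[i] (xiC g) ∈ Set.Ioo (0 : ℝ) 1) (hgh : g = intGL N * h) :
    ∃ k, N⁻¹ = cfMat k (xiC g) := by
  induction m generalizing N g with
  | zero =>
    exfalso
    have h00 := hN 0 0
    have h01 := hN 0 1
    have h10 := hN 1 0
    have h11 := hN 1 1
    have e0 : N 0 0 = 0 := by push_cast at hm; omega
    have e1 : N 0 1 = 0 := by push_cast at hm; omega
    rcases det_int_cases N with hd | hd <;> rw [e0, e1] at hd <;> simp at hd
  | succ m ih =>
    by_cases hN1 : N = 1
    · exact ⟨0, by rw [hN1, cfMat, inv_one]⟩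
    set n := ⌊(xiC g)⁻¹⌋ with hn
    have hn1 : 1 ≤ n := one_le_floor_inv hg.xi
    have hn1' : (1 : ℝ) ≤ n := by exact_mod_cast hn1
    obtain ⟨e00, e10⟩ := stepMat_mul_apply n N 0
    obtain ⟨e01, e11⟩ := stepMat_mul_apply n N 1
    have h00 := hN 0 0
    have h01 := hN 0 1
    have h10 := hN 1 0
    have h11 := hN 1 1
    have hred := (hg.step (hit 1).1.ne').1
    have hg1 : intGL (stepMat n) * g = intGL (stepMat n * N) * h := by
      rw [hgh, map_mul, mul_assoc]
    have hx1 : xiC (intGL (stepMat n) * g) = gaussMap (xiC g) :=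
      (coords_step hg.b_ne hg.c_ne hg.xi.1.ne' (by linarith [hg.zeta.1])).2.2.1
    obtain ⟨c00, c10, -, -⟩ := coords_int_mul (stepMat n * N) h hh.b_ne hh.c_ne
    rw [← hg1, e00, e01] at c00
    rw [← hg1, e10, e11] at c10
    have hdet1 := det_int_cases (stepMat n * N)
    rw [e00, e01, e10, e11] at hdet1
    have hx := hh.xi
    have h00' : (0 : ℝ) ≤ N 0 0 := by exact_mod_cast h00
    have h01' : (0 : ℝ) ≤ N 0 1 := by exact_mod_cast h01
    have hden : (0 : ℝ) < N 0 0 * xiC h + N 0 1 := by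
      have hne : N 0 0 * xiC h + N 0 1 ≠ (0 : ℝ) := by
        intro h0; rw [h0, mul_zero] at c10; exact hred.c_ne c10
      have : (0 : ℝ) ≤ N 0 0 * xiC h + N 0 1 := by
        have := hx.1
        positivity
      exact lt_of_le_of_ne this hne.symm
    have hpos : (0 : ℝ) < ((N 1 0 - n * N 0 0 : ℤ) : ℝ) * xiC h +
        ((N 1 1 - n * N 0 1 : ℤ) : ℝ) := by
      have hxi : xiC (intGL (stepMat n) * g) =
          (((N 1 0 - n * N 0 0 : ℤ) : ℝ) * xiC h + ((N 1 1 - n * N 0 1 : ℤ) : ℝ)) /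
            (N 0 0 * xiC h + N 0 1) := by
        rw [xiC, c00, c10, mul_div_mul_left _ _ hh.c_ne]
      have := hred.xi.1
      rw [hxi] at this
      exact (div_pos_iff_of_pos_right hden).1 this
    have hex : ¬ (N 0 0 = 1 ∧ N 0 1 = 0 ∧ N 1 1 - n * N 0 1 = 1) := by
      rintro ⟨f1, f2, f3⟩
      rw [f2, mul_zero, sub_zero] at f3
      rcases h10.lt_or_eq with hlt | heq
      · obtain ⟨-, -, b01, b11⟩ := coords_int_mul N h hh.b_ne hh.c_ne
        rw [← hgh, f1, f2] at b01
        rw [← hgh, f3] at b11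
        have hz : zetaC g = zetaC h - N 1 0 := by
          rw [zetaC, b01, b11, ← mul_neg, mul_div_mul_left _ _ hh.b_ne]
          push_cast; ring
        have hN10 : (1 : ℝ) ≤ N 1 0 := by exact_mod_cast hlt
        linarith [hg.zeta.1, hh.zeta.2]
      · apply hN1
        ext i j
        fin_cases i <;> fin_cases j
        · exact f1
        · exact f2
        · exact heq.symm
        · exact f3
    obtain ⟨hP, hQ⟩ := nonneg_of_step (n := n) hx.1 hx.2 h00 h01 (by linarith) (by linarith) hdet1
      hpos hex
    have hsum : 1 ≤ N 0 0 + N 0 1 := by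
      by_contra hlt
      have z0 : N 0 0 = 0 := by omega
      have z1 : N 0 1 = 0 := by omega
      rw [z0, z1] at hden
      simp at hden
    obtain ⟨k, hk⟩ := ih (N := stepMat n * N) (g := intGL (stepMat n) * g) (by
        intro i j
        fin_cases i <;> fin_cases j
        · exact e00 ▸ hP
        · exact e01 ▸ hQ
        · exact e10 ▸ h00
        · exact e11 ▸ h01) (by
        rw [e00, e01, e10, e11]
        push_cast at hm
        nlinarith) hred (fun i => by
        rw [hx1, ← Function.iterate_succ_apply]; exact hit (i + 1)) hg1
    refine ⟨k + 1, ?_⟩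
    rw [cfMat, ← hn, ← hx1, ← hk, mul_inv_rev, inv_mul_cancel_right]

lemma inv_entries (γ : GL (Fin 2) ℤ) : ∃ e : ℤ, (e = 1 ∨ e = -1) ∧ γ⁻¹ 0 0 = e * γ 1 1 ∧
    γ⁻¹ 0 1 = -(e * γ 0 1) ∧ γ⁻¹ 1 0 = -(e * γ 1 0) ∧ γ⁻¹ 1 1 = e * γ 0 0 := by
  have hd : γ.1.det = γ 0 0 * γ 1 1 - γ 0 1 * γ 1 0 := Matrix.det_fin_two _
  refine ⟨γ.1.det, ?_, ?_⟩
  · rw [hd]; exact det_int_cases γ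
  · have hu : γ.1.det * γ.1.det = 1 := by
      rcases det_int_cases γ with h | h <;> rw [hd, h] <;> rfl
    have hinv : (γ⁻¹).1 = γ.1.det • γ.1.adjugate := by
      have : γ.1 * (γ.1.det • γ.1.adjugate) = 1 := by
        rw [Matrix.mul_smul, Matrix.mul_adjugate, smul_smul, hu, one_smul]
      calc (γ⁻¹).1 = (γ⁻¹).1 * (γ.1 * (γ.1.det • γ.1.adjugate)) := by rw [this, mul_one]
        _ = _ := by rw [← mul_assoc, Units.inv_mul, one_mul]
    have e := fun i j => congrFun (congrFun hinv i) j
    refine ⟨?_, ?_, ?_, ?_⟩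
    · rw [e 0 0]; simp [Matrix.adjugate_fin_two]
    · rw [e 0 1]; simp [Matrix.adjugate_fin_two]
    · rw [e 1 0]; simp [Matrix.adjugate_fin_two]
    · rw [e 1 1]; simp [Matrix.adjugate_fin_two]

lemma sign_estimates {u r x z x' z' : ℝ} (hu : 0 < u) (hx : x ∈ Set.Ioo (0 : ℝ) 1)
    (hz : z ∈ Set.Ioo (0 : ℝ) 1) (hx' : x' ∈ Set.Ioo (0 : ℝ) 1) (hz' : z' ∈ Set.Ioo (0 : ℝ) 1)
    (hr : |r| < u * (x * z')) :
    0 ≤ u + x' * z * r ∧ x' * r - x * u ≤ 0 ∧ z * r - z' * u ≤ 0 ∧ 0 ≤ r + z' * u * x := by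
  have small : ∀ c : ℝ, c ∈ Set.Ioo (0 : ℝ) 1 → |c * r| ≤ u * (x * z') := fun c hc => by
    rw [abs_mul, abs_of_pos hc.1]
    exact (mul_le_of_le_one_left (abs_nonneg r) hc.2.le).trans hr.le
  have m1 : u * (x * z') ≤ u * x :=
    mul_le_mul_of_nonneg_left (mul_le_of_le_one_right hx.1.le hz'.2.le) hu.le
  have m2 : u * (x * z') ≤ u * z' :=
    mul_le_mul_of_nonneg_left (mul_le_of_le_one_left hz'.1.le hx.2.le) hu.le
  have m3 : u * x ≤ u := mul_le_of_le_one_right hu.le hx.2.le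
  have h1 := abs_le.1 (small (x' * z) ⟨mul_pos hx'.1 hz.1, mul_lt_one_of_nonneg_of_lt_one_left
    hx'.1.le hx'.2 hz.2.le⟩)
  have h2 := abs_le.1 (small x' hx')
  have h3 := abs_le.1 (small z hz)
  have h4 := abs_lt.1 hr
  refine ⟨by linarith [h1.1], by linarith [h2.2], by linarith [h3.2], by linarith [h4.1]⟩

/-- If `γ` moves a reduced geodesic far enough in the direction of the continued fraction
expansion, then all entries of `γ⁻¹` have the same sign. -/
lemma inv_sign_of_rho_lt {γ : GL (Fin 2) ℤ} {g : GL (Fin 2) ℝ} (hg : Red g)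
    (hh : Red (intGL γ * g))
    (hlt : |rhoC (intGL γ * g)| < |rhoC g| * (xiC g * zetaC (intGL γ * g))) :
    (∀ i j, 0 ≤ γ⁻¹ i j) ∨ (∀ i j, 0 ≤ (-γ⁻¹ : GL (Fin 2) ℤ) i j) := by
  obtain ⟨e00, e10, e01, e11⟩ := coords_int_mul γ g hg.b_ne hg.c_ne
  set x := xiC g with hx
  set z := zetaC g with hz
  set x' := xiC (intGL γ * g) with hx'
  set z' := zetaC (intGL γ * g) with hz'
  set R : ℝ := γ 1 0 * x + γ 1 1 with hR
  set U : ℝ := γ 0 0 - γ 0 1 * z with hU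
  have hR0 : R ≠ 0 := by
    have := hh.c_ne; rw [e10] at this; exact right_ne_zero_of_mul this
  have hU0 : U ≠ 0 := by
    have := hh.b_ne; rw [e01] at this; exact right_ne_zero_of_mul this
  have ex : x' * R = γ 0 0 * x + γ 0 1 := by
    rw [hx', xiC, e00, e10, mul_div_mul_left _ _ hg.c_ne, div_mul_cancel₀ _ hR0]
  have ez : z' * U = -(γ 1 0 - γ 1 1 * z) := by
    rw [hz', zetaC, e11, e01, ← mul_neg, mul_div_mul_left _ _ hg.b_ne, div_mul_cancel₀ _ hU0]
  have er : |rhoC (intGL γ * g)| = |rhoC g| * (|R| / |U|) := by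
    rw [rhoC, rhoC, e10, e01, mul_div_mul_comm, abs_mul, abs_div R]
  have hr : 0 < |rhoC g| := abs_pos.2 (div_ne_zero hg.c_ne hg.b_ne)
  have hUp : 0 < |U| := abs_pos.2 hU0
  obtain ⟨x0, x1⟩ := hg.xi
  obtain ⟨z0, z1⟩ := hg.zeta
  obtain ⟨x0', x1'⟩ := hh.xi
  obtain ⟨z0', z1'⟩ := hh.zeta
  have hRU : |R| < |U| * (x * z') := by
    rw [er] at hlt
    have := lt_of_mul_lt_mul_left hlt hr.le
    rw [div_lt_iff₀ hUp] at this
    linarith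
  have hk : 0 < 1 + x * z := by positivity
  have hp : γ 0 0 * (1 + x * z) = U + x' * R * z := by rw [ex, hU]; ring
  have hq : γ 0 1 * (1 + x * z) = x' * R - x * U := by rw [ex, hU]; ring
  have hrr : γ 1 0 * (1 + x * z) = z * R - z' * U := by rw [ez, hR]; ring
  have hs : γ 1 1 * (1 + x * z) = R + z' * U * x := by rw [ez, hR]; ring
  have main : ∀ σ : ℤ, (σ = 1 ∨ σ = -1) → 0 < σ * U →
      0 ≤ σ * γ 0 0 ∧ σ * γ 0 1 ≤ 0 ∧ σ * γ 1 0 ≤ 0 ∧ 0 ≤ σ * γ 1 1 := by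
    intro σ hσ hσU
    have hσabs : |(σ : ℝ)| = 1 := by rcases hσ with rfl | rfl <;> simp
    have hUa : |U| = σ * U := by
      rw [← abs_of_pos hσU, abs_mul, hσabs, one_mul]
    have hRa : |σ * R| < σ * U * (x * z') := by
      rw [abs_mul, hσabs, one_mul, ← hUa]; exact hRU
    set u := (σ : ℝ) * U with hu
    set r := (σ : ℝ) * R with hrd
    obtain ⟨w1, w2, w3, w4⟩ := sign_estimates hσU ⟨x0, x1⟩ ⟨z0, z1⟩ ⟨x0', x1'⟩ ⟨z0', z1'⟩ hRa
    have conv : ∀ (a : ℤ) (b : ℝ), (a : ℝ) * (1 + x * z) = b → (0 ≤ σ * b → 0 ≤ σ * a) ∧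
        (σ * b ≤ 0 → σ * a ≤ 0) := by
      intro a b hab
      have e : ((σ * a : ℤ) : ℝ) * (1 + x * z) = σ * b := by push_cast; rw [← hab]; ring
      constructor
      · intro h
        rw [← e] at h
        exact_mod_cast (mul_nonneg_iff_of_pos_right hk).1 h
      · intro h
        rw [← e] at h
        have : ((σ * a : ℤ) : ℝ) ≤ 0 := by
          by_contra hc
          exact absurd (mul_pos (not_le.1 hc) hk) (not_lt.2 h)
        exact_mod_cast this
    refine ⟨(conv _ _ hp).1 ?_, (conv _ _ hq).2 ?_, (conv _ _ hrr).2 ?_, (conv _ _ hs).1 ?_⟩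
    · convert w1 using 1; rw [hu, hrd]; ring
    · convert w2 using 1; rw [hu, hrd]; ring
    · convert w3 using 1; rw [hu, hrd]; ring
    · convert w4 using 1; rw [hu, hrd]; ring
  obtain ⟨σ, hσ, hσU⟩ : ∃ σ : ℤ, (σ = 1 ∨ σ = -1) ∧ 0 < σ * U := by
    rcases hU0.lt_or_gt with h | h
    · exact ⟨-1, Or.inr rfl, by push_cast; linarith⟩
    · exact ⟨1, Or.inl rfl, by push_cast; linarith⟩
  obtain ⟨m1, m2, m3, m4⟩ := main σ hσ hσU
  obtain ⟨e, he, i00, i01, i10, i11⟩ := inv_entries γ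
  have hσe : σ = e ∨ σ = -e := by rcases hσ with rfl | rfl <;> rcases he with rfl | rfl <;> simp
  rcases hσe with rfl | rfl
  · left
    intro i j
    fin_cases i <;> fin_cases j
    · exact i00 ▸ m4
    · exact i01 ▸ (by linarith)
    · exact i10 ▸ (by linarith)
    · exact i11 ▸ m1
  · right
    intro i j
    rw [Units.val_neg, Matrix.neg_apply]
    fin_cases i <;> fin_cases j
    · exact i00 ▸ (by linarith)
    · exact i01 ▸ (by linarith)
    · exact i10 ▸ (by linarith)
    · exact i11 ▸ (by linarith)

/-! ### Quadratic irrationals -/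

lemma irrational_of_mem_QI {α : ℝ} (hα : α ∈ QI) : Irrational α := by
  rintro ⟨q, hq⟩
  have hbot : ℚ⟮α⟯ = ⊥ := by
    rw [IntermediateField.adjoin_simple_eq_bot_iff, IntermediateField.mem_bot]
    exact ⟨q, by rw [eq_ratCast, hq]⟩
  have h3 : Module.finrank ℚ ℚ⟮α⟯ = 2 := hα
  rw [hbot, IntermediateField.finrank_bot] at h3
  omega

/-- `(A, B, C)` is an integral binary quadratic form and `p = (x, z)` a pair for which `x` and
`-1 / z` are its two roots. -/
structure IsRootPair (A B C : ℤ) (p : ℝ × ℝ) : Prop where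
  x_irr : Irrational p.1
  z_irr : Irrational p.2
  ne : 1 + p.1 * p.2 ≠ 0
  A_ne : A ≠ 0
  root : A * p.1 ^ 2 + B * p.1 + C = 0
  root' : A - B * p.2 + C * p.2 ^ 2 = 0

/-- The two ends of the geodesic of a quadratic irrational, in the coordinates `(ξ, ζ)`, are the
roots of an integral binary quadratic form. -/
lemma exists_isRootPair {α : ℝ} (hα : α ∈ QI) :
    ∃ A B C : ℤ, IsRootPair A B C (α, -1 / galConj α) := by
  have hfin : Module.finrank ℚ ℚ⟮α⟯ = 2 := hα
  have hirr := irrational_of_mem_QI hα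
  have : FiniteDimensional ℚ ℚ⟮α⟯ := Module.finite_of_finrank_pos (by omega)
  have hint : IsIntegral ℚ α := (IntermediateField.AdjoinSimple.isIntegral_gen ℚ α).1
    (Algebra.IsIntegral.isIntegral _)
  have hdeg : (minpoly ℚ α).natDegree = 2 := by
    rw [← IntermediateField.adjoin.finrank hint, hfin]
  have hmonic := minpoly.monic hint
  set b := (minpoly ℚ α).coeff 1 with hb
  set c := (minpoly ℚ α).coeff 0 with hc
  have hroot : α ^ 2 + b * α + c = 0 := by
    have h := minpoly.aeval ℚ α
    have h2 : (minpoly ℚ α).coeff 2 = 1 := by rw [← hdeg]; exact hmonic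
    rw [Polynomial.aeval_eq_sum_range, hdeg] at h
    simp only [Finset.sum_range_succ, Finset.sum_range_zero, h2, ← hb, ← hc] at h
    simp only [Rat.smul_def] at h
    push_cast at h
    linarith
  have hconj : galConj α = -b - α := rfl
  have hroot' : galConj α ^ 2 + b * galConj α + c = 0 := by rw [hconj]; linear_combination hroot
  have hirr' : Irrational (galConj α) := by
    rw [hconj, show (-(b : ℝ) - α) = ((-b : ℚ) : ℝ) - α by push_cast; ring]
    exact hirr.ratCast_sub _
  have h0 : galConj α ≠ 0 := hirr'.ne_zero
  have hbd : (b.den : ℝ) * b = b.num := by exact_mod_cast Rat.den_mul_eq_num b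
  have hcd : (c.den : ℝ) * c = c.num := by exact_mod_cast Rat.den_mul_eq_num c
  have hz : Irrational (-1 / galConj α) := by
    rw [neg_div, one_div]; exact hirr'.inv.neg
  refine ⟨b.den * c.den, b.num * c.den, c.num * b.den, hirr, hz, ?_, ?_, ?_, ?_⟩
  · show 1 + α * (-1 / galConj α) ≠ 0
    intro h
    field_simp at h
    exact ne_galConj hα (by linarith)
  · exact mul_ne_zero (by exact_mod_cast b.den_nz) (by exact_mod_cast c.den_nz)
  · push_cast
    rw [← hbd, ← hcd]
    linear_combination (b.den * c.den : ℝ) * hroot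
  · push_cast
    rw [← hbd, ← hcd]
    have : (1 : ℝ) + b * (1 / galConj α) + c * (1 / galConj α) ^ 2 = 0 := by
      field_simp
      linear_combination hroot'
    linear_combination (b.den * c.den : ℝ) * this

namespace IsRootPair

variable {A B C : ℤ} {p : ℝ × ℝ}

lemma C_ne (h : IsRootPair A B C p) : C ≠ 0 := by
  rintro rfl
  have hx := h.x_irr.ne_zero
  have h1 : p.1 * (A * p.1 + B) = 0 := by have := h.root; push_cast at this; linear_combination this
  have h2 := (mul_eq_zero.1 h1).resolve_left hx
  exact ((h.x_irr.intCast_mul h.A_ne).add_intCast B).ne_zero h2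

lemma lin (h : IsRootPair A B C p) : A * (p.1 * p.2 - 1) + B * p.2 = 0 := by
  have : (1 + p.1 * p.2) * (A * (p.1 * p.2 - 1) + B * p.2) = 0 := by
    linear_combination p.2 ^ 2 * h.root - h.root'
  exact (mul_eq_zero.1 this).resolve_left h.ne

lemma prod (h : IsRootPair A B C p) : A * p.1 + C * p.2 = 0 := by
  linear_combination p.2 * h.root - p.1 * h.lin

lemma floor_add_ne (h : IsRootPair A B C p) (n : ℤ) : (n + p.2 : ℝ) ≠ 0 :=
  (h.z_irr.intCast_add n).ne_zero

lemma pairStep (h : IsRootPair A B C p) :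
    IsRootPair C (B + 2 * C * ⌊p.1⁻¹⌋) (A + B * ⌊p.1⁻¹⌋ + C * ⌊p.1⁻¹⌋ ^ 2)
      (CFGeodesic.pairStep p) := by
  have hx0 := h.x_irr.ne_zero
  have hz0 := h.floor_add_ne ⌊p.1⁻¹⌋
  have hroot := h.root
  have hroot' := h.root'
  have hne := h.ne
  obtain ⟨x, z⟩ := p
  simp only [CFGeodesic.pairStep, gaussMap, Int.fract] at *
  generalize ⌊x⁻¹⌋ = n at *
  refine ⟨?_, ?_, ?_, h.C_ne, ?_, ?_⟩
  · exact h.x_irr.inv.sub_intCast n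
  · rw [one_div]; exact (h.z_irr.intCast_add n).inv
  · simp only
    intro h0
    field_simp at h0
    apply hne
    linarith
  · simp only
    push_cast
    have : (A : ℝ) + B * x⁻¹ + C * x⁻¹ ^ 2 = 0 := by
      field_simp
      linear_combination hroot
    linear_combination this
  · simp only
    push_cast
    field_simp
    linear_combination hroot'

/-- The first coordinate determines the second one: two forms with a common irrational root are
proportional. -/
lemma snd_eq {A' B' C' : ℤ} {z : ℝ} (h : IsRootPair A B C p) (h' : IsRootPair A' B' C' (p.1, z)) :
    p.2 = z := by
  have e1 := h.lin
  have e2 := h'.lin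
  have r1 := h.root
  have r2 := h'.root
  simp only at e2 r2
  have hdet : A' * B - A * B' = 0 := by
    by_contra hne
    have : ((A' * B - A * B' : ℤ) : ℝ) * p.1 + (A' * C - A * C' : ℤ) = 0 := by
      push_cast
      linear_combination A' * r1 - A * r2
    exact ((h.x_irr.intCast_mul hne).add_intCast _).ne_zero this
  have hdet' : (A' : ℝ) * B - A * B' = 0 := by exact_mod_cast hdet
  have key : (A' : ℝ) * ((A * p.1 + B) * (p.2 - z)) = 0 := by
    linear_combination A' * e1 - A * e2 - z * hdet'
  have k1 := (mul_eq_zero.1 key).resolve_left (by exact_mod_cast h'.A_ne)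
  have k2 := (mul_eq_zero.1 k1).resolve_left
    ((h.x_irr.intCast_mul h.A_ne).add_intCast B).ne_zero
  linarith

end IsRootPair

/-- The pairs of roots, lying in the square `(0, 1)²`, of forms of discriminant `D`. -/
def rootPairs (D : ℤ) : Set (ℝ × ℝ) :=
  {p | p.1 ∈ Set.Ioo (0 : ℝ) 1 ∧ p.2 ∈ Set.Ioo (0 : ℝ) 1 ∧
    ∃ A B C : ℤ, IsRootPair A B C p ∧ B ^ 2 - 4 * A * C = D}

lemma IsRootPair.mul_neg {A B C : ℤ} {p : ℝ × ℝ} (h : IsRootPair A B C p) (hx : 0 < p.1)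
    (hz : 0 < p.2) : A * C < 0 := by
  have e : (A * C : ℝ) * p.2 = -(A ^ 2 * p.1) := by linear_combination (A : ℝ) * h.prod
  have hA : (0 : ℝ) < A ^ 2 := by
    have : (A : ℝ) ≠ 0 := by exact_mod_cast h.A_ne
    positivity
  have : (A * C : ℝ) < 0 := by
    by_contra hc
    have h1 := mul_nonneg (not_lt.1 hc) hz.le
    have h2 := mul_pos hA hx
    linarith
  exact_mod_cast this

/-- There are finitely many reduced pairs of a given discriminant. -/
lemma finite_rootPairs (D : ℤ) : (rootPairs D).Finite := by
  have hsub : rootPairs D ⊆ ⋃ t ∈ (Set.Icc (-D) D ×ˢ (Set.Icc (-D) D ×ˢ Set.Icc (-D) D) :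
      Set (ℤ × ℤ × ℤ)), {p | p.1 ∈ Set.Ioo (0 : ℝ) 1 ∧ p.2 ∈ Set.Ioo (0 : ℝ) 1 ∧
        IsRootPair t.1 t.2.1 t.2.2 p} := by
    rintro p ⟨hx, hz, A, B, C, h, hD⟩
    have hAC := h.mul_neg hx.1 hz.1
    have hA : |A| ≤ D := by
      have h1 : 1 ≤ |C| := Int.one_le_abs h.C_ne
      have h2 : |A| * |C| = -(A * C) := by rw [← abs_mul, abs_of_neg hAC]
      nlinarith [abs_nonneg A, sq_nonneg B]
    have hC : |C| ≤ D := by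
      have h1 : 1 ≤ |A| := Int.one_le_abs h.A_ne
      have h2 : |A| * |C| = -(A * C) := by rw [← abs_mul, abs_of_neg hAC]
      nlinarith [abs_nonneg C, sq_nonneg B]
    have hB : |B| ≤ D := by
      have h1 : |B| ≤ B ^ 2 := by
        rw [← sq_abs]
        rcases (abs_nonneg B).eq_or_lt with h0 | h0
        · rw [← h0]; norm_num
        · nlinarith
      linarith
    simp only [Set.mem_iUnion]
    exact ⟨(A, B, C), ⟨abs_le.1 hA, abs_le.1 hB, abs_le.1 hC⟩, hx, hz, h⟩
  refine Set.Finite.subset (Set.Finite.biUnion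
    ((Set.finite_Icc _ _).prod ((Set.finite_Icc _ _).prod (Set.finite_Icc _ _))) ?_) hsub
  rintro ⟨A, B, C⟩ -
  apply Set.Subsingleton.finite
  rintro p ⟨hx, hz, h⟩ q ⟨hx', hz', h'⟩
  simp only at h h'
  -- the other root of the form is negative
  have hxx : p.1 = q.1 := by
    by_contra hne
    have e : (p.1 - q.1) * (A * (p.1 + q.1) + B) = 0 := by linear_combination h.root - h'.root
    have e2 := (mul_eq_zero.1 e).resolve_left (sub_ne_zero.2 hne)
    have e3 : (A ^ 2 * (p.1 * q.1) : ℝ) = A * C := by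
      linear_combination (A * p.1 : ℝ) * e2 - (A : ℝ) * h.root
    have h1 : (A * C : ℝ) < 0 := by exact_mod_cast h.mul_neg hx.1 hz.1
    have h2 : (0 : ℝ) ≤ A ^ 2 * (p.1 * q.1) := by
      have := hx.1; have := hx'.1; positivity
    linarith
  exact Prod.ext hxx (h.snd_eq (z := q.2) (by rw [hxx]; exact h'))

lemma mapsTo_pairStep (D : ℤ) : Set.MapsTo pairStep (rootPairs D) (rootPairs D) := by
  rintro p ⟨hx, hz, A, B, C, h, hD⟩
  have h' := h.pairStep
  have hn : (1 : ℝ) ≤ ⌊p.1⁻¹⌋ := by exact_mod_cast one_le_floor_inv hx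
  refine ⟨⟨?_, ?_⟩, ⟨?_, ?_⟩, _, _, _, h', ?_⟩
  · exact lt_of_le_of_ne (Int.fract_nonneg _) h'.x_irr.ne_zero.symm
  · exact Int.fract_lt_one _
  · have := hz.1
    show 0 < 1 / (⌊p.1⁻¹⌋ + p.2 : ℝ)
    positivity
  · show 1 / (⌊p.1⁻¹⌋ + p.2 : ℝ) < 1
    have := hz.1
    rw [div_lt_one (by positivity)]; linarith
  · rw [← hD]; ring

lemma injOn_pairStep :
    Set.InjOn pairStep (Set.Ioo (0 : ℝ) 1 ×ˢ Set.Ioo (0 : ℝ) 1) := by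
  rintro ⟨x, z⟩ ⟨hx, hz⟩ ⟨x', z'⟩ ⟨hx', hz'⟩ h
  simp only [pairStep, Prod.mk.injEq, one_div, inv_inj, gaussMap] at h hx hz hx' hz'
  obtain ⟨h1, h2⟩ := h
  have hfl : ⌊x⁻¹⌋ = ⌊x'⁻¹⌋ := by
    have := congrArg Int.floor h2
    rwa [Int.floor_intCast_add, Int.floor_intCast_add, Int.floor_eq_zero_iff.2 ⟨hz.1.le, hz.2⟩,
      Int.floor_eq_zero_iff.2 ⟨hz'.1.le, hz'.2⟩, add_zero, add_zero] at this
  rw [hfl] at h2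
  have e1 : x⁻¹ = x'⁻¹ := by
    rw [← Int.floor_add_fract x⁻¹, ← Int.floor_add_fract x'⁻¹, hfl, h1]
  exact Prod.ext (inv_injective e1) (add_left_cancel h2)

/-- Two numbers with the same continued fraction digits are equal: every two steps of the continued
fraction expansion multiply their distance by at least `4`. -/
lemma eq_of_digits {y w n : ℕ → ℝ} (hn : ∀ k, 1 ≤ n k) (hy : ∀ k, y k ∈ Set.Ioo (0 : ℝ) 1)
    (hw : ∀ k, w k ∈ Set.Ioo (0 : ℝ) 1) (hyn : ∀ k, y k * (n k + y (k + 1)) = 1)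
    (hwn : ∀ k, w k * (n k + w (k + 1)) = 1) : y 0 = w 0 := by
  have half : ∀ {u : ℕ → ℝ}, (∀ k, u k ∈ Set.Ioo (0 : ℝ) 1) →
      (∀ k, u k * (n k + u (k + 1)) = 1) → ∀ k, u k * u (k + 1) ≤ 1 / 2 := by
    intro u hu hun k
    have h1 := hun k
    have h2 : u k * u (k + 1) ≤ u k * n k :=
      mul_le_mul_of_nonneg_left ((hu (k + 1)).2.le.trans (hn k)) (hu k).1.le
    linarith
  have step : ∀ k, |y k - w k| = |y (k + 1) - w (k + 1)| * (y k * w k) := by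
    intro k
    have : y k - w k = (w (k + 1) - y (k + 1)) * (y k * w k) := by
      linear_combination w k * hyn k - y k * hwn k
    rw [this, abs_mul, abs_sub_comm, abs_of_pos (mul_pos (hy k).1 (hw k).1)]
  have step2 : ∀ k, |y k - w k| ≤ |y (k + 2) - w (k + 2)| * (1 / 4) := by
    intro k
    rw [step k, step (k + 1), mul_assoc]
    gcongr
    calc y (k + 1) * w (k + 1) * (y k * w k) = (y k * y (k + 1)) * (w k * w (k + 1)) := by ring
      _ ≤ 1 / 2 * (1 / 2) := by
        have := (hw k).1; have := (hw (k + 1)).1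
        exact mul_le_mul (half hy hyn k) (half hw hwn k) (by positivity) (by norm_num)
      _ = 1 / 4 := by norm_num
  have bound : ∀ m, |y 0 - w 0| ≤ |y (2 * m) - w (2 * m)| * (1 / 4) ^ m := by
    intro m
    induction m with
    | zero => simp
    | succ m ih =>
      refine ih.trans ?_
      rw [pow_succ', ← mul_assoc]
      gcongr
      exact step2 _
  have bound1 : ∀ m : ℕ, |y 0 - w 0| ≤ (1 / 4 : ℝ) ^ m := by
    intro m
    refine (bound m).trans (mul_le_of_le_one_left (by positivity) ?_)
    rw [abs_le]
    constructor <;> linarith [(hy (2 * m)).1, (hy (2 * m)).2, (hw (2 * m)).1, (hw (2 * m)).2]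
  have := ge_of_tendsto' (tendsto_pow_atTop_nhds_zero_of_lt_one (by norm_num : (0 : ℝ) ≤ 1 / 4)
    (by norm_num)) bound1
  exact sub_eq_zero.1 (abs_nonpos_iff.1 this)

lemma isRootPair_iterate {A B C : ℤ} {p : ℝ × ℝ} (h : IsRootPair A B C p) (k : ℕ) :
    ∃ A' B' C' : ℤ, IsRootPair A' B' C' (pairStep^[k] p) ∧
      B' ^ 2 - 4 * A' * C' = B ^ 2 - 4 * A * C := by
  induction k with
  | zero => exact ⟨A, B, C, h, rfl⟩
  | succ k ih =>
    obtain ⟨A', B', C', h', hD⟩ := ih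
    rw [Function.iterate_succ_apply']
    exact ⟨_, _, _, h'.pairStep, by rw [← hD]; ring⟩

/-- The backward end point of the geodesic is eventually positive: otherwise both end points
would have the same continued fraction expansion. -/
lemma exists_snd_pos {A B C : ℤ} {p : ℝ × ℝ} (h : IsRootPair A B C p)
    (hx : p.1 ∈ Set.Ioo (0 : ℝ) 1) : ∃ k, 0 < (pairStep^[k] p).2 := by
  by_contra! hneg
  have hxk : ∀ k, (pairStep^[k] p).1 ∈ Set.Ioo (0 : ℝ) 1 := by
    intro k
    rcases k with _ | k
    · exact hx
    · obtain ⟨A', B', C', h', -⟩ := isRootPair_iterate h (k + 1)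
      have h0 := h'.x_irr.ne_zero
      rw [Function.iterate_succ_apply'] at h0 ⊢
      exact ⟨lt_of_le_of_ne (Int.fract_nonneg _) h0.symm, Int.fract_lt_one _⟩
  have hzk : ∀ k, (pairStep^[k] p).2 < 0 := by
    intro k
    obtain ⟨A', B', C', h', -⟩ := isRootPair_iterate h k
    exact lt_of_le_of_ne (hneg k) h'.z_irr.ne_zero
  have hn : ∀ k, (1 : ℝ) ≤ ⌊(pairStep^[k] p).1⁻¹⌋ := fun k => by
    exact_mod_cast one_le_floor_inv (hxk k)
  have hzn : ∀ k, (⌊(pairStep^[k] p).1⁻¹⌋ + (pairStep^[k] p).2 : ℝ) < 0 := by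
    intro k
    have := hzk (k + 1)
    rw [Function.iterate_succ_apply'] at this
    exact one_div_neg.1 this
  have key := eq_of_digits (y := fun k => (pairStep^[k] p).1)
    (w := fun k => -1 / (pairStep^[k] p).2) (n := fun k => ⌊(pairStep^[k] p).1⁻¹⌋) hn hxk ?_ ?_ ?_
  · simp only [Function.iterate_zero, id] at key
    apply h.ne
    rw [key]
    have := (hzk 0).ne
    simp only [Function.iterate_zero, id] at this
    field_simp
    ring
  · intro k
    have h1 := hzk k
    refine ⟨div_pos_of_neg_of_neg (by norm_num) h1, ?_⟩
    rw [div_lt_one_of_neg h1]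
    linarith [hn k, hzn k]
  · intro k
    have h0 := (hxk k).1.ne'
    simp only [Function.iterate_succ_apply', pairStep, gaussMap, Int.fract]
    field_simp
    ring
  · intro k
    have h0 := (hzk k).ne
    have h1 := (hzn k).ne
    simp only [Function.iterate_succ_apply', pairStep]
    field_simp
    ring

lemma zetaC_gMat (α : QI) : (gMat α) 0 1 ≠ 0 ∧ (gMat α) 1 0 ≠ 0 ∧ xiC (gMat α) = α ∧
    zetaC (gMat α) = -1 / galConj α := by
  obtain ⟨A, B, C, h⟩ := exists_isRootPair α.2
  have h0 : galConj α ≠ 0 := fun h0 => h.z_irr.ne_zero (by simp [h0])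
  unfold gMat xiC zetaC
  split_ifs <;> simp [Matrix.GeneralLinearGroup.mkOfDetNeZero, h0, neg_div]

/-- The matrix `(1, -n; 0, 1)`. -/
def translMat (n : ℤ) : GL (Fin 2) ℤ :=
  ⟨!![1, -n; 0, 1], !![1, n; 0, 1], by simp [Matrix.one_fin_two], by simp [Matrix.one_fin_two]⟩

lemma coords_translMat (n : ℤ) {g : GL (Fin 2) ℝ} (hb : g 0 1 ≠ 0) (hc : g 1 0 ≠ 0)
    (hz : 1 + n * zetaC g ≠ 0) :
    (intGL (translMat n) * g) 0 1 ≠ 0 ∧ (intGL (translMat n) * g) 1 0 ≠ 0 ∧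
    xiC (intGL (translMat n) * g) = xiC g - n ∧
    zetaC (intGL (translMat n) * g) = zetaC g / (1 + n * zetaC g) := by
  obtain ⟨e00, e10, e01, e11⟩ := coords_int_mul (translMat n) g hb hc
  have t00 : translMat n 0 0 = 1 := rfl
  have t01 : translMat n 0 1 = -n := rfl
  have t10 : translMat n 1 0 = 0 := rfl
  have t11 : translMat n 1 1 = 1 := rfl
  rw [t00, t01] at e00 e01
  rw [t10, t11] at e10 e11
  simp only [Int.cast_one, Int.cast_neg, Int.cast_zero] at e00 e10 e01 e11
  refine ⟨?_, ?_, ?_, ?_⟩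
  · rw [e01]; refine mul_ne_zero hb ?_; convert hz using 1; ring
  · rw [e10]; simpa using hc
  · rw [xiC, e00, e10, mul_div_mul_left _ _ hc]; ring
  · rw [zetaC, e11, e01, ← mul_neg, mul_div_mul_left _ _ hb]; congr 1 <;> ring

/-- The geodesic of a quadratic irrational is equivalent to a reduced one whose forward end point
`y` has a purely periodic continued fraction expansion, with the period of `α`; one period of
continued fraction steps maps this reduced geodesic to itself. -/
theorem exists_reduced (α : QI) : ∃ (δ : GL (Fin 2) ℤ) (p : ℕ) (y : ℝ),
    Red (intGL δ * gMat α) ∧ xiC (intGL δ * gMat α) = y ∧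
    (∀ k, gaussMap^[k] y ∈ Set.Ioo (0 : ℝ) 1) ∧ 0 < p ∧ gaussMap^[p] y = y ∧
    Set.InjOn (fun k => gaussMap^[k] y) (Finset.range p) ∧
    zetaC (intGL (cfMat p y) * (intGL δ * gMat α)) = zetaC (intGL δ * gMat α) ∧
    cfPeriod α = (fun k => gaussMap^[k] y) '' (Finset.range p) := by
  obtain ⟨hb, hc, hxg, hzg⟩ := zetaC_gMat α
  obtain ⟨A, B, C, h⟩ := exists_isRootPair α.2
  rw [← hzg, ← hxg] at h
  -- translate the forward end point to `fract α`
  set n := ⌊(α : ℝ)⌋ with hn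
  have hz1 : 1 + n * zetaC (gMat α) ≠ 0 := by
    by_cases hn0 : n = 0
    · simp [hn0]
    · rw [add_comm, ← Int.cast_one]
      exact ((h.z_irr.intCast_mul hn0).add_intCast 1).ne_zero
  obtain ⟨tb, tc, tx, tz⟩ := coords_translMat n hb hc hz1
  set g₁ := intGL (translMat n) * gMat α with hg₁
  have hfr : xiC g₁ = Int.fract (α : ℝ) := by rw [tx, hxg]; rfl
  have h₁ : IsRootPair A (B + 2 * A * n) (C + B * n + A * n ^ 2) (xiC g₁, zetaC g₁) := by
    have r := h.root
    have r' := h.root'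
    have hne := h.ne
    have hzi := h.z_irr
    simp only at r r' hne hzi
    refine ⟨?_, ?_, ?_, h.A_ne, ?_, ?_⟩
    · simp only [tx]; exact h.x_irr.sub_intCast n
    · simp only [tz]
      have : Irrational ((zetaC (gMat α))⁻¹ + n) := hzi.inv.add_intCast n
      have hz0 := hzi.ne_zero
      rw [show zetaC (gMat α) / (1 + n * zetaC (gMat α)) = ((zetaC (gMat α))⁻¹ + n)⁻¹ by
        field_simp]
      exact this.inv
    · simp only [tx, tz]
      intro h0
      field_simp at h0
      apply hne
      linarith
    · simp only [tx]; push_cast; linear_combination r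
    · simp only [tz]; push_cast; field_simp; linear_combination r'
  have hx₁ : xiC g₁ ∈ Set.Ioo (0 : ℝ) 1 := by
    have h0 : xiC g₁ ≠ 0 := h₁.x_irr.ne_zero
    rw [hfr] at h0 ⊢
    exact ⟨lt_of_le_of_ne (Int.fract_nonneg _) h0.symm, Int.fract_lt_one _⟩
  -- after finitely many steps the geodesic is reduced
  set P : ℝ × ℝ := (xiC g₁, zetaC g₁) with hP
  set D : ℤ := (B + 2 * A * n) ^ 2 - 4 * A * (C + B * n + A * n ^ 2) with hD
  obtain ⟨K, hK⟩ := exists_snd_pos h₁ hx₁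
  have hKmem : pairStep^[K + 1] P ∈ rootPairs D := by
    obtain ⟨A', B', C', h', hD'⟩ := isRootPair_iterate h₁ (K + 1)
    obtain ⟨A₂, B₂, C₂, h₂, -⟩ := isRootPair_iterate h₁ K
    have hxK : (pairStep^[K] P).1 ∈ Set.Ioo (0 : ℝ) 1 := by
      rcases K with _ | K
      · exact hx₁
      · have h0 := h₂.x_irr.ne_zero
        rw [Function.iterate_succ_apply'] at h0 ⊢
        exact ⟨lt_of_le_of_ne (Int.fract_nonneg _) h0.symm, Int.fract_lt_one _⟩
    have hn1 : (1 : ℝ) ≤ ⌊(pairStep^[K] P).1⁻¹⌋ := by exact_mod_cast one_le_floor_inv hxK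
    refine ⟨?_, ?_, A', B', C', h', hD'⟩
    · have h0 := h'.x_irr.ne_zero
      rw [Function.iterate_succ_apply'] at h0 ⊢
      exact ⟨lt_of_le_of_ne (Int.fract_nonneg _) h0.symm, Int.fract_lt_one _⟩
    · rw [Function.iterate_succ_apply']
      refine ⟨one_div_pos.2 (by linarith), ?_⟩
      rw [show (pairStep (pairStep^[K] P)).2 = 1 / (⌊(pairStep^[K] P).1⁻¹⌋ + (pairStep^[K] P).2)
        from rfl, div_lt_one (by linarith)]
      linarith
  set K' := K + 1
  have hiter : ∀ i, pairStep^[i] (pairStep^[K'] P) ∈ rootPairs D := fun i =>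
    (mapsTo_pairStep D).iterate i hKmem
  have hmono : rootPairs D ⊆ Set.Ioo (0 : ℝ) 1 ×ˢ Set.Ioo (0 : ℝ) 1 := fun q hq => ⟨hq.1, hq.2.1⟩
  -- the sequence of reduced pairs takes finitely many values
  obtain ⟨i, j, hij, heq⟩ := (finite_rootPairs D).exists_lt_map_eq_of_forall_mem hiter
  have hper : pairStep^[j - i] (pairStep^[K'] P) = pairStep^[K'] P := by
    refine ((injOn_pairStep.mono hmono).iterate (mapsTo_pairStep D) i) (hiter _) hKmem ?_
    rw [← Function.iterate_add_apply, Nat.add_sub_cancel' hij.le, ← heq]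
  obtain ⟨cb, cc, cpair⟩ := coords_cfMat K' tb tc
    (fun i => (isRootPair_iterate h₁ i).elim fun _ ⟨_, _, h', _⟩ => h'.x_irr.ne_zero)
    (fun i => (isRootPair_iterate h₁ i).elim fun _ ⟨_, _, h', _⟩ => h'.z_irr.ne_zero)
  rw [hg₁, ← mul_assoc, ← map_mul, ← hg₁] at cb cc cpair
  set δ := cfMat K' (xiC g₁) * translMat n with hδ
  set y := xiC (intGL δ * gMat α) with hy
  have hyK : y = gaussMap^[K'] (Int.fract (α : ℝ)) := by
    have e := congrArg Prod.fst cpair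
    rw [iterate_pairStep_fst] at e
    rw [← hfr]
    exact e
  have hpair : (y, zetaC (intGL δ * gMat α)) = pairStep^[K'] P := cpair
  have hred : Red (intGL δ * gMat α) := by
    have := hKmem
    rw [← hpair] at this
    exact ⟨cb, cc, this.1, this.2.1⟩
  have hit : ∀ k, gaussMap^[k] y ∈ Set.Ioo (0 : ℝ) 1 := by
    intro k
    have := (hiter k).1
    rwa [iterate_pairStep_fst, ← hpair] at this
  have hyper : Function.IsPeriodicPt gaussMap (j - i) y := by
    have := congrArg Prod.fst hper
    rwa [iterate_pairStep_fst, ← hpair] at this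
  have hymem : y ∈ Function.periodicPts gaussMap := ⟨j - i, by omega, hyper⟩
  set p := Function.minimalPeriod gaussMap y with hp
  have hp0 : 0 < p := Function.minimalPeriod_pos_of_mem_periodicPts hymem
  have hpfix : gaussMap^[p] y = y := Function.isPeriodicPt_minimalPeriod gaussMap y
  refine ⟨δ, p, y, hred, rfl, hit, hp0, hpfix, ?_, ?_, ?_⟩
  · intro k hk l hl hkl
    rw [Finset.coe_range, Set.mem_Iio] at hk hl
    exact (Function.iterate_eq_iterate_iff_of_lt_minimalPeriod hk hl).1 hkl
  · obtain ⟨-, -, e⟩ := coords_cfMat p cb cc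
      (fun i => by
        rw [hpair, ← Function.iterate_add_apply]
        exact (isRootPair_iterate h₁ _).elim fun _ ⟨_, _, h', _⟩ => h'.x_irr.ne_zero)
      (fun i => by
        rw [hpair, ← Function.iterate_add_apply]
        exact (isRootPair_iterate h₁ _).elim fun _ ⟨_, _, h', _⟩ => h'.z_irr.ne_zero)
    have e1 := congrArg Prod.fst e
    have e2 := congrArg Prod.snd e
    rw [iterate_pairStep_fst] at e1
    obtain ⟨-, -, A', B', C', h', -⟩ := hiter p
    obtain ⟨-, -, A₂, B₂, C₂, h₂, -⟩ := hKmem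
    rw [← hpair] at h' h₂
    refine Eq.trans e2 (h'.snd_eq (A' := A₂) (B' := B₂) (C' := C₂)
      (z := zetaC (intGL δ * gMat α)) ?_)
    rw [iterate_pairStep_fst]
    rw [show (y, zetaC (intGL δ * gMat α)).1 = y from rfl, hpfix]
    exact h₂
  · ext w
    constructor
    · rintro ⟨⟨m, rfl⟩, q, hq, hwq⟩
      have e : gaussMap^[m] (Int.fract (α : ℝ)) = gaussMap^[(m + K' * q - K')] y := by
        have h1 : gaussMap^[K' * q] (gaussMap^[m] (Int.fract (α : ℝ))) =
            gaussMap^[m] (Int.fract (α : ℝ)) := hwq.const_mul K'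
        have h2 : K' ≤ K' * q := Nat.le_mul_of_pos_right _ hq
        rw [hyK, ← Function.iterate_add_apply, Nat.sub_add_cancel (by omega), add_comm,
          Function.iterate_add_apply, h1]
      refine ⟨(m + K' * q - K') % p, ?_, ?_⟩
      · rw [Finset.coe_range, Set.mem_Iio]; exact Nat.mod_lt _ hp0
      · rw [e]; exact Function.iterate_mod_minimalPeriod_eq
    · rintro ⟨k, -, rfl⟩
      refine ⟨⟨k + K', ?_⟩, ?_⟩
      · rw [Function.iterate_add_apply, ← hyK]
      · exact ⟨p, hp0, (Function.isPeriodicPt_minimalPeriod gaussMap y).apply_iterate k⟩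

/-! ### Closed geodesics -/

/-- The diagonal matrix with entries `u`, `v`. -/
def diagGL : ℝˣ × ℝˣ →* GL (Fin 2) ℝ where
  toFun w := ⟨!![(w.1 : ℝ), 0; 0, (w.2 : ℝ)], !![((w.1⁻¹ : ℝˣ) : ℝ), 0; 0, ((w.2⁻¹ : ℝˣ) : ℝ)],
    by simp [Matrix.one_fin_two], by simp [Matrix.one_fin_two]⟩
  map_one' := by
    ext i j; fin_cases i <;> fin_cases j <;> rfl
  map_mul' w w' := by
    ext i j
    fin_cases i <;> fin_cases j <;> simp

lemma mul_diagGL_apply (g : GL (Fin 2) ℝ) (w : ℝˣ × ℝˣ) (i : Fin 2) :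
    (g * diagGL w) i 0 = g i 0 * w.1 ∧ (g * diagGL w) i 1 = g i 1 * w.2 := by
  rw [mul_apply_two, mul_apply_two]
  simp [diagGL]

lemma mul_diagExp_apply (g : GL (Fin 2) ℝ) (t : ℝ) (i : Fin 2) :
    (g * diagExp t) i 0 = g i 0 * Real.exp t ∧ (g * diagExp t) i 1 = g i 1 * 1 := by
  rw [mul_apply_two, mul_apply_two]
  simp [diagExp, Matrix.GeneralLinearGroup.mkOfDetNeZero]

lemma coords_mul_diagGL (g : GL (Fin 2) ℝ) (w : ℝˣ × ℝˣ) :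
    xiC (g * diagGL w) = xiC g ∧ zetaC (g * diagGL w) = zetaC g ∧
      rhoC (g * diagGL w) = rhoC g * (w.1 / w.2) :=
  coords_of_cols w.1.ne_zero w.2.ne_zero (fun i => (mul_diagGL_apply g w i).1)
    (fun i => (mul_diagGL_apply g w i).2)

lemma coords_mul_diagExp (g : GL (Fin 2) ℝ) (t : ℝ) :
    xiC (g * diagExp t) = xiC g ∧ zetaC (g * diagExp t) = zetaC g ∧
      rhoC (g * diagExp t) = rhoC g * Real.exp t := by
  have := coords_of_cols (Real.exp_ne_zero t) one_ne_zero (fun i => (mul_diagExp_apply g t i).1)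
    (fun i => (mul_diagExp_apply g t i).2)
  rwa [div_one] at this

lemma phi_mul_diagExp (ψ : ℝ × ℝ → ℝ) (g : GL (Fin 2) ℝ) (t : ℝ) :
    phi ψ (g * diagExp t) = ψ (xiC g, zetaC g) * hat (|rhoC g| * Real.exp t) := by
  obtain ⟨a, b, c⟩ := coords_mul_diagExp g t
  rw [phi, a, b, c, abs_mul, Real.abs_exp]

/-- A reduced geodesic that `p` steps of the continued fraction expansion of its forward end
point map to itself; `diagGL (u, v)` is the corresponding holonomy and `ℓ` the length travelled. -/
structure ClosedRed (g : GL (Fin 2) ℝ) (p : ℕ) (u v : ℝˣ) (ℓ : ℝ) : Prop extends Red g where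
  mem : ∀ k, gaussMap^[k] (xiC g) ∈ Set.Ioo (0 : ℝ) 1
  pos : 0 < p
  period : gaussMap^[p] (xiC g) = xiC g
  inj : Set.InjOn (fun k => gaussMap^[k] (xiC g)) (Finset.range p)
  length_pos : 0 < ℓ
  semiconj : intGL (CFGeodesic.cfMat p (xiC g)) * g = g * diagGL (u, v)
  abs_ratio : |(u / v : ℝ)| = Real.exp (-ℓ)
  mul_eq : (u * v : ℝ) = (-1) ^ p

lemma det_GL (g : GL (Fin 2) ℝ) : g 0 0 * g 1 1 - g 0 1 * g 1 0 ≠ 0 := by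
  have := g.det_ne_zero
  rwa [Matrix.det_fin_two] at this

/-- A reduced geodesic with periodic end points is closed. -/
lemma exists_closedRed {g : GL (Fin 2) ℝ} {p : ℕ} (hg : Red g)
    (hmem : ∀ k, gaussMap^[k] (xiC g) ∈ Set.Ioo (0 : ℝ) 1) (hp : 0 < p)
    (hper : gaussMap^[p] (xiC g) = xiC g)
    (hinj : Set.InjOn (fun k => gaussMap^[k] (xiC g)) (Finset.range p))
    (hz : zetaC (intGL (cfMat p (xiC g)) * g) = zetaC g) :
    ∃ u v ℓ, ClosedRed g p u v ℓ := by
  obtain ⟨hr, hx, hlt⟩ := hg.cfMat p hmem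
  rw [hper] at hx
  set h := intGL (cfMat p (xiC g)) * g with hh
  have hc := hg.c_ne
  have hb := hg.b_ne
  have h00 : h 0 0 = g 0 0 * (h 1 0 / g 1 0) := by
    have := hr.c_ne
    unfold xiC at hx
    field_simp at hx ⊢
    linarith
  have h10 : h 1 0 = g 1 0 * (h 1 0 / g 1 0) := by field_simp
  have h01 : h 0 1 = g 0 1 * (h 0 1 / g 0 1) := by field_simp
  have h11 : h 1 1 = g 1 1 * (h 0 1 / g 0 1) := by
    have := hr.b_ne
    unfold zetaC at hz
    field_simp at hz ⊢
    linarith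
  set u : ℝˣ := Units.mk0 (h 1 0 / g 1 0) (div_ne_zero hr.c_ne hc) with hu
  set v : ℝˣ := Units.mk0 (h 0 1 / g 0 1) (div_ne_zero hr.b_ne hb) with hv
  have hconj : h = g * diagGL (u, v) := by
    ext i j
    fin_cases j
    · refine Eq.trans ?_ (mul_diagGL_apply g (u, v) i).1.symm
      fin_cases i
      · exact h00
      · exact h10
    · refine Eq.trans ?_ (mul_diagGL_apply g (u, v) i).2.symm
      fin_cases i
      · exact h01
      · exact h11
  have hrho : rhoC h = rhoC g * (u / v) := by
    rw [hconj]; exact (coords_mul_diagGL g (u, v)).2.2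
  have hρ : 0 < |rhoC g| := abs_pos.2 (div_ne_zero hc hb)
  have habs : |(u / v : ℝ)| < 1 := by
    have := hlt hp
    rw [hrho, abs_mul] at this
    exact (mul_lt_iff_lt_one_right hρ).1 this
  have habs0 : 0 < |(u / v : ℝ)| := abs_pos.2 (div_ne_zero u.ne_zero v.ne_zero)
  refine ⟨u, v, -Real.log |(u / v : ℝ)|, hg, hmem, hp, hper, hinj, ?_, hconj, ?_, ?_⟩
  · have := Real.log_neg habs0 habs; linarith
  · rw [neg_neg, Real.exp_log habs0]
  · have hdet : h 0 0 * h 1 1 - h 0 1 * h 1 0 =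
        (-1) ^ p * (g 0 0 * g 1 1 - g 0 1 * g 1 0) := by
      have := det_cfMat p (xiC g)
      have : (cfMat p (xiC g) 0 0 * cfMat p (xiC g) 1 1 -
        cfMat p (xiC g) 0 1 * cfMat p (xiC g) 1 0 : ℝ) = (-1) ^ p := by exact_mod_cast this
      rw [← this]
      simp only [hh, intGL_mul_apply]
      ring
    have e : h 0 0 * h 1 1 - h 0 1 * h 1 0 = (u * v : ℝ) * (g 0 0 * g 1 1 - g 0 1 * g 1 0) := by
      rw [hu, hv, Units.val_mk0, Units.val_mk0]
      linear_combination h11 * h 0 0 + g 1 1 * (h 0 1 / g 0 1) * h00 - h10 * h 0 1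
        - g 1 0 * (h 1 0 / g 1 0) * h01
    exact mul_right_cancel₀ (det_GL g) (e.symm.trans hdet)

namespace ClosedRed

variable {g : GL (Fin 2) ℝ} {p : ℕ} {u v : ℝˣ} {ℓ : ℝ}

lemma cfMat_zpow (h : ClosedRed g p u v ℓ) (m : ℤ) :
    intGL (CFGeodesic.cfMat p (xiC g) ^ m) * g = g * diagGL (u ^ m, v ^ m) := by
  have hs : SemiconjBy g (diagGL (u, v)) (intGL (CFGeodesic.cfMat p (xiC g))) := h.semiconj.symm
  rw [map_zpow]
  refine (hs.zpow_right m).eq.symm.trans ?_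
  rw [← map_zpow]
  rfl

lemma abs_ratio_zpow (h : ClosedRed g p u v ℓ) (m : ℤ) :
    |(((u ^ m : ℝˣ) : ℝ) / ((v ^ m : ℝˣ) : ℝ))| = Real.exp (-(m * ℓ)) := by
  rw [Units.val_zpow_eq_zpow_val, Units.val_zpow_eq_zpow_val, ← div_zpow, abs_zpow, h.abs_ratio,
    show -((m : ℝ) * ℓ) = -ℓ * m by ring, Real.exp_mul, Real.rpow_intCast]

/-- The elements of `GL₂(ℤ)` that map a closed reduced geodesic to a reduced one. -/
def param (g : GL (Fin 2) ℝ) (p : ℕ) (a : Bool × Fin p × ℤ) : GL (Fin 2) ℤ :=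
  cond a.1 1 (-1) * (CFGeodesic.cfMat a.2.1 (xiC g) * CFGeodesic.cfMat p (xiC g) ^ a.2.2)

lemma coords_param (h : ClosedRed g p u v ℓ) (k : ℕ) (m : ℤ) :
    xiC (intGL (CFGeodesic.cfMat k (xiC g) * CFGeodesic.cfMat p (xiC g) ^ m) * g) =
      gaussMap^[k] (xiC g) ∧
    zetaC (intGL (CFGeodesic.cfMat k (xiC g) * CFGeodesic.cfMat p (xiC g) ^ m) * g) =
      zetaC (intGL (CFGeodesic.cfMat k (xiC g)) * g) ∧
    |rhoC (intGL (CFGeodesic.cfMat k (xiC g) * CFGeodesic.cfMat p (xiC g) ^ m) * g)| =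
      |rhoC (intGL (CFGeodesic.cfMat k (xiC g)) * g)| * Real.exp (-(m * ℓ)) := by
  rw [map_mul, mul_assoc, h.cfMat_zpow, ← mul_assoc]
  obtain ⟨a, b, c⟩ := coords_mul_diagGL (intGL (CFGeodesic.cfMat k (xiC g)) * g) (u ^ m, v ^ m)
  refine ⟨a.trans (h.toRed.cfMat k h.mem).2.1, b, ?_⟩
  rw [c, abs_mul, h.abs_ratio_zpow]

lemma neg_cols (h : GL (Fin 2) ℝ) : xiC (-h) = xiC h ∧ zetaC (-h) = zetaC h ∧
    rhoC (-h) = rhoC h := by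
  have := coords_of_cols (g := h) (h := -h) (u := -1) (v := -1) (by norm_num) (by norm_num)
    (by simp) (by simp)
  simpa using this

/-- The sign in `param` does not affect the coordinates. -/
lemma coords_param_sign (g : GL (Fin 2) ℝ) (p : ℕ) (a : Bool × Fin p × ℤ) :
    xiC (intGL (param g p a) * g) =
      xiC (intGL (CFGeodesic.cfMat a.2.1 (xiC g) * CFGeodesic.cfMat p (xiC g) ^ a.2.2) * g) ∧
    zetaC (intGL (param g p a) * g) =
      zetaC (intGL (CFGeodesic.cfMat a.2.1 (xiC g) * CFGeodesic.cfMat p (xiC g) ^ a.2.2) * g) ∧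
    rhoC (intGL (param g p a) * g) =
      rhoC (intGL (CFGeodesic.cfMat a.2.1 (xiC g) * CFGeodesic.cfMat p (xiC g) ^ a.2.2) * g) := by
  obtain ⟨s, k, m⟩ := a
  cases s
  · simp only [param, cond_false, intGL_neg, neg_mul, one_mul]
    exact neg_cols _
  · simp [param]

lemma neg_ne_self (γ : GL (Fin 2) ℤ) : γ ≠ -γ := by
  intro h
  have e : ∀ i j, γ i j = 0 := by
    intro i j
    have h1 : γ i j = (-γ : GL (Fin 2) ℤ) i j := by rw [← h]
    simp only [Units.val_neg, Matrix.neg_apply] at h1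
    omega
  rcases det_int_cases γ with hd | hd <;> simp [e] at hd

lemma rho_pos (h : ClosedRed g p u v ℓ) (k : ℕ) :
    0 < |rhoC (intGL (CFGeodesic.cfMat k (xiC g)) * g)| :=
  abs_pos.2 (div_ne_zero (h.toRed.cfMat k h.mem).1.c_ne (h.toRed.cfMat k h.mem).1.b_ne)

lemma param_injective (h : ClosedRed g p u v ℓ) : Function.Injective (param g p) := by
  rintro ⟨s, k, m⟩ ⟨s', k', m'⟩ heq
  have e := coords_param_sign g p (s, k, m)
  rw [heq, (coords_param_sign g p (s', k', m')).1, (coords_param_sign g p (s', k', m')).2.2] at e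
  obtain ⟨e1, -, e3⟩ := e
  have e3' := congrArg abs e3
  simp only at e1 e3'
  rw [(h.coords_param _ _).1, (h.coords_param _ _).1] at e1
  rw [(h.coords_param _ _).2.2, (h.coords_param _ _).2.2] at e3'
  have hk : k = k' := (Fin.ext (h.inj (by simp) (by simp) e1)).symm
  subst hk
  have e4 := mul_left_cancel₀ (h.rho_pos k).ne' e3'
  have hm : m = m' := by
    have h1 := Real.exp_injective e4
    have h2 : (m' : ℝ) = m := mul_right_cancel₀ h.length_pos.ne' (neg_injective h1)
    exact_mod_cast h2.symm
  subst hm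
  have hs : s = s' := by
    cases s <;> cases s' <;> try rfl
    · simp only [param, cond_true, cond_false, neg_one_mul, one_mul] at heq
      exact absurd heq.symm (neg_ne_self _)
    · simp only [param, cond_true, cond_false, neg_one_mul, one_mul] at heq
      exact absurd heq (neg_ne_self _)
  rw [hs]

/-- Every reduced translate of a closed reduced geodesic comes from its continued fraction. -/
lemma exists_param (h : ClosedRed g p u v ℓ) {γ : GL (Fin 2) ℤ} (hγ : Red (intGL γ * g)) :
    γ ∈ Set.range (param g p) := by
  set y := xiC g with hy
  set B := CFGeodesic.cfMat p y with hB
  have hρ : 0 < |rhoC g| := abs_pos.2 (div_ne_zero h.c_ne h.b_ne)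
  -- flow far forward
  have hcoord : ∀ m : ℤ, Red (intGL (γ * B ^ m) * g) ∧
      zetaC (intGL (γ * B ^ m) * g) = zetaC (intGL γ * g) ∧
      |rhoC (intGL (γ * B ^ m) * g)| = |rhoC (intGL γ * g)| * Real.exp (-(m * ℓ)) := by
    intro m
    have e : intGL (γ * B ^ m) * g = intGL γ * g * diagGL (u ^ m, v ^ m) := by
      rw [map_mul, mul_assoc, h.cfMat_zpow, ← mul_assoc]
    obtain ⟨a, b, c⟩ := coords_mul_diagGL (intGL γ * g) (u ^ m, v ^ m)
    rw [e]
    refine ⟨⟨?_, ?_, ?_, ?_⟩, b, ?_⟩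
    · rw [(mul_diagGL_apply _ _ 0).2]; exact mul_ne_zero hγ.b_ne (Units.ne_zero _)
    · rw [(mul_diagGL_apply _ _ 1).1]; exact mul_ne_zero hγ.c_ne (Units.ne_zero _)
    · rw [a]; exact hγ.xi
    · rw [b]; exact hγ.zeta
    · rw [c, abs_mul, h.abs_ratio_zpow]
  obtain ⟨M, hM⟩ : ∃ M : ℕ, |rhoC (intGL γ * g)| * Real.exp (-(M * ℓ)) <
      |rhoC g| * (y * zetaC (intGL γ * g)) := by
    have hlim : Filter.Tendsto (fun M : ℕ => |rhoC (intGL γ * g)| * Real.exp (-(M * ℓ)))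
        Filter.atTop (nhds (|rhoC (intGL γ * g)| * 0)) := by
      refine Filter.Tendsto.const_mul _ (Real.tendsto_exp_neg_atTop_nhds_zero.comp ?_)
      exact tendsto_natCast_atTop_atTop.atTop_mul_const h.length_pos
    rw [mul_zero] at hlim
    exact (hlim.eventually_lt_const (mul_pos hρ (mul_pos h.xi.1 hγ.zeta.1))).exists
  obtain ⟨hred, hz, hr⟩ := hcoord M
  set γ' := γ * B ^ (M : ℤ) with hγ'
  have hlt : |rhoC (intGL γ' * g)| < |rhoC g| * (xiC g * zetaC (intGL γ' * g)) := by
    rw [hr, hz]; exact_mod_cast hM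
  -- the continued fraction algorithm reaches `±γ B ^ M`
  obtain ⟨s, N, hN, hNγ⟩ : ∃ (s : Bool) (N : GL (Fin 2) ℤ), (∀ i j, 0 ≤ N i j) ∧
      N⁻¹ = cond s 1 (-1) * γ' := by
    rcases inv_sign_of_rho_lt h.toRed hred hlt with h1 | h1
    · exact ⟨true, γ'⁻¹, h1, by simp⟩
    · exact ⟨false, -γ'⁻¹, h1, by rw [inv_neg, inv_inv]; simp⟩
  have hredN : Red (intGL N⁻¹ * g) := by
    rw [hNγ]
    cases s
    · rw [cond_false, neg_one_mul, intGL_neg, neg_mul]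
      obtain ⟨a, b, -⟩ := neg_cols (intGL γ' * g)
      refine ⟨?_, ?_, ?_, ?_⟩
      · have := hred.b_ne; simpa using this
      · have := hred.c_ne; simpa using this
      · rw [a]; exact hred.xi
      · rw [b]; exact hred.zeta
    · simpa using hred
  obtain ⟨K, hK⟩ := exists_cfMat_of_nonneg (N 0 0 + N 0 1 + N 1 0 + N 1 1).toNat hN
    (Int.self_le_toNat _) h.toRed hredN h.mem (by
      rw [← mul_assoc, ← map_mul, mul_inv_cancel, map_one, one_mul])
  have hKd : CFGeodesic.cfMat K y = CFGeodesic.cfMat (K % p) y * B ^ (K / p) := by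
    conv_lhs => rw [← Nat.mod_add_div K p]
    have hit : gaussMap^[p * (K / p)] y = y := by
      rw [Function.iterate_mul]
      exact Function.iterate_fixed h.period _
    rw [cfMat_add, hit, cfMat_mul_period h.period]
  refine ⟨(s, ⟨K % p, Nat.mod_lt _ h.pos⟩, (K / p : ℕ) - (M : ℤ)), ?_⟩
  have e1 : γ = cond s 1 (-1) * (CFGeodesic.cfMat (K % p) y * B ^ (K / p)) * B ^ (-(M : ℤ)) := by
    rw [← hKd, ← hK, hNγ, hγ', zpow_neg]
    cases s <;> simp
  rw [e1, param, mul_assoc, mul_assoc (CFGeodesic.cfMat (K % p) y), ← zpow_natCast B (K / p),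
    ← zpow_add, sub_eq_add_neg]

end ClosedRed

/-! ### The length of a closed geodesic -/

lemma flow_proj (g : GL (Fin 2) ℝ) (t : ℝ) : flow (proj g) t = proj (g * diagExp t) := rfl

lemma mul_scalar_apply (g : GL (Fin 2) ℝ) (c : ℝˣ) (i j : Fin 2) :
    (g * Matrix.GeneralLinearGroup.scalar (Fin 2) c) i j = g i j * c := by
  rw [mul_apply_two]
  fin_cases j <;> simp [Matrix.GeneralLinearGroup.scalar]

namespace ClosedRed

variable {g : GL (Fin 2) ℝ} {p : ℕ} {u v : ℝˣ} {ℓ : ℝ}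

lemma flow_eq_of_even (h : ClosedRed g p u v ℓ) {j : ℕ} (hj : Even (p * j)) :
    flow (proj g) (j * ℓ) = proj g := by
  rw [flow_proj, eq_comm, proj_eq_iff]
  refine ⟨CFGeodesic.cfMat p (xiC g) ^ (-(j : ℤ)), v ^ (j : ℤ), ?_⟩
  have huv : (u ^ j * v ^ j : ℝ) = 1 := by
    rw [← mul_pow, h.mul_eq, ← pow_mul, hj.neg_one_pow]
  have hratio : (v ^ j : ℝ) = u ^ j * Real.exp (j * ℓ) := by
    have h1 : |(u / v : ℝ)| ^ j = Real.exp (-(j * ℓ)) := by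
      rw [h.abs_ratio, ← Real.exp_nat_mul]; congr 1; ring
    have h2 : (u / v : ℝ) ^ j = Real.exp (-(j * ℓ)) := by
      rw [← h1, ← abs_pow, abs_of_pos]
      have hv : 0 < (v ^ j * v ^ j : ℝ) := mul_self_pos.2 (pow_ne_zero _ v.ne_zero)
      have : (u / v : ℝ) ^ j * (v ^ j * v ^ j) = 1 := by
        rw [div_pow, ← huv]
        have := v.ne_zero
        field_simp
      by_contra hc
      have := mul_nonneg (neg_nonneg.2 (not_lt.1 hc)) hv.le
      linarith
    rw [div_pow, div_eq_iff (pow_ne_zero _ v.ne_zero)] at h2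
    rw [h2, mul_right_comm, ← Real.exp_add]
    simp
  have e0 : (((u ^ (-(j : ℤ)) : ℝˣ) : ℝ)) * ((v ^ (j : ℤ) : ℝˣ) : ℝ) = Real.exp (j * ℓ) := by
    simp only [zpow_neg, zpow_natCast, Units.val_inv_eq_inv_val, Units.val_pow_eq_pow_val]
    rw [hratio]
    have := u.ne_zero
    field_simp
  have e1 : (((v ^ (-(j : ℤ)) : ℝˣ) : ℝ)) * ((v ^ (j : ℤ) : ℝˣ) : ℝ) = 1 := by
    rw [← Units.val_mul, ← zpow_add]; simp
  rw [h.cfMat_zpow]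
  ext i k
  rw [mul_scalar_apply]
  fin_cases k
  · refine (mul_diagExp_apply g _ i).1.trans ?_
    refine Eq.trans ?_ (congrArg (· * _) (mul_diagGL_apply g _ i).1.symm)
    simp only
    rw [mul_assoc, e0]
  · refine (mul_diagExp_apply g _ i).2.trans ?_
    refine Eq.trans ?_ (congrArg (· * _) (mul_diagGL_apply g _ i).2.symm)
    simp only
    rw [mul_assoc, e1]

/-- The return times of a closed geodesic are multiples of `ℓ`, and even ones if `p` is odd. -/
lemma exists_of_flow_eq (h : ClosedRed g p u v ℓ) {t : ℝ} (ht : flow (proj g) t = proj g) :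
    ∃ m : ℤ, t = m * ℓ ∧ (Odd p → Even m) := by
  rw [flow_proj, eq_comm, proj_eq_iff] at ht
  obtain ⟨γ, c, hγ⟩ := ht
  have e0 : ∀ i, (intGL γ * g) i 0 * c = g i 0 * Real.exp t := fun i => by
    rw [← mul_scalar_apply, ← hγ, (mul_diagExp_apply g t i).1]
  have e1 : ∀ i, (intGL γ * g) i 1 * c = g i 1 := fun i => by
    rw [← mul_scalar_apply, ← hγ, (mul_diagExp_apply g t i).2, mul_one]
  have hc := c.ne_zero
  have e0' : ∀ i, (intGL γ * g) i 0 = g i 0 * (Real.exp t / c) := fun i => by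
    rw [← mul_div_assoc, ← e0]; field_simp
  have e1' : ∀ i, (intGL γ * g) i 1 = g i 1 * (1 / c) := fun i => by
    rw [mul_one_div, eq_div_iff hc, e1]
  obtain ⟨hx, hz, hr⟩ := coords_of_cols (div_ne_zero (Real.exp_ne_zero t) hc)
    (one_div_ne_zero hc) e0' e1'
  have hred : Red (intGL γ * g) := by
    refine ⟨?_, ?_, hx ▸ h.xi, hz ▸ h.zeta⟩
    · rw [e1']; exact mul_ne_zero h.b_ne (one_div_ne_zero hc)
    · rw [e0']; exact mul_ne_zero h.c_ne (div_ne_zero (Real.exp_ne_zero t) hc)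
  obtain ⟨⟨s, k, m⟩, rfl⟩ := h.exists_param hred
  obtain ⟨a1, -, a3⟩ := coords_param_sign g p (s, k, m)
  simp only at a1 a3
  have hk : k = ⟨0, h.pos⟩ := by
    rw [hx, (h.coords_param _ _).1] at a1
    exact Fin.ext (h.inj (by simp) (by simpa using h.pos) a1.symm)
  subst hk
  have a3' := congrArg abs a3
  have hρ : 0 < |rhoC g| := abs_pos.2 (div_ne_zero h.c_ne h.b_ne)
  rw [hr, (h.coords_param _ _).2.2] at a3'
  simp only [CFGeodesic.cfMat, map_one, one_mul] at a3'
  rw [div_div_div_cancel_right₀ hc, div_one, abs_mul, Real.abs_exp] at a3'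
  have a4 := Real.exp_injective (mul_left_cancel₀ hρ.ne' a3')
  refine ⟨-m, by push_cast; linarith, fun hp => ?_⟩
  have hγ' : ∃ σ : ℝ, σ * σ = 1 ∧ ∀ i j, (intGL (param g p (s, ⟨0, h.pos⟩, m)) * g) i j =
      σ * (g * diagGL (u ^ m, v ^ m)) i j := by
    rw [← h.cfMat_zpow]
    cases s
    · refine ⟨-1, by norm_num, fun i j => ?_⟩
      simp [param, CFGeodesic.cfMat, intGL_neg]
    · refine ⟨1, by norm_num, fun i j => ?_⟩
      simp [param, CFGeodesic.cfMat]
  obtain ⟨σ, hσ, hγ'⟩ := hγ'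
  have b0 := (hγ' 1 0).symm.trans (e0' 1)
  have b1 := (hγ' 0 1).symm.trans (e1' 0)
  rw [(mul_diagGL_apply _ _ _).1] at b0
  rw [(mul_diagGL_apply _ _ _).2] at b1
  simp only at b0 b1
  have c0 : σ * ((u ^ m : ℝˣ) : ℝ) = Real.exp t / c :=
    mul_left_cancel₀ h.c_ne (by linear_combination b0)
  have c1 : σ * ((v ^ m : ℝˣ) : ℝ) = 1 / c :=
    mul_left_cancel₀ h.b_ne (by linear_combination b1)
  have c2 : ((u ^ m : ℝˣ) : ℝ) * ((v ^ m : ℝˣ) : ℝ) = Real.exp t / c ^ 2 := by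
    have : ((u ^ m : ℝˣ) : ℝ) * ((v ^ m : ℝˣ) : ℝ) =
      (σ * ((u ^ m : ℝˣ) : ℝ)) * (σ * ((v ^ m : ℝˣ) : ℝ)) := by
      linear_combination -(((u ^ m : ℝˣ) : ℝ) * ((v ^ m : ℝˣ) : ℝ)) * hσ
    rw [this, c0, c1]; field_simp
  have c3 : 0 < ((u ^ m : ℝˣ) : ℝ) * ((v ^ m : ℝˣ) : ℝ) := by
    rw [c2]
    have := Real.exp_pos t
    positivity
  rw [Units.val_zpow_eq_zpow_val, Units.val_zpow_eq_zpow_val, ← mul_zpow, h.mul_eq,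
    hp.neg_one_pow] at c3
  by_contra hodd
  rw [even_neg, Int.not_even_iff_odd] at hodd
  rw [hodd.neg_one_zpow] at c3
  linarith

lemma orbitLength_eq (h : ClosedRed g p u v ℓ) :
    orbitLength (proj g) = (if Even p then 1 else 2 : ℕ) * ℓ := by
  refine IsLeast.csInf_eq ⟨⟨?_, ?_⟩, ?_⟩
  · have := h.length_pos
    split_ifs <;> simp <;> linarith
  · refine h.flow_eq_of_even ?_
    split_ifs with hp
    · simpa using hp
    · exact even_two.mul_left p
  · rintro t ⟨ht, hft⟩
    obtain ⟨m, rfl, hm⟩ := h.exists_of_flow_eq hft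
    have hm0 : (0 : ℝ) < m := pos_of_mul_pos_left ht h.length_pos.le
    have hm1 : 0 < m := by exact_mod_cast hm0
    refine mul_le_mul_of_nonneg_right ?_ h.length_pos.le
    split_ifs with hp
    · exact_mod_cast hm1
    · obtain ⟨r, rfl⟩ := hm (Nat.not_even_iff_odd.1 hp)
      exact_mod_cast (by omega : (2 : ℤ) ≤ r + r)

/-! ### Unfolding along a closed geodesic -/

lemma poincare_add_length (h : ClosedRed g p u v ℓ) (ψ : ℝ × ℝ → ℝ) (t : ℝ) :
    poincare ψ (g * diagExp (t + ℓ)) = poincare ψ (g * diagExp t) := by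
  rw [← poincare_int_mul ψ (CFGeodesic.cfMat p (xiC g))]
  refine tsum_congr fun γ => congrArg ENNReal.ofReal ?_
  have huv : |(v : ℝ)| = |(u : ℝ) * Real.exp ℓ| := by
    have := h.abs_ratio
    rw [abs_div, div_eq_iff (abs_pos.2 v.ne_zero).ne'] at this
    rw [abs_mul, this, Real.abs_exp, mul_right_comm, ← Real.exp_add]
    simp
  have e : intGL γ * (intGL (CFGeodesic.cfMat p (xiC g)) * (g * diagExp (t + ℓ))) =
      intGL γ * g * diagGL (u, v) * diagExp (t + ℓ) := by
    rw [← mul_assoc (intGL (CFGeodesic.cfMat p (xiC g))), h.semiconj]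
    simp only [mul_assoc]
  rw [e, ← mul_assoc]
  refine phi_of_cols ψ (mul_ne_zero u.ne_zero (Real.exp_ne_zero ℓ)) huv (fun i => ?_) (fun i => ?_)
  · rw [(mul_diagExp_apply _ _ i).1, (mul_diagGL_apply _ _ i).1, (mul_diagExp_apply _ _ i).1,
      Real.exp_add]
    ring
  · rw [(mul_diagExp_apply _ _ i).2, (mul_diagGL_apply _ _ i).2, (mul_diagExp_apply _ _ i).2]
    ring

end ClosedRed

lemma lintegral_eq_tsum_Ico {ℓ : ℝ} (hℓ : 0 < ℓ) {F : ℝ → ℝ≥0∞} :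
    ∫⁻ t, F t = ∑' m : ℤ, ∫⁻ t in Set.Ico 0 ℓ, F (t - m * ℓ) := by
  rw [← setLIntegral_univ, ← iUnion_Ico_add_zsmul hℓ (0 : ℝ),
    lintegral_iUnion (fun _ => measurableSet_Ico) (by
      have := Set.pairwise_disjoint_Ico_add_zsmul (0 : ℝ) ℓ
      exact this)]
  rw [← (Equiv.neg ℤ).tsum_eq]
  refine tsum_congr fun m => ?_
  have hmp := measurePreserving_sub_right (volume : Measure ℝ) (m * ℓ)
  rw [← hmp.setLIntegral_comp_preimage_emb (measurableEmbedding_subRight _) F]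
  congr 2
  ext t
  simp only [Equiv.neg_apply, Set.mem_Ico, Set.mem_preimage, zsmul_eq_mul]
  push_cast
  constructor <;> rintro ⟨a, b⟩ <;> constructor <;> linarith

lemma lintegral_hat {r : ℝ} (hr : 0 < r) :
    ∫⁻ t : ℝ, ENNReal.ofReal (hat (r * Real.exp t)) = hatMass := by
  rw [hatMass, ← lintegral_add_right_eq_self (fun t => ENNReal.ofReal (hat (Real.exp t)))
    (Real.log r)]
  refine lintegral_congr fun t => ?_
  rw [Real.exp_add, Real.exp_log hr, mul_comm]

namespace ClosedRed

variable {g : GL (Fin 2) ℝ} {p : ℕ} {u v : ℝˣ} {ℓ : ℝ}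

/-- The translates by the powers of the return matrix tile the time axis by intervals of length `ℓ`,
so that each point of the period contributes the full mass of the bump, once for each sign. -/
lemma lintegral_param (h : ClosedRed g p u v ℓ) {ψ : ℝ × ℝ → ℝ} (hψ : ∀ q, 0 ≤ ψ q) :
    ∫⁻ t in Set.Ico 0 ℓ, ∑' a, ENNReal.ofReal (phi ψ (intGL (param g p a) * (g * diagExp t))) =
      2 * hatMass * ∑ k ∈ Finset.range p, ENNReal.ofReal (ψ (gaussMap^[k] (xiC g),
        zetaC (intGL (CFGeodesic.cfMat k (xiC g)) * g))) := by
  set r : ℕ → ℝ := fun k => |rhoC (intGL (CFGeodesic.cfMat k (xiC g)) * g)| with hr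
  set w : ℕ → ℝ := fun k => ψ (gaussMap^[k] (xiC g),
        zetaC (intGL (CFGeodesic.cfMat k (xiC g)) * g)) with hw
  have hterm : ∀ (t : ℝ) (a : Bool × Fin p × ℤ),
      ENNReal.ofReal (phi ψ (intGL (param g p a) * (g * diagExp t))) =
        ENNReal.ofReal (w a.2.1) * ENNReal.ofReal (hat (r a.2.1 * Real.exp (t - a.2.2 * ℓ))) := by
    intro t a
    obtain ⟨e1, e2, e3⟩ := coords_param_sign g p a
    obtain ⟨f1, f2, f3⟩ := h.coords_param a.2.1 a.2.2
    rw [← mul_assoc, phi_mul_diagExp, e1, e2, e3, f1, f2, f3, ENNReal.ofReal_mul (hψ _), mul_assoc,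
      ← Real.exp_add, neg_add_eq_sub]
  have hmeas : ∀ a : Bool × Fin p × ℤ, Measurable fun t : ℝ => ENNReal.ofReal (w a.2.1) *
      ENNReal.ofReal (hat (r a.2.1 * Real.exp (t - a.2.2 * ℓ))) := by
    intro a
    have : Continuous fun t : ℝ => hat (r a.2.1 * Real.exp (t - a.2.2 * ℓ)) :=
      continuous_hat.comp (by fun_prop)
    exact this.measurable.ennreal_ofReal.const_mul _
  simp_rw [hterm]
  rw [lintegral_tsum fun a => (hmeas a).aemeasurable]
  have hint : ∀ a : Bool × Fin p × ℤ, ∫⁻ t in Set.Ico 0 ℓ, ENNReal.ofReal (w a.2.1) *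
      ENNReal.ofReal (hat (r a.2.1 * Real.exp (t - a.2.2 * ℓ))) =
      ENNReal.ofReal (w a.2.1) * ∫⁻ t in Set.Ico 0 ℓ,
      ENNReal.ofReal (hat (r a.2.1 * Real.exp (t - a.2.2 * ℓ))) := fun a =>
    lintegral_const_mul' _ _ ENNReal.ofReal_ne_top
  simp_rw [hint]
  rw [ENNReal.tsum_prod', tsum_fintype, Fintype.sum_bool, ← two_mul, mul_assoc]
  congr 1
  rw [ENNReal.tsum_prod', tsum_fintype, Finset.mul_sum, ← Fin.sum_univ_eq_sum_range
    (fun k => hatMass * ENNReal.ofReal (w k))]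
  refine Finset.sum_congr rfl fun k _ => ?_
  simp only
  rw [ENNReal.tsum_mul_left, ← lintegral_eq_tsum_Ico h.length_pos
    (F := fun t => ENNReal.ofReal (hat (r k * Real.exp t))), lintegral_hat (h.rho_pos k), mul_comm]

lemma lintegral_poincare_ge (h : ClosedRed g p u v ℓ) {ψ : ℝ × ℝ → ℝ} (hψ : ∀ q, 0 ≤ ψ q) :
    2 * hatMass * ∑ k ∈ Finset.range p, ENNReal.ofReal (ψ (gaussMap^[k] (xiC g),
        zetaC (intGL (CFGeodesic.cfMat k (xiC g)) * g))) ≤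
      ∫⁻ t in Set.Ico 0 ℓ, poincare ψ (g * diagExp t) := by
  rw [← h.lintegral_param hψ]
  exact lintegral_mono fun t => ENNReal.tsum_comp_le_tsum_of_injective h.param_injective
    (fun γ => ENNReal.ofReal (phi ψ (intGL γ * (g * diagExp t))))

lemma lintegral_poincare_eq (h : ClosedRed g p u v ℓ) {ψ : ℝ × ℝ → ℝ} (hψ : ∀ q, 0 ≤ ψ q)
    (hsupp : ∀ q, ψ q ≠ 0 → q.1 ∈ Set.Ioo (0 : ℝ) 1 ∧ q.2 ∈ Set.Ioo (0 : ℝ) 1) :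
    ∫⁻ t in Set.Ico 0 ℓ, poincare ψ (g * diagExp t) =
    2 * hatMass * ∑ k ∈ Finset.range p, ENNReal.ofReal (ψ (gaussMap^[k] (xiC g),
        zetaC (intGL (CFGeodesic.cfMat k (xiC g)) * g))) := by
  rw [← h.lintegral_param hψ]
  refine lintegral_congr fun t => ?_
  refine (Function.Injective.tsum_eq h.param_injective fun γ hγ => h.exists_param ?_).symm
  have h1 : phi ψ (intGL γ * g * diagExp t) ≠ 0 := by
    intro h0
    rw [Function.mem_support, ← mul_assoc, h0] at hγ
    simp at hγ
  rw [phi_mul_diagExp] at h1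
  obtain ⟨hx, hz⟩ := hsupp _ (left_ne_zero_of_mul h1)
  simp only at hx hz
  refine ⟨fun h0 => ?_, fun h0 => ?_, hx, hz⟩
  · rw [zetaC, h0, div_zero] at hz; exact lt_irrefl _ hz.1
  · rw [xiC, h0, div_zero] at hx; exact lt_irrefl _ hx.1

/-- The integral over the closed orbit reduces to one return of the continued fraction, also when
the orbit closes up only after two returns. -/
lemma lintegral_orbitMeasure (h : ClosedRed g p u v ℓ) {L : ℝ} {ψ : ℝ × ℝ → ℝ} (hψ : IsTest L ψ) :
    ∫⁻ x, poincareX ψ x ∂(orbitMeasure (proj g)) =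
      (ENNReal.ofReal ℓ)⁻¹ * ∫⁻ t in Set.Ico 0 ℓ, poincare ψ (g * diagExp t) := by
  have hflow : Continuous (flow (proj g)) := by
    change Continuous fun t => proj (g * diagExp t)
    refine continuous_proj.comp (continuous_GL_of_entries fun i j => ?_)
    fin_cases j
    · simp only [(mul_diagExp_apply g _ i).1, Fin.zero_eta]; fun_prop
    · simp only [(mul_diagExp_apply g _ i).2, Fin.mk_one]; fun_prop
  rw [orbitMeasure, lintegral_map (measurable_poincareX hψ) hflow.measurable,
    ProbabilityTheory.cond, lintegral_smul_measure, h.orbitLength_eq]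
  simp only [flow_proj, poincareX_proj, smul_eq_mul, Real.volume_Ico, sub_zero]
  split_ifs with hp
  · simp
  · have h2 : ∫⁻ t in Set.Ico 0 (((2 : ℕ) : ℝ) * ℓ), poincare ψ (g * diagExp t) =
        2 * ∫⁻ t in Set.Ico 0 ℓ, poincare ψ (g * diagExp t) := by
      have hun : Set.Ico 0 (((2 : ℕ) : ℝ) * ℓ) = Set.Ico 0 ℓ ∪ Set.Ico ℓ (((2 : ℕ) : ℝ) * ℓ) := by
        rw [Set.Ico_union_Ico_eq_Ico h.length_pos.le]
        push_cast
        linarith [h.length_pos]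
      rw [hun, lintegral_union measurableSet_Ico (Set.Ico_disjoint_Ico_same), two_mul]
      congr 1
      have hmp := measurePreserving_sub_right (volume : Measure ℝ) ℓ
      have := hmp.setLIntegral_comp_preimage_emb (measurableEmbedding_subRight _)
        (fun t => poincare ψ (g * diagExp t)) (Set.Ico 0 ℓ)
      rw [← this]
      have hpre : (fun t => t - ℓ) ⁻¹' Set.Ico 0 ℓ = Set.Ico ℓ (((2 : ℕ) : ℝ) * ℓ) := by
        ext t
        simp only [Set.mem_Ico, Set.mem_preimage]
        push_cast
        constructor <;> rintro ⟨a, b⟩ <;> constructor <;> linarith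
      rw [hpre]
      refine lintegral_congr fun t => ?_
      have := h.poincare_add_length ψ (t - ℓ)
      rwa [sub_add_cancel] at this
    rw [h2, ENNReal.ofReal_mul (by norm_num), ENNReal.mul_inv (by simp) (by simp), ← mul_assoc]
    congr 1
    rw [mul_right_comm]
    simp [ENNReal.inv_mul_cancel]

end ClosedRed

/-! ### Weights on the cross-section -/

lemma hatMass_ne_top : hatMass ≠ ⊤ := by
  have hle : ∀ t : ℝ, ENNReal.ofReal (hat (Real.exp t)) ≤
      (Set.Icc (-1 : ℝ) 1).indicator 1 t := by
    intro t
    by_cases h : hat (Real.exp t) = 0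
    · simp [h]
    · obtain ⟨h1, h2⟩ := hat_ne_zero h
      have ht : t ∈ Set.Icc (-1 : ℝ) 1 := by
        constructor
        · by_contra! hc
          have h3 := Real.exp_lt_exp.2 hc
          have h4 := Real.exp_neg_one_lt_half
          linarith
        · linarith [Real.add_one_le_exp t]
      rw [Set.indicator_of_mem ht, Pi.one_apply]
      exact ENNReal.ofReal_le_one.2 (hat_le _)
  refine ne_top_of_le_ne_top ?_ (lintegral_mono hle)
  rw [lintegral_indicator_one measurableSet_Icc, Real.volume_Icc]
  exact ENNReal.ofReal_ne_top

lemma hatMass_toReal_pos : 0 < hatMass.toReal := by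
  refine ENNReal.toReal_pos ?_ hatMass_ne_top
  have hle : ∀ t : ℝ, (Set.Icc (0 : ℝ) (Real.log (5 / 4))).indicator
      (fun _ => ENNReal.ofReal (1 / 4)) t ≤ ENNReal.ofReal (hat (Real.exp t)) := by
    intro t
    by_cases ht : t ∈ Set.Icc (0 : ℝ) (Real.log (5 / 4))
    · rw [Set.indicator_of_mem ht]
      refine ENNReal.ofReal_le_ofReal (le_max_of_le_right ?_)
      have h1 := Real.one_le_exp ht.1
      have h2 := Real.exp_le_exp.2 ht.2
      rw [Real.exp_log (by norm_num)] at h2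
      rw [abs_of_nonneg (by linarith)]
      linarith
    · rw [Set.indicator_of_notMem ht]; exact zero_le
  refine (lt_of_lt_of_le ?_ (lintegral_mono hle)).ne'
  rw [lintegral_indicator_const measurableSet_Icc, Real.volume_Icc]
  refine ENNReal.mul_pos (by simp) ?_
  have := Real.log_pos (by norm_num : (1 : ℝ) < 5 / 4)
  simp only [sub_zero, ne_eq, ENNReal.ofReal_eq_zero, not_le]
  exact this

/-- Truncation to `[0, 1]`. -/
def clamp (x : ℝ) : ℝ := max 0 (min 1 x)

lemma clamp_nonneg (x : ℝ) : 0 ≤ clamp x := le_max_left _ _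

lemma clamp_le_one (x : ℝ) : clamp x ≤ 1 := max_le zero_le_one (min_le_left _ _)

lemma clamp_lip (x y : ℝ) : |clamp x - clamp y| ≤ |x - y| := by
  unfold clamp
  refine (abs_max_sub_max_le_max _ _ _ _).trans ?_
  rw [sub_self, abs_zero]
  refine max_le (abs_nonneg _) ((abs_min_sub_min_le_max _ _ _ _).trans ?_)
  rw [sub_self, abs_zero]
  exact max_le (abs_nonneg _) le_rfl

lemma pos_of_clamp_ne_zero {x : ℝ} (h : clamp x ≠ 0) : 0 < x := by
  by_contra! hx
  exact h (max_eq_left ((min_le_right _ _).trans hx))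

lemma clamp_eq_one {x : ℝ} (h : 1 ≤ x) : clamp x = 1 := by
  rw [clamp, min_eq_left h, max_eq_right zero_le_one]

/-- The signed distance to the boundary of `[0, 1]`. -/
def depth (x : ℝ) : ℝ := min x (1 - x)

lemma depth_lip (x y : ℝ) : |depth x - depth y| ≤ |x - y| := by
  refine (abs_min_sub_min_le_max _ _ _ _).trans (max_le le_rfl ?_)
  rw [show 1 - x - (1 - y) = y - x by ring, abs_sub_comm]

/-- A trapezoidal bump: it is `1` where `depth ≥ (1 - c) δ`, and `0` where `depth ≤ - c δ`. -/
def trap (c δ x : ℝ) : ℝ := clamp (c + depth x / δ)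

lemma trap_lip (c : ℝ) {δ : ℝ} (hδ : 0 < δ) (x y : ℝ) :
    |trap c δ x - trap c δ y| ≤ δ⁻¹ * |x - y| := by
  refine (clamp_lip _ _).trans ?_
  rw [add_sub_add_left_eq_sub, ← sub_div, abs_div, abs_of_pos hδ, div_eq_inv_mul]
  exact mul_le_mul_of_nonneg_left (depth_lip x y) (by positivity)

/-- The weight equal to `f` in the first coordinate, cut off near the boundary of `[0, 1]²`. -/
def weight (c δ : ℝ) (f : ℝ → ℝ) (q : ℝ × ℝ) : ℝ := f q.1 * (trap c δ q.1 * trap c δ q.2)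

section weight

variable {c δ : ℝ} {f : ℝ → ℝ}

lemma trap_prod_mem (c δ : ℝ) (q : ℝ × ℝ) :
    0 ≤ trap c δ q.1 * trap c δ q.2 ∧ trap c δ q.1 * trap c δ q.2 ≤ 1 :=
  ⟨mul_nonneg (clamp_nonneg _) (clamp_nonneg _),
    mul_le_one₀ (clamp_le_one _) (clamp_nonneg _) (clamp_le_one _)⟩

lemma abs_mul_sub_mul_le {a b a' b' : ℝ} (ha : |a'| ≤ 1) (hb : |b| ≤ 1) :
    |a * b - a' * b'| ≤ |a - a'| + |b - b'| := by
  rw [show a * b - a' * b' = (a - a') * b + a' * (b - b') by ring]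
  refine (abs_add_le _ _).trans (add_le_add ?_ ?_)
  · rw [abs_mul]; exact mul_le_of_le_one_right (abs_nonneg _) hb
  · rw [abs_mul]; exact mul_le_of_le_one_left (abs_nonneg _) ha

lemma isTest_weight (hc : c ∈ Set.Icc (0 : ℝ) 1) (hδ : 0 < δ) (hδ' : δ ≤ 1 / 4)
    (hf : ∀ x, f x ∈ Set.Icc (0 : ℝ) 1) (hlip : ∀ x y, |f x - f y| ≤ |x - y|) :
    IsTest (2 / δ) (weight c δ f) := by
  have habs : ∀ x, |f x| ≤ 1 := fun x => by rw [abs_of_nonneg (hf x).1]; exact (hf x).2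
  have htr : ∀ x, |trap c δ x| ≤ 1 := fun x => by
    rw [trap, abs_of_nonneg (clamp_nonneg _)]; exact clamp_le_one _
  refine ⟨fun q => mul_nonneg (hf _).1 (trap_prod_mem c δ q).1, fun q =>
    mul_le_one₀ (hf _).2 (trap_prod_mem c δ q).1 (trap_prod_mem c δ q).2, fun q q' => ?_,
    fun q hq => ?_⟩
  · have h1 : |weight c δ f q - weight c δ f q'| ≤ |q.1 - q'.1| +
        (δ⁻¹ * |q.1 - q'.1| + δ⁻¹ * |q.2 - q'.2|) := by
      refine (abs_mul_sub_mul_le (habs _) ?_).trans (add_le_add (hlip _ _) ?_)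
      · rw [abs_of_nonneg (trap_prod_mem c δ q).1]; exact (trap_prod_mem c δ q).2
      · exact (abs_mul_sub_mul_le (htr _) (htr _)).trans
          (add_le_add (trap_lip c hδ _ _) (trap_lip c hδ _ _))
    have h2 : 1 ≤ δ⁻¹ := (one_le_inv₀ hδ).2 (by linarith)
    rw [div_eq_mul_inv]
    nlinarith [mul_le_mul_of_nonneg_right h2 (abs_nonneg (q.1 - q'.1)),
      mul_nonneg (inv_nonneg.2 hδ.le) (abs_nonneg (q.2 - q'.2))]
  · have hd : ∀ x, trap c δ x ≠ 0 → x ∈ Set.Icc (-1 / 4 : ℝ) (5 / 4) := by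
      intro x hx
      have h1 := pos_of_clamp_ne_zero hx
      have h2 : -δ < depth x := by
        have h3 : -1 < depth x / δ := by linarith [hc.2]
        rw [lt_div_iff₀ hδ] at h3; linarith
      have h4 := min_le_left x (1 - x)
      have h5 := min_le_right x (1 - x)
      unfold depth at h2
      constructor <;> linarith
    have h := right_ne_zero_of_mul hq
    exact ⟨hd _ (left_ne_zero_of_mul h), hd _ (right_ne_zero_of_mul h)⟩

lemma weight_supp (hδ : 0 < δ) {q : ℝ × ℝ} (hq : weight 0 δ f q ≠ 0) :
    q.1 ∈ Set.Ioo (0 : ℝ) 1 ∧ q.2 ∈ Set.Ioo (0 : ℝ) 1 := by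
  have hd : ∀ x, trap 0 δ x ≠ 0 → x ∈ Set.Ioo (0 : ℝ) 1 := by
    intro x hx
    have h1 := pos_of_clamp_ne_zero hx
    rw [zero_add] at h1
    have h2 : 0 < depth x := (div_pos_iff_of_pos_right hδ).1 h1
    have := lt_min_iff.1 h2
    exact ⟨this.1, by linarith [this.2]⟩
  have h := right_ne_zero_of_mul hq
  exact ⟨hd _ (left_ne_zero_of_mul h), hd _ (right_ne_zero_of_mul h)⟩

lemma weight_one_eq_one (hδ : 0 < δ) {q : ℝ × ℝ} (hx : q.1 ∈ Set.Ioo (0 : ℝ) 1)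
    (hz : q.2 ∈ Set.Ioo (0 : ℝ) 1) : weight 1 δ (fun _ => 1) q = 1 := by
  have hd : ∀ x ∈ Set.Ioo (0 : ℝ) 1, trap 1 δ x = 1 := by
    intro x hx
    refine clamp_eq_one ?_
    have : 0 ≤ depth x := le_min hx.1.le (by linarith [hx.2])
    have := div_nonneg this hδ.le
    linarith
  rw [weight, hd _ hx, hd _ hz]; norm_num

end weight

/-! ### The mass of the weights on the cross-section -/

lemma lintegral_inv_sq {ξ : ℝ} (hξ : 0 ≤ ξ) :
    ∫⁻ ζ in Set.Icc (0 : ℝ) 1, ENNReal.ofReal (1 / (1 + ξ * ζ) ^ 2) =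
      ENNReal.ofReal (1 / (1 + ξ)) := by
  have hpos : ∀ ζ ∈ Set.Icc (0 : ℝ) 1, 0 < 1 + ξ * ζ := fun ζ hζ => by
    have := mul_nonneg hξ hζ.1; linarith
  have hcont : ContinuousOn (fun ζ : ℝ => 1 / (1 + ξ * ζ) ^ 2) (Set.Icc 0 1) :=
    continuousOn_const.div (by fun_prop) fun ζ hζ => pow_ne_zero _ (hpos ζ hζ).ne'
  have hint : IntegrableOn (fun ζ : ℝ => 1 / (1 + ξ * ζ) ^ 2) (Set.Icc 0 1) :=
    hcont.integrableOn_compact isCompact_Icc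
  rw [← ofReal_integral_eq_lintegral_ofReal hint
    (Filter.Eventually.of_forall fun ζ => by positivity)]
  congr 1
  rw [integral_Icc_eq_integral_Ioc, ← intervalIntegral.integral_of_le zero_le_one,
    intervalIntegral.integral_eq_sub_of_hasDerivAt (f := fun ζ => ζ / (1 + ξ * ζ))]
  · simp
  · intro ζ hζ
    rw [Set.uIcc_of_le zero_le_one] at hζ
    have h1 := (hpos ζ hζ).ne'
    have h2 : HasDerivAt (fun ζ : ℝ => 1 + ξ * ζ) ξ ζ := by
      simpa using ((hasDerivAt_id ζ).const_mul ξ).const_add 1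
    refine ((hasDerivAt_id' ζ).div h2 h1).congr_deriv ?_
    congr 1; ring
  · exact (hcont.mono (by rw [Set.uIcc_of_le zero_le_one])).intervalIntegrable

lemma integral_one_div_one_add : ∫ x in Set.Icc (0 : ℝ) 1, 1 / (1 + x) = Real.log 2 := by
  rw [integral_Icc_eq_integral_Ioc, ← intervalIntegral.integral_of_le zero_le_one,
    intervalIntegral.integral_comp_add_left (fun x => 1 / x) 1, integral_one_div]
  · norm_num
  · rw [Set.uIcc_of_le (by norm_num)]; intro h; linarith [h.1]

lemma lintegral_square {f : ℝ → ℝ} (hf : ∀ x, 0 ≤ f x) (hcont : Continuous f) :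
    ∫⁻ ξ in Set.Icc (0 : ℝ) 1, ∫⁻ ζ in Set.Icc (0 : ℝ) 1, ENNReal.ofReal (f ξ / (1 + ξ * ζ) ^ 2) =
      ENNReal.ofReal (∫ ξ in Set.Icc (0 : ℝ) 1, f ξ / (1 + ξ)) := by
  have hint : IntegrableOn (fun ξ : ℝ => f ξ / (1 + ξ)) (Set.Icc 0 1) := by
    refine ContinuousOn.integrableOn_compact isCompact_Icc ?_
    exact hcont.continuousOn.div (by fun_prop) fun ξ hξ => by linarith [hξ.1]
  rw [ofReal_integral_eq_lintegral_ofReal hint]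
  · refine setLIntegral_congr_fun measurableSet_Icc fun ξ hξ => ?_
    simp only [div_eq_mul_one_div (f ξ)]
    simp_rw [ENNReal.ofReal_mul (hf ξ)]
    rw [lintegral_const_mul' _ _ ENNReal.ofReal_ne_top, lintegral_inv_sq hξ.1]
  · filter_upwards [ae_restrict_mem measurableSet_Icc] with ξ hξ
    exact div_nonneg (hf ξ) (by linarith [hξ.1])

lemma lintegral_add_indicator_le (s : Set ℝ) (hs : MeasurableSet s) (F : ℝ → ℝ → ℝ≥0∞) :
    ∫⁻ ξ in Set.Icc (0 : ℝ) 1, ∫⁻ ζ in Set.Icc (0 : ℝ) 1,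
      (F ξ ζ + (s.indicator 1 ξ + s.indicator 1 ζ)) ≤
    (∫⁻ ξ in Set.Icc (0 : ℝ) 1, ∫⁻ ζ in Set.Icc (0 : ℝ) 1, F ξ ζ) + 2 * volume s := by
  have hm : Measurable (s.indicator (1 : ℝ → ℝ≥0∞)) := measurable_one.indicator hs
  have hle : ∫⁻ ζ in Set.Icc (0 : ℝ) 1, s.indicator (1 : ℝ → ℝ≥0∞) ζ ≤ volume s := by
    refine (setLIntegral_le_lintegral _ _).trans ?_
    rw [lintegral_indicator_one hs]
  have h1 : ∀ ξ, ∫⁻ ζ in Set.Icc (0 : ℝ) 1, (F ξ ζ + (s.indicator 1 ξ + s.indicator 1 ζ)) ≤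
      (∫⁻ ζ in Set.Icc (0 : ℝ) 1, F ξ ζ) + (s.indicator 1 ξ + volume s) := by
    intro ξ
    have hm' : Measurable fun ζ => s.indicator 1 ξ + s.indicator (1 : ℝ → ℝ≥0∞) ζ :=
      measurable_const.add hm
    rw [lintegral_add_right _ hm', lintegral_add_right _ hm, setLIntegral_const]
    gcongr
    simp
  refine (lintegral_mono h1).trans ?_
  have hm' : Measurable fun ξ => s.indicator (1 : ℝ → ℝ≥0∞) ξ + volume s := hm.add measurable_const
  rw [lintegral_add_right _ hm', lintegral_add_right _ measurable_const,
    setLIntegral_const, two_mul]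
  gcongr
  simp

/-- The weight that is cut off inside the square has almost full mass. -/
lemma crossInt_weight_zero_ge {δ : ℝ} {f : ℝ → ℝ} (hδ : 0 < δ)
    (hf : ∀ x, f x ∈ Set.Icc (0 : ℝ) 1) (hcont : Continuous f) :
    ENNReal.ofReal (∫ ξ in Set.Icc (0 : ℝ) 1, f ξ / (1 + ξ)) ≤
      crossInt (weight 0 δ f) + ENNReal.ofReal (4 * δ) := by
  set s : Set ℝ := Set.Icc 0 δ ∪ Set.Icc (1 - δ) 1 with hs
  have hsm : MeasurableSet s := measurableSet_Icc.union measurableSet_Icc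
  have hvol : volume s ≤ ENNReal.ofReal (2 * δ) := by
    refine (measure_union_le _ _).trans ?_
    rw [Real.volume_Icc, Real.volume_Icc, ← ENNReal.ofReal_add (by linarith) (by linarith)]
    exact ENNReal.ofReal_le_ofReal (by linarith)
  have hpt : ∀ ξ ∈ Set.Icc (0 : ℝ) 1, ∀ ζ ∈ Set.Icc (0 : ℝ) 1,
      ENNReal.ofReal (f ξ / (1 + ξ * ζ) ^ 2) ≤
        ENNReal.ofReal (weight 0 δ f (ξ, ζ) / (1 + ξ * ζ) ^ 2) +
          (s.indicator 1 ξ + s.indicator 1 ζ) := by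
    intro ξ hξ ζ hζ
    have hone : ENNReal.ofReal (f ξ / (1 + ξ * ζ) ^ 2) ≤ 1 := by
      refine ENNReal.ofReal_le_one.2 (div_le_one_of_le₀ ?_ (by positivity))
      have := mul_nonneg hξ.1 hζ.1
      exact (hf ξ).2.trans (one_le_pow₀ (by linarith))
    have htrap : ∀ x ∈ Set.Icc (0 : ℝ) 1, x ∉ s → trap 0 δ x = 1 := by
      intro x hx hxs
      refine clamp_eq_one ?_
      rw [zero_add, one_le_div hδ]
      refine le_min ?_ ?_
      · by_contra! hc; exact hxs (Or.inl ⟨hx.1, hc.le⟩)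
      · by_contra! hc; exact hxs (Or.inr ⟨by linarith, hx.2⟩)
    by_cases h1 : ξ ∈ s
    · rw [Set.indicator_of_mem h1]
      exact hone.trans (le_add_left (le_add_right le_rfl))
    · by_cases h2 : ζ ∈ s
      · rw [Set.indicator_of_mem h2]
        exact hone.trans (le_add_left (le_add_left le_rfl))
      · refine le_add_right (le_of_eq ?_)
        rw [weight, htrap ξ hξ h1, htrap ζ hζ h2, mul_one, mul_one]
  rw [← lintegral_square (fun x => (hf x).1) hcont]
  calc _ ≤ ∫⁻ ξ in Set.Icc (0 : ℝ) 1, ∫⁻ ζ in Set.Icc (0 : ℝ) 1,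
        (ENNReal.ofReal (weight 0 δ f (ξ, ζ) / (1 + ξ * ζ) ^ 2) +
          (s.indicator 1 ξ + s.indicator 1 ζ)) :=
        setLIntegral_mono' measurableSet_Icc fun ξ hξ =>
          setLIntegral_mono' measurableSet_Icc fun ζ hζ => hpt ξ hξ ζ hζ
    _ ≤ (∫⁻ ξ in Set.Icc (0 : ℝ) 1, ∫⁻ ζ in Set.Icc (0 : ℝ) 1,
        ENNReal.ofReal (weight 0 δ f (ξ, ζ) / (1 + ξ * ζ) ^ 2)) + 2 * volume s :=
        lintegral_add_indicator_le s hsm _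
    _ ≤ crossInt (weight 0 δ f) + ENNReal.ofReal (4 * δ) := by
        refine add_le_add ?_ ?_
        · exact (setLIntegral_le_lintegral _ _).trans
            (lintegral_mono fun ξ => setLIntegral_le_lintegral _ _)
        · refine (mul_le_mul_right hvol 2).trans (le_of_eq ?_)
          rw [show (2 : ℝ≥0∞) = ENNReal.ofReal 2 by simp, ← ENNReal.ofReal_mul (by norm_num)]
          congr 1; ring

/-- The weight that is cut off outside the square has little more than the mass of the square. -/
lemma crossInt_weight_one_le {δ : ℝ} (hδ : 0 < δ) (hδ' : δ ≤ 1 / 4) :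
    crossInt (weight 1 δ fun _ => 1) ≤ ENNReal.ofReal (Real.log 2 + 18 * δ) := by
  set I : Set ℝ := Set.Icc (-δ) (1 + δ) with hI
  set J : Set ℝ := Set.Icc 0 1 with hJ
  set A : Set ℝ := Set.Icc (-δ) 0 ∪ Set.Icc 1 (1 + δ) with hA
  have hIm : MeasurableSet I := measurableSet_Icc
  have hJm : MeasurableSet J := measurableSet_Icc
  have hAm : MeasurableSet A := measurableSet_Icc.union measurableSet_Icc
  have hIv : volume I ≤ ENNReal.ofReal (3 / 2) := by
    rw [hI, Real.volume_Icc]; exact ENNReal.ofReal_le_ofReal (by linarith)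
  have hAv : volume A ≤ ENNReal.ofReal (2 * δ) := by
    refine (measure_union_le _ _).trans ?_
    rw [Real.volume_Icc, Real.volume_Icc, ← ENNReal.ofReal_add (by linarith) (by linarith)]
    exact ENNReal.ofReal_le_ofReal (by linarith)
  have hpt : ∀ ξ ζ : ℝ, ENNReal.ofReal (weight 1 δ (fun _ => 1) (ξ, ζ) / (1 + ξ * ζ) ^ 2) ≤
      J.indicator 1 ξ * J.indicator (fun ζ => ENNReal.ofReal (1 / (1 + ξ * ζ) ^ 2)) ζ +
        3 * (A.indicator 1 ξ * I.indicator 1 ζ + I.indicator 1 ξ * A.indicator 1 ζ) := by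
    intro ξ ζ
    by_cases h0 : weight 1 δ (fun _ => 1) (ξ, ζ) = 0
    · simp [h0]
    have hI' : ∀ x, trap 1 δ x ≠ 0 → x ∈ I := by
      intro x hx
      have h1 := pos_of_clamp_ne_zero hx
      have h2 : -δ < depth x := by
        have h3 : -1 < depth x / δ := by linarith
        rw [lt_div_iff₀ hδ] at h3; linarith
      have h4 := min_le_left x (1 - x)
      have h5 := min_le_right x (1 - x)
      unfold depth at h2
      constructor <;> linarith
    have h := right_ne_zero_of_mul h0
    have hξ : ξ ∈ I := hI' _ (left_ne_zero_of_mul h)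
    have hζ : ζ ∈ I := hI' _ (right_ne_zero_of_mul h)
    have hw : weight 1 δ (fun _ => 1) (ξ, ζ) ≤ 1 := by
      rw [weight, one_mul]; exact (trap_prod_mem 1 δ (ξ, ζ)).2
    have hle : ENNReal.ofReal (weight 1 δ (fun _ => 1) (ξ, ζ) / (1 + ξ * ζ) ^ 2) ≤
        ENNReal.ofReal (1 / (1 + ξ * ζ) ^ 2) :=
      ENNReal.ofReal_le_ofReal (div_le_div_of_nonneg_right hw (by positivity))
    have hthree : ENNReal.ofReal (1 / (1 + ξ * ζ) ^ 2) ≤ 3 := by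
      have h1 : 11 / 16 ≤ 1 + ξ * ζ := by
        rcases le_total 0 ξ with hx | hx <;> rcases le_total 0 ζ with hz | hz
        · nlinarith [mul_nonneg hx hz]
        · nlinarith [hξ.2, hζ.1]
        · nlinarith [hξ.1, hζ.2]
        · nlinarith [mul_nonneg_of_nonpos_of_nonpos hx hz]
      have h2 : 1 / (1 + ξ * ζ) ^ 2 ≤ 3 := by
        rw [div_le_iff₀ (by positivity)]; nlinarith
      refine (ENNReal.ofReal_le_ofReal h2).trans (by simp)
    have hAI : ∀ x ∈ I, x ∉ J → x ∈ A := by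
      intro x hx hxJ
      rcases le_or_gt 0 x with h1 | h1
      · right; exact ⟨by by_contra! hc; exact hxJ ⟨h1, hc.le⟩, hx.2⟩
      · left; exact ⟨hx.1, h1.le⟩
    refine hle.trans ?_
    by_cases h1 : ξ ∈ J
    · by_cases h2 : ζ ∈ J
      · refine le_add_right ?_
        rw [Set.indicator_of_mem h1, Set.indicator_of_mem h2, Pi.one_apply, one_mul]
      · refine hthree.trans (le_add_left ?_)
        rw [Set.indicator_of_mem (hAI ζ hζ h2), Set.indicator_of_mem hξ, Pi.one_apply, Pi.one_apply,
          one_mul]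
        exact le_mul_of_one_le_right zero_le (le_add_left le_rfl)
    · refine hthree.trans (le_add_left ?_)
      rw [Set.indicator_of_mem (hAI ξ hξ h1), Set.indicator_of_mem hζ, Pi.one_apply, Pi.one_apply,
        one_mul]
      exact le_mul_of_one_le_right zero_le (le_add_right le_rfl)
  have mI : Measurable (I.indicator (1 : ℝ → ℝ≥0∞)) := measurable_one.indicator hIm
  have mA : Measurable (A.indicator (1 : ℝ → ℝ≥0∞)) := measurable_one.indicator hAm
  have hinner : ∀ ξ : ℝ, ∫⁻ ζ, ENNReal.ofReal (weight 1 δ (fun _ => 1) (ξ, ζ) /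
      (1 + ξ * ζ) ^ 2) ≤ J.indicator (fun ξ => ∫⁻ ζ in J, ENNReal.ofReal (1 / (1 + ξ * ζ) ^ 2)) ξ +
        3 * (A.indicator 1 ξ * volume I + I.indicator 1 ξ * volume A) := by
    intro ξ
    refine (lintegral_mono (hpt ξ)).trans (le_of_eq ?_)
    have m1 : Measurable fun ζ => A.indicator 1 ξ * I.indicator (1 : ℝ → ℝ≥0∞) ζ := mI.const_mul _
    have m2 : Measurable fun ζ => I.indicator 1 ξ * A.indicator (1 : ℝ → ℝ≥0∞) ζ := mA.const_mul _
    have m12 : Measurable fun ζ => A.indicator 1 ξ * I.indicator (1 : ℝ → ℝ≥0∞) ζ +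
        I.indicator 1 ξ * A.indicator (1 : ℝ → ℝ≥0∞) ζ := m1.add m2
    rw [lintegral_add_right _ (m12.const_mul _)]
    congr 1
    · by_cases h1 : ξ ∈ J
      · simp only [Set.indicator_of_mem h1, Pi.one_apply, one_mul]
        rw [lintegral_indicator hJm]
      · simp [Set.indicator_of_notMem h1]
    · rw [lintegral_const_mul _ m12, lintegral_add_right _ m2,
        lintegral_const_mul _ mI, lintegral_const_mul _ mA,
        lintegral_indicator_one hIm, lintegral_indicator_one hAm]
  have hone := lintegral_square (f := fun _ => 1) (fun _ => zero_le_one) continuous_const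
  rw [integral_one_div_one_add] at hone
  refine (lintegral_mono hinner).trans ?_
  have n1 : Measurable fun ξ => A.indicator (1 : ℝ → ℝ≥0∞) ξ * volume I := mA.mul_const _
  have n2 : Measurable fun ξ => I.indicator (1 : ℝ → ℝ≥0∞) ξ * volume A := mI.mul_const _
  have n12 : Measurable fun ξ => A.indicator (1 : ℝ → ℝ≥0∞) ξ * volume I +
      I.indicator (1 : ℝ → ℝ≥0∞) ξ * volume A := n1.add n2
  rw [lintegral_add_right _ (n12.const_mul _),
    lintegral_indicator hJm, hone, lintegral_const_mul _ n12, lintegral_add_right _ n2,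
    lintegral_mul_const _ mA, lintegral_mul_const _ mI,
    lintegral_indicator_one hIm, lintegral_indicator_one hAm,
    ENNReal.ofReal_add (Real.log_nonneg (by norm_num)) (by linarith)]
  refine add_le_add le_rfl ?_
  calc 3 * (volume A * volume I + volume I * volume A)
      ≤ 3 * (ENNReal.ofReal (2 * δ) * ENNReal.ofReal (3 / 2) +
        ENNReal.ofReal (3 / 2) * ENNReal.ofReal (2 * δ)) := by gcongr
    _ = ENNReal.ofReal (18 * δ) := by
      rw [← ENNReal.ofReal_mul (by linarith), ← ENNReal.ofReal_mul (by norm_num),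
        ← ENNReal.ofReal_add (by linarith) (by linarith),
        show (3 : ℝ≥0∞) = ENNReal.ofReal 3 by simp, ← ENNReal.ofReal_mul (by norm_num)]
      congr 1; ring

/-! ### Comparison of the periodic orbit with the invariant measure -/

/-- For a suitable constant, approximate equidistribution holds for the Poincaré series of all
weights, with an error proportional to their Lipschitz constants. -/
lemma exists_transfer (Q : InvInnerProduct) : ∃ C : ℝ, 0 < C ∧ ∀ (α : QI) (T : ℝ), 0 < T →
    ApproxHaar Q α T → ∀ {L : ℝ} {ψ : ℝ × ℝ → ℝ}, 1 ≤ L → IsTest L ψ →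
    |(∫⁻ x, poincareX ψ x ∂(muPeriodic α)).toReal - (∫⁻ x, poincareX ψ x ∂haarX).toReal| ≤
      C * L * T⁻¹ := by
  obtain ⟨K, hK, hlip⟩ := exists_lipX Q
  obtain ⟨C, hC, hnorm⟩ := exists_eLpNorm_bound
  refine ⟨K + C, by positivity, fun α T hT happ L ψ hL hψ => ?_⟩
  have hκ : 0 < (K * L).toNNReal := Real.toNNReal_pos.2 (by positivity)
  have h := happ _ _ hκ (hlip hL hψ) (hnorm hψ).1
  have hconv : ∀ μ : Measure XInf, ∫ x, ((poincareX ψ x).toReal : ℂ) ∂μ =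
      ((∫⁻ x, poincareX ψ x ∂μ).toReal : ℂ) := fun μ => by
    rw [integral_complex_ofReal, integral_toReal (measurable_poincareX hψ).aemeasurable
      (Filter.Eventually.of_forall fun x => (poincareX_ne_top hψ x).lt_top)]
  rw [hconv, hconv, ← Complex.ofReal_sub, Complex.norm_real, Real.norm_eq_abs] at h
  refine h.trans (mul_le_mul_of_nonneg_right (max_le ?_ ?_) (by positivity))
  · refine (hnorm hψ).2.trans ?_
    nlinarith
  · rw [Real.coe_toNNReal _ (by positivity)]
    nlinarith

lemma crossInt_ne_top {L : ℝ} {ψ : ℝ × ℝ → ℝ} (hψ : IsTest L ψ) : crossInt ψ ≠ ⊤ := by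
  obtain ⟨N, hN⟩ := exists_poincare_bound
  have hfin : ∫⁻ x, poincareX ψ x ∂haarX ≠ ⊤ := by
    have hle : ∀ x, poincareX ψ x ≤ N := fun x => hN hψ _
    refine ne_top_of_le_ne_top ?_ (lintegral_mono hle)
    rw [lintegral_const]
    exact ENNReal.mul_ne_top (by simp) (measure_ne_top _ _)
  rw [lintegral_poincareX_haarX_eq hψ] at hfin
  intro h
  rw [h] at hfin
  apply hfin
  have h1 : hatMass ≠ 0 := fun h0 => hatMass_toReal_pos.ne' (by simp [h0])
  rw [ENNReal.mul_top h1, ENNReal.mul_top]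
  rw [Ne, ENNReal.ofReal_eq_zero, not_le]
  positivity

lemma toReal_lintegral_haarX {L : ℝ} {ψ : ℝ × ℝ → ℝ} (hψ : IsTest L ψ) :
    (∫⁻ x, poincareX ψ x ∂haarX).toReal =
      12 / Real.pi ^ 2 * (hatMass.toReal * (crossInt ψ).toReal) := by
  rw [lintegral_poincareX_haarX_eq hψ, ENNReal.toReal_mul, ENNReal.toReal_mul,
    ENNReal.toReal_ofReal (by positivity)]

/-- The geodesic of a quadratic irrational, put into reduced form. -/
lemma exists_closedRed_of_QI (α : QI) : ∃ g p u v ℓ, ClosedRed g p u v ℓ ∧ xPoint α = proj g ∧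
    cfPeriod α = (fun k => gaussMap^[k] (xiC g)) '' (Finset.range p) := by
  obtain ⟨δ, p, y, hred, rfl, hmem, hp, hper, hinj, hz, hcf⟩ := exists_reduced α
  obtain ⟨u, v, ℓ, h⟩ := exists_closedRed hred hmem hp hper hinj hz
  refine ⟨_, p, u, v, ℓ, h, ?_, hcf⟩
  change proj (gMat α) = _
  exact proj_eq_iff.2 ⟨δ, 1, by simp⟩

namespace ClosedRed

variable {g : GL (Fin 2) ℝ} {p : ℕ} {u v : ℝˣ} {ℓ : ℝ}

lemma toReal_sum (ψ : ℝ × ℝ → ℝ) (hψ : ∀ q, 0 ≤ ψ q) (F : ℕ → ℝ × ℝ) :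
    ((ENNReal.ofReal ℓ)⁻¹ * (2 * hatMass * ∑ k ∈ Finset.range p, ENNReal.ofReal (ψ (F k)))).toReal =
      (ENNReal.ofReal ℓ).toReal⁻¹ * (2 * hatMass.toReal * ∑ k ∈ Finset.range p, ψ (F k)) := by
  rw [← ENNReal.ofReal_sum_of_nonneg fun _ _ => hψ _, ENNReal.toReal_mul, ENNReal.toReal_inv,
    ENNReal.toReal_mul, ENNReal.toReal_mul,
    ENNReal.toReal_ofReal (Finset.sum_nonneg fun _ _ => hψ _)]
  rfl

lemma zeta_mem (h : ClosedRed g p u v ℓ) (k : ℕ) :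
    zetaC (intGL (CFGeodesic.cfMat k (xiC g)) * g) ∈ Set.Ioo (0 : ℝ) 1 :=
  (h.toRed.cfMat k h.mem).1.zeta

lemma count_le (h : ClosedRed g p u v ℓ) {δ : ℝ} (hδ : 0 < δ) (hδ' : δ ≤ 1 / 4) :
    2 * hatMass.toReal * (p / ℓ) ≤
      (∫⁻ x, poincareX (weight 1 δ fun _ => 1) x ∂(orbitMeasure (proj g))).toReal := by
  have hψ : IsTest (2 / δ) (weight 1 δ fun _ => 1) :=
    isTest_weight (by norm_num) hδ hδ' (fun _ => by norm_num) (fun x y => by simp)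
  have h1 := mul_le_mul_right (h.lintegral_poincare_ge hψ.nonneg) (ENNReal.ofReal ℓ)⁻¹
  rw [← h.lintegral_orbitMeasure hψ] at h1
  have hfin : ∫⁻ x, poincareX (weight 1 δ fun _ => 1) x ∂(orbitMeasure (proj g)) ≠ ⊤ := by
    obtain ⟨N, hN⟩ := exists_poincare_bound
    rw [h.lintegral_orbitMeasure hψ]
    refine ENNReal.mul_ne_top (by simpa using h.length_pos) ?_
    refine ne_top_of_le_ne_top ?_ (lintegral_mono fun t => hN hψ (g * diagExp t))
    rw [lintegral_const]
    exact ENNReal.mul_ne_top (by simp) (by simp)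
  refine le_trans (le_of_eq ?_) (ENNReal.toReal_mono hfin h1)
  rw [toReal_sum _ hψ.nonneg, ENNReal.toReal_ofReal h.length_pos.le,
    Finset.sum_congr rfl fun k _ => weight_one_eq_one hδ (h.mem k) (h.zeta_mem k)]
  simp
  ring

lemma le_sum (h : ClosedRed g p u v ℓ) {δ : ℝ} (hδ : 0 < δ) (hδ' : δ ≤ 1 / 4) {f : ℝ → ℝ}
    (hf : ∀ x, f x ∈ Set.Icc (0 : ℝ) 1) (hlip : ∀ x y, |f x - f y| ≤ |x - y|) :
    (∫⁻ x, poincareX (weight 0 δ f) x ∂(orbitMeasure (proj g))).toReal ≤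
      2 * hatMass.toReal * ((∑ k ∈ Finset.range p, f (gaussMap^[k] (xiC g))) / ℓ) := by
  have hψ : IsTest (2 / δ) (weight 0 δ f) := isTest_weight (by norm_num) hδ hδ' hf hlip
  rw [h.lintegral_orbitMeasure hψ, h.lintegral_poincare_eq hψ.nonneg fun q => weight_supp hδ,
    toReal_sum _ hψ.nonneg, ENNReal.toReal_ofReal h.length_pos.le]
  have hle : ∑ k ∈ Finset.range p, weight 0 δ f (gaussMap^[k] (xiC g),
      zetaC (intGL (CFGeodesic.cfMat k (xiC g)) * g)) ≤
      ∑ k ∈ Finset.range p, f (gaussMap^[k] (xiC g)) :=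
    Finset.sum_le_sum fun k _ => mul_le_of_le_one_right (hf _).1 (trap_prod_mem 0 δ _).2
  have := h.length_pos
  have := hatMass_toReal_pos
  rw [div_eq_inv_mul, mul_left_comm]
  gcongr

end ClosedRed

/-- One-sided bounds for the number of continued fraction steps and for their weighted count, per
unit of length of the geodesic. -/
lemma exists_count_bounds (Q : InvInnerProduct) : ∃ C : ℝ, 0 < C ∧ ∀ (α : QI) (T : ℝ), 16 < T →
    ApproxHaar Q α T → ∀ {g : GL (Fin 2) ℝ} {p : ℕ} {u v : ℝˣ} {ℓ : ℝ}, ClosedRed g p u v ℓ →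
    xPoint α = proj g →
    p / ℓ ≤ 6 / Real.pi ^ 2 * Real.log 2 + C * (√T)⁻¹ ∧
    ∀ f : ℝ → ℝ, (∀ x, f x ∈ Set.Icc (0 : ℝ) 1) → (∀ x y, |f x - f y| ≤ |x - y|) →
      6 / Real.pi ^ 2 * (∫ x in Set.Icc (0 : ℝ) 1, f x / (1 + x)) - C * (√T)⁻¹ ≤
        (∑ k ∈ Finset.range p, f (gaussMap^[k] (xiC g))) / ℓ := by
  obtain ⟨C, hC, htr⟩ := exists_transfer Q
  have hM := hatMass_toReal_pos
  set M := hatMass.toReal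
  have hπ : 0 < 6 / Real.pi ^ 2 := by positivity
  refine ⟨6 / Real.pi ^ 2 * 18 + 2 * C / M, by positivity,
    fun α T hT happ g p u v ℓ h hx => ?_⟩
  set δ := (√T)⁻¹ with hδ
  have hT0 : 0 < T := by linarith
  have hδ0 : 0 < δ := by positivity
  have hδ' : δ ≤ 1 / 4 := by
    rw [hδ, inv_le_comm₀ (by positivity) (by norm_num)]
    refine Real.le_sqrt_of_sq_le ?_
    norm_num
    linarith
  have hL : 1 ≤ 2 / δ := by rw [one_le_div hδ0]; linarith
  have herr : C * (2 / δ) * T⁻¹ = 2 * C * δ := by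
    have : T⁻¹ = δ ^ 2 := by rw [hδ, inv_pow, Real.sq_sqrt hT0.le]
    rw [this]; field_simp
  have hμ : muPeriodic α = orbitMeasure (proj g) := by rw [muPeriodic, hx]
  have e12 : 12 / Real.pi ^ 2 = 2 * (6 / Real.pi ^ 2) := by ring
  set c := 6 / Real.pi ^ 2 with hc
  constructor
  · have hψ : IsTest (2 / δ) (weight 1 δ fun _ => 1) :=
      isTest_weight (by norm_num) hδ0 hδ' (fun _ => by norm_num) (fun x y => by simp)
    have h1 := (abs_le.1 (htr α T hT0 happ hL hψ)).2
    rw [herr, hμ, toReal_lintegral_haarX hψ, e12] at h1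
    have h2 := h.count_le hδ0 hδ'
    have h3 : (crossInt (weight 1 δ fun _ => 1)).toReal ≤ Real.log 2 + 18 * δ :=
      ENNReal.toReal_le_of_le_ofReal
        (by have := Real.log_nonneg (by norm_num : (1 : ℝ) ≤ 2); positivity)
        (crossInt_weight_one_le hδ0 hδ')
    have h4 : 2 * c * (M * (crossInt (weight 1 δ fun _ => 1)).toReal) ≤
        2 * c * (M * (Real.log 2 + 18 * δ)) := by gcongr
    have h5 : M * (p / ℓ) ≤ M * (c * Real.log 2 + (c * 18 + 2 * C / M) * δ) := by
      have : M * (c * Real.log 2 + (c * 18 + 2 * C / M) * δ) =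
          c * (M * (Real.log 2 + 18 * δ)) + 2 * C * δ := by field_simp; ring
      rw [this]
      have : 0 < C * δ := by positivity
      linarith
    exact le_of_mul_le_mul_left h5 hM
  · intro f hf hlip
    have hcont : Continuous f := by
      refine (LipschitzWith.of_dist_le_mul (K := 1) fun x y => ?_).continuous
      simpa [Real.dist_eq] using hlip x y
    have hψ : IsTest (2 / δ) (weight 0 δ f) := isTest_weight (by norm_num) hδ0 hδ' hf hlip
    have h1 := (abs_le.1 (htr α T hT0 happ hL hψ)).1
    rw [herr, hμ, toReal_lintegral_haarX hψ, e12] at h1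
    have h2 := h.le_sum hδ0 hδ' hf hlip
    have h3 := ENNReal.toReal_mono
      (ENNReal.add_ne_top.2 ⟨crossInt_ne_top hψ, ENNReal.ofReal_ne_top⟩)
      (crossInt_weight_zero_ge hδ0 hf hcont)
    have hI : 0 ≤ ∫ x in Set.Icc (0 : ℝ) 1, f x / (1 + x) :=
      setIntegral_nonneg measurableSet_Icc fun x hx =>
        div_nonneg (hf x).1 (by linarith [hx.1])
    rw [ENNReal.toReal_ofReal hI, ENNReal.toReal_add (crossInt_ne_top hψ)
      ENNReal.ofReal_ne_top,
      ENNReal.toReal_ofReal (by positivity)] at h3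
    set I := ∫ x in Set.Icc (0 : ℝ) 1, f x / (1 + x)
    have h4 : 2 * c * (M * (I - 4 * δ)) ≤ 2 * c * (M * (crossInt (weight 0 δ f)).toReal) := by
      gcongr
      linarith
    have h5 : M * (c * I - (c * 18 + 2 * C / M) * δ) ≤
        M * ((∑ k ∈ Finset.range p, f (gaussMap^[k] (xiC g))) / ℓ) := by
      have : M * (c * I - (c * 18 + 2 * C / M) * δ) =
          c * (M * (I - 4 * δ)) - 14 * (c * M * δ) - 2 * C * δ := by field_simp; ring
      rw [this]
      have : 0 < C * δ := by positivity
      have : 0 < c * M * δ := by positivity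
      linarith
    exact le_of_mul_le_mul_left h5 hM

lemma integrableOn_div_one_add {f : ℝ → ℝ} (hf : ContinuousOn f (Set.Icc 0 1)) :
    IntegrableOn (fun x => f x / (1 + x)) (Set.Icc (0 : ℝ) 1) :=
  (hf.div (by fun_prop) fun ξ hξ => by linarith [hξ.1]).integrableOn_compact isCompact_Icc

/-- Two-sided bounds: applied to `f` and to `1 - f`, the lower bound for the weighted count and the
upper bound for the count of all steps give also an upper bound for the weighted count. -/
lemma exists_count_estimates (Q : InvInnerProduct) : ∃ C : ℝ, 0 < C ∧ ∀ (α : QI) (T : ℝ), 16 < T →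
    ApproxHaar Q α T → ∀ {g : GL (Fin 2) ℝ} {p : ℕ} {u v : ℝˣ} {ℓ : ℝ}, ClosedRed g p u v ℓ →
    xPoint α = proj g →
    |p / ℓ - 6 / Real.pi ^ 2 * Real.log 2| ≤ C * (√T)⁻¹ ∧
    ∀ f : ℝ → ℝ, (∀ x, f x ∈ Set.Icc (0 : ℝ) 1) → (∀ x y, |f x - f y| ≤ |x - y|) →
      |(∑ k ∈ Finset.range p, f (gaussMap^[k] (xiC g))) / p -
        (∫ x in Set.Icc (0 : ℝ) 1, f x / (1 + x)) / Real.log 2| ≤ C * (√T)⁻¹ := by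
  obtain ⟨C, hC, hb⟩ := exists_count_bounds Q
  have hlog : 0 < Real.log 2 := Real.log_pos (by norm_num)
  have hπ : 0 < 6 / Real.pi ^ 2 := by positivity
  set c := 6 / Real.pi ^ 2 with hc
  set b := c * Real.log 2 with hbd
  have hb0 : 0 < b := by positivity
  refine ⟨C + 3 * C / b, by positivity, fun α T hT happ g p u v ℓ h hx => ?_⟩
  obtain ⟨hup, hlow⟩ := hb α T hT happ h hx
  set δ := (√T)⁻¹ with hδ
  have hδ0 : 0 ≤ δ := by positivity
  have hℓ := h.length_pos
  have hp : (0 : ℝ) < p := by exact_mod_cast h.pos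
  have hlow1 : b - C * δ ≤ p / ℓ := by
    have := hlow (fun _ => 1) (fun _ => by norm_num) (fun x y => by simp)
    rw [integral_one_div_one_add] at this
    simpa using this
  have hP : |p / ℓ - b| ≤ C * δ := by
    rw [abs_le]; constructor <;> linarith
  have hextra : 0 ≤ 3 * C / b * δ := by positivity
  refine ⟨hP.trans (by nlinarith), fun f hf hlip => ?_⟩
  have hcont : Continuous f := by
    refine (LipschitzWith.of_dist_le_mul (K := 1) fun x y => ?_).continuous
    simpa [Real.dist_eq] using hlip x y
  have hlf := hlow f hf hlip
  have hlf' := hlow (fun x => 1 - f x)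
    (fun x => ⟨by linarith [(hf x).2], by linarith [(hf x).1]⟩)
    (fun x y => by
      rw [show 1 - f x - (1 - f y) = f y - f x by ring, abs_sub_comm]; exact hlip x y)
  have hI : ∫ x in Set.Icc (0 : ℝ) 1, (1 - f x) / (1 + x) =
      Real.log 2 - ∫ x in Set.Icc (0 : ℝ) 1, f x / (1 + x) := by
    simp only [sub_div]
    rw [integral_sub (integrableOn_div_one_add (f := fun _ => 1) continuousOn_const)
      (integrableOn_div_one_add hcont.continuousOn), integral_one_div_one_add]
  rw [hI, Finset.sum_sub_distrib] at hlf'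
  simp only [Finset.sum_const, Finset.card_range, nsmul_eq_mul, mul_one, sub_div] at hlf'
  set S := ∑ k ∈ Finset.range p, f (gaussMap^[k] (xiC g)) with hS
  set I := ∫ x in Set.Icc (0 : ℝ) 1, f x / (1 + x) with hId
  have hS0 : 0 ≤ S := Finset.sum_nonneg fun k _ => (hf _).1
  have hSp : S ≤ p := by
    calc S ≤ ∑ k ∈ Finset.range p, (1 : ℝ) := Finset.sum_le_sum fun k _ => (hf _).2
      _ = p := by simp
  have hA : |S / ℓ - c * I| ≤ 2 * C * δ := by
    rw [abs_le]; constructor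
    · nlinarith
    · nlinarith
  have key : S / p - I / Real.log 2 = (S / p * (b - p / ℓ) + (S / ℓ - c * I)) / b := by
    rw [hbd]; field_simp; ring
  have hratio : |S / p| ≤ 1 := by
    rw [abs_of_nonneg (by positivity)]; exact div_le_one_of_le₀ hSp hp.le
  rw [key, abs_div, abs_of_pos hb0, div_le_iff₀ hb0]
  have h1 : |S / p * (b - p / ℓ)| ≤ C * δ := by
    rw [abs_mul, abs_sub_comm]
    exact (mul_le_of_le_one_left (abs_nonneg _) hratio).trans hP
  have h2 : (C + 3 * C / b) * δ * b = C * δ * b + 3 * C * δ := by field_simp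
  have h3 : 0 ≤ C * δ * b := by positivity
  linarith [abs_add_le (S / p * (b - p / ℓ)) (S / ℓ - c * I)]

/-! ### Integrals over the period and against the Gauss measure -/

lemma integral_nuPeriod {g : GL (Fin 2) ℝ} {p : ℕ} {u v : ℝˣ} {ℓ : ℝ} (h : ClosedRed g p u v ℓ)
    {α : ℝ} (hα : cfPeriod α = (fun k => gaussMap^[k] (xiC g)) '' (Finset.range p)) (f : ℝ → ℂ) :
    ∫ x in Set.Icc 0 1, f x ∂(nuPeriod α) =
      (p : ℂ)⁻¹ * ∑ k ∈ Finset.range p, f (gaussMap^[k] (xiC g)) := by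
  classical
  set F := (Finset.range p).image fun k => gaussMap^[k] (xiC g) with hF
  have hcf : cfPeriod α = F := by rw [hα, hF, Finset.coe_image]
  have hcard : F.card = p := by rw [hF, Finset.card_image_of_injOn h.inj, Finset.card_range]
  have hsub : Set.Icc (0 : ℝ) 1 ∩ F = F := by
    refine Set.inter_eq_right.2 fun x hx => ?_
    rw [hF, Finset.coe_image] at hx
    obtain ⟨k, -, rfl⟩ := hx
    exact ⟨(h.mem k).1.le, (h.mem k).2.le⟩
  have hint : IntegrableOn f F Measure.count := by
    have : IntegrableOn f (⋃ x ∈ F, {x}) Measure.count :=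
      integrableOn_finset_iUnion.2 fun x _ => integrableOn_singleton (by simp)
        (by rw [Measure.count_singleton]; exact ENNReal.one_lt_top)
    convert this
    ext x
    simp
  rw [nuPeriod, uniformOn, ProbabilityTheory.cond, hcf, Measure.restrict_smul,
    Measure.restrict_restrict measurableSet_Icc, hsub, integral_smul_measure,
    Measure.count_apply_finset, hcard, setIntegral_finset _ hint]
  simp only [Measure.real, Measure.count_singleton, ENNReal.toReal_one, one_smul]
  rw [hF, Finset.sum_image h.inj, Complex.real_smul]
  simp

lemma integral_nuGauss (f : ℝ → ℂ) :
    ∫ x in Set.Icc 0 1, f x ∂nuGauss =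
      ∫ x in Set.Icc (0 : ℝ) 1, (1 / (Real.log 2 * (1 + x))) • f x := by
  have hm : Measurable fun x : ℝ => ENNReal.ofReal (1 / (Real.log 2 * (1 + x))) := by fun_prop
  rw [nuGauss, restrict_withDensity measurableSet_Icc, Measure.restrict_restrict measurableSet_Icc,
    Set.inter_self, integral_withDensity_eq_integral_toReal_smul hm
      (Filter.Eventually.of_forall fun _ => ENNReal.ofReal_lt_top)]
  refine setIntegral_congr_fun measurableSet_Icc fun x hx => ?_
  have h1 : 0 ≤ 1 + x := by linarith [hx.1]
  have h2 := Real.log_nonneg (by norm_num : (1 : ℝ) ≤ 2)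
  exact congrArg (· • f x) (ENNReal.toReal_ofReal (by positivity))

/-- Normalization of a Lipschitz function on `[0, 1]` to one with values in `[0, 1]` and Lipschitz
constant `1`. -/
lemma average_estimate {p : ℕ} {y : ℕ → ℝ} {E : ℝ} (hp : 0 < p)
    (hy : ∀ k, y k ∈ Set.Ioo (0 : ℝ) 1)
    (hE : ∀ f : ℝ → ℝ, (∀ x, f x ∈ Set.Icc (0 : ℝ) 1) → (∀ x y, |f x - f y| ≤ |x - y|) →
      |(∑ k ∈ Finset.range p, f (y k)) / p -
        (∫ x in Set.Icc (0 : ℝ) 1, f x / (1 + x)) / Real.log 2| ≤ E)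
    {M : ℝ} (hM : 0 < M) {f : ℝ → ℝ} (hf : ∀ x ∈ Set.Icc (0 : ℝ) 1, |f x| ≤ M)
    (hlip : ∀ x ∈ Set.Icc (0 : ℝ) 1, ∀ y ∈ Set.Icc (0 : ℝ) 1, |f x - f y| ≤ M * |x - y|) :
    |(∑ k ∈ Finset.range p, f (y k)) / p -
        (∫ x in Set.Icc (0 : ℝ) 1, f x / (1 + x)) / Real.log 2| ≤ 2 * M * E := by
  set P : ℝ → ℝ := fun x => Set.projIcc (0 : ℝ) 1 zero_le_one x with hP
  have hPmem : ∀ x, P x ∈ Set.Icc (0 : ℝ) 1 := fun x => Subtype.coe_prop _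
  have hPid : ∀ x ∈ Set.Icc (0 : ℝ) 1, P x = x := fun x hx => by
    simp only [hP]; rw [Set.projIcc_of_mem _ hx]
  have hPlip : ∀ x y, |P x - P y| ≤ |x - y| := fun x y => Set.abs_projIcc_sub_projIcc zero_le_one
  have hlog : 0 < Real.log 2 := Real.log_pos (by norm_num)
  have hcont : ContinuousOn f (Set.Icc 0 1) := by
    refine (LipschitzOnWith.of_dist_le_mul (K := M.toNNReal) fun x hx y hy => ?_).continuousOn
    rw [Real.coe_toNNReal _ hM.le]
    exact hlip x hx y hy
  have key := hE (fun x => (f (P x) / M + 1) / 2) (fun x => by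
      have := abs_le.1 (hf _ (hPmem x))
      have h1 : -1 ≤ f (P x) / M := by rw [le_div_iff₀ hM]; linarith [this.1]
      have h2 : f (P x) / M ≤ 1 := by rw [div_le_iff₀ hM]; linarith [this.2]
      constructor <;> linarith) (fun x y => by
      rw [show (f (P x) / M + 1) / 2 - (f (P y) / M + 1) / 2 = (f (P x) - f (P y)) / (2 * M) by
        field_simp; ring, abs_div, abs_of_pos (by positivity : 0 < 2 * M),
        div_le_iff₀ (by positivity)]
      have h1 := hlip _ (hPmem x) _ (hPmem y)
      have h2 := mul_le_mul_of_nonneg_left (hPlip x y) hM.le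
      nlinarith [mul_nonneg hM.le (abs_nonneg (x - y))])
  have hI : ∫ x in Set.Icc (0 : ℝ) 1, (f (P x) / M + 1) / 2 / (1 + x) =
      (2 * M)⁻¹ * (∫ x in Set.Icc (0 : ℝ) 1, f x / (1 + x)) + 2⁻¹ * Real.log 2 := by
    rw [← integral_one_div_one_add, ← integral_const_mul, ← integral_const_mul,
      ← integral_add ((integrableOn_div_one_add hcont).const_mul _)
        ((integrableOn_div_one_add (f := fun _ => 1) continuousOn_const).const_mul _)]
    refine setIntegral_congr_fun measurableSet_Icc fun x hx => ?_
    change (f (P x) / M + 1) / 2 / (1 + x) =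
      (2 * M)⁻¹ * (f x / (1 + x)) + 2⁻¹ * (1 / (1 + x))
    rw [hPid x hx]
    have : 1 + x ≠ 0 := by linarith [hx.1]
    field_simp
  have hS : ∑ k ∈ Finset.range p, (f (P (y k)) / M + 1) / 2 =
      (2 * M)⁻¹ * (∑ k ∈ Finset.range p, f (y k)) + 2⁻¹ * p := by
    rw [Finset.mul_sum, ← mul_one (p : ℝ), ← nsmul_eq_mul, ← Finset.card_range p,
      ← Finset.sum_const, Finset.mul_sum, Finset.card_range, ← Finset.sum_add_distrib]
    refine Finset.sum_congr rfl fun k _ => ?_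
    rw [hPid _ ⟨(hy k).1.le, (hy k).2.le⟩]
    field_simp
  rw [hI, hS] at key
  have hp' : (p : ℝ) ≠ 0 := by exact_mod_cast hp.ne'
  set S := ∑ k ∈ Finset.range p, f (y k)
  set I := ∫ x in Set.Icc (0 : ℝ) 1, f x / (1 + x)
  have e : ((2 * M)⁻¹ * S + 2⁻¹ * p) / p - ((2 * M)⁻¹ * I + 2⁻¹ * Real.log 2) / Real.log 2 =
      (S / p - I / Real.log 2) / (2 * M) := by
    field_simp; ring
  rw [e, abs_div, abs_of_pos (by positivity : 0 < 2 * M), div_le_iff₀ (by positivity)] at key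
  linarith

lemma inv_sqrt_le_rpow {T ε : ℝ} (hT : 1 ≤ T) (hε : 0 < ε) :
    (√T)⁻¹ ≤ T ^ (-(1 / 3 : ℝ) + ε) := by
  rw [Real.sqrt_eq_rpow, ← Real.rpow_neg (by linarith)]
  exact Real.rpow_le_rpow_of_exponent_le hT (by linarith)

lemma norm_le_supNorm01 {f : ℝ → ℂ} (hf : ContinuousOn f (Set.Icc 0 1)) {x : ℝ}
    (hx : x ∈ Set.Icc (0 : ℝ) 1) : ‖f x‖ ≤ supNorm01 f := by
  have hb : BddAbove (Set.range fun x : Set.Icc (0 : ℝ) 1 => ‖f x‖) := by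
    have := (isCompact_Icc.image_of_continuousOn hf.norm).bddAbove
    rwa [Set.image_eq_range] at this
  exact le_ciSup hb (⟨x, hx⟩ : Set.Icc (0 : ℝ) 1)

/-- The complex-valued form of `average_estimate`. -/
lemma norm_average_estimate {p : ℕ} {y : ℕ → ℝ} {E : ℝ} (hp : 0 < p)
    (hy : ∀ k, y k ∈ Set.Ioo (0 : ℝ) 1)
    (hE : ∀ f : ℝ → ℝ, (∀ x, f x ∈ Set.Icc (0 : ℝ) 1) → (∀ x y, |f x - f y| ≤ |x - y|) →
      |(∑ k ∈ Finset.range p, f (y k)) / p -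
        (∫ x in Set.Icc (0 : ℝ) 1, f x / (1 + x)) / Real.log 2| ≤ E)
    {κ : ℝ≥0} {f : ℝ → ℂ} (hκ : 0 < κ) (hf : LipschitzOnWith κ f (Set.Icc 0 1)) :
    ‖(p : ℂ)⁻¹ * ∑ k ∈ Finset.range p, f (y k) -
      ∫ x in Set.Icc (0 : ℝ) 1, (1 / (Real.log 2 * (1 + x))) • f x‖ ≤
        4 * max (supNorm01 f) κ * E := by
  set M := max (supNorm01 f) κ with hM
  have hM0 : 0 < M := lt_max_of_lt_right (by exact_mod_cast hκ)
  have hcont := hf.continuousOn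
  have hint : IntegrableOn (fun x : ℝ => (1 / (Real.log 2 * (1 + x))) • f x) (Set.Icc 0 1) := by
    have hlog : 0 < Real.log 2 := Real.log_pos (by norm_num)
    have hw : ContinuousOn (fun x : ℝ => 1 / (Real.log 2 * (1 + x))) (Set.Icc 0 1) := ?_
    · exact (hw.smul hcont).integrableOn_compact isCompact_Icc
    refine continuousOn_const.div (by fun_prop) fun x hx => mul_ne_zero hlog.ne' ?_
    linarith [hx.1]
  have hnorm : ∀ x ∈ Set.Icc (0 : ℝ) 1, ‖f x‖ ≤ M := fun x hx =>
    (norm_le_supNorm01 hcont hx).trans (le_max_left _ _)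
  have hlip : ∀ x ∈ Set.Icc (0 : ℝ) 1, ∀ y ∈ Set.Icc (0 : ℝ) 1, ‖f x - f y‖ ≤ M * |x - y| := by
    intro x hx y hy
    have := hf.dist_le_mul x hx y hy
    rw [dist_eq_norm, Real.dist_eq] at this
    exact this.trans (mul_le_mul_of_nonneg_right (le_max_right _ _) (abs_nonneg _))
  -- both the real and the imaginary part satisfy the real estimate
  have part : ∀ Λ : ℂ →L[ℝ] ℝ, (∀ z, |Λ z| ≤ ‖z‖) →
      |Λ ((p : ℂ)⁻¹ * ∑ k ∈ Finset.range p, f (y k) -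
        ∫ x in Set.Icc (0 : ℝ) 1, (1 / (Real.log 2 * (1 + x))) • f x)| ≤ 2 * M * E := by
    intro Λ hΛ
    have h1 := average_estimate hp hy hE hM0 (f := fun x => Λ (f x))
      (fun x hx => (hΛ _).trans (hnorm x hx))
      (fun x hx y hy => by rw [← map_sub]; exact (hΛ _).trans (hlip x hx y hy))
    convert h1 using 2
    rw [map_sub, ← ContinuousLinearMap.integral_comp_comm Λ hint, ← integral_div]
    congr 1
    · rw [show (p : ℂ)⁻¹ * ∑ k ∈ Finset.range p, f (y k) =
        (p : ℝ)⁻¹ • ∑ k ∈ Finset.range p, f (y k) by rw [Complex.real_smul]; simp,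
        map_smul, map_sum, smul_eq_mul, div_eq_inv_mul]
    · refine setIntegral_congr_fun measurableSet_Icc fun x _ => ?_
      simp only [map_smul, smul_eq_mul]
      rw [div_div, mul_comm (1 + x), one_div_mul_eq_div]
  refine (Complex.norm_le_abs_re_add_abs_im _).trans ?_
  have h1 := part Complex.reCLM fun z => Complex.abs_re_le_norm z
  have h2 := part Complex.imCLM fun z => Complex.abs_im_le_norm z
  simp only [Complex.reCLM_apply, Complex.imCLM_apply] at h1 h2
  linarith

end CFGeodesic

end

theorem theorem7p5 :
    ∃ c₀ : ℝ, 0 < c₀ ∧ ∀ Q : CFGeodesic.InvInnerProduct, ∃ T₀ : ℝ, 1 < T₀ ∧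
      ∀ ε : ℝ, 0 < ε → ∃ C : ℝ, 0 < C ∧
        ∀ (α : CFGeodesic.QI) (T : ℝ), T₀ < T → CFGeodesic.ApproxHaar Q α T →
          (∀ (κ : ℝ≥0) (f : ℝ → ℂ), 0 < κ → LipschitzOnWith κ f (Set.Icc 0 1) →
            ‖(∫ x in Set.Icc 0 1, f x ∂(CFGeodesic.nuPeriod α))
                - ∫ x in Set.Icc 0 1, f x ∂CFGeodesic.nuGauss‖
              ≤ C * max (CFGeodesic.supNorm01 f) κ * T ^ (-(1 / 3 : ℝ) + ε)) ∧
          |((CFGeodesic.cfPeriod α).ncard : ℝ) / CFGeodesic.tLength α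
              - 1 / (CFGeodesic.parityIndex α * c₀)| ≤ C * T ^ (-(1 / 3 : ℝ) + ε) := by
  have hlog : 0 < Real.log 2 := Real.log_pos (by norm_num)
  refine ⟨Real.pi ^ 2 / (6 * Real.log 2), by positivity, fun Q => ⟨16, by norm_num, ?_⟩⟩
  obtain ⟨C, hC, hest⟩ := CFGeodesic.exists_count_estimates Q
  refine fun ε hε => ⟨4 * C, by positivity, fun α T hT happ => ?_⟩
  obtain ⟨g, p, u, v, ℓ, h, hx, hcf⟩ := CFGeodesic.exists_closedRed_of_QI α
  obtain ⟨hcount, hmean⟩ := hest α T hT happ h hx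
  have hpow := CFGeodesic.inv_sqrt_le_rpow (by linarith : 1 ≤ T) hε
  have hpow0 : 0 ≤ (√T)⁻¹ := by positivity
  refine ⟨fun κ f hκ hf => ?_, ?_⟩
  · rw [CFGeodesic.integral_nuPeriod h hcf, CFGeodesic.integral_nuGauss]
    refine (CFGeodesic.norm_average_estimate h.pos h.mem hmean hκ hf).trans ?_
    have hM : 0 ≤ max (CFGeodesic.supNorm01 f) κ := le_max_of_le_right κ.2
    calc 4 * max (CFGeodesic.supNorm01 f) κ * (C * (√T)⁻¹)
        = 4 * C * max (CFGeodesic.supNorm01 f) κ * (√T)⁻¹ := by ring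
      _ ≤ _ := by gcongr
  · have hn : (CFGeodesic.cfPeriod α).ncard = p := by
      rw [hcf, Set.InjOn.ncard_image h.inj, Set.ncard_coe_finset, Finset.card_range]
    have hj : (1 : ℝ) ≤ (if Even p then 1 else 2 : ℕ) := by split_ifs <;> norm_num
    have ht : CFGeodesic.tLength α = (if Even p then 1 else 2 : ℕ) * ℓ := by
      rw [CFGeodesic.tLength, hx, h.orbitLength_eq]
    rw [CFGeodesic.parityIndex, hn, ht]
    set j : ℝ := ((if Even p then 1 else 2 : ℕ) : ℝ) with hjd
    have hℓ := h.length_pos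
    have e : (p : ℝ) / (j * ℓ) - 1 / (j * (Real.pi ^ 2 / (6 * Real.log 2))) =
        (p / ℓ - 6 / Real.pi ^ 2 * Real.log 2) / j := by
      have := Real.pi_pos
      field_simp
    rw [e, abs_div, abs_of_pos (by linarith : 0 < j)]
    calc |p / ℓ - 6 / Real.pi ^ 2 * Real.log 2| / j
        ≤ |p / ℓ - 6 / Real.pi ^ 2 * Real.log 2| := div_le_self (abs_nonneg _) hj
      _ ≤ C * (√T)⁻¹ := hcount
      _ ≤ 4 * C * T ^ (-(1 / 3 : ℝ) + ε) := by gcongr; linarith
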